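/- **Conventions.** Let $\{G_n\}_{n\in\omega}$ be groups, regarded as sharing only their identity element. A *word* is a function $W:\overline W\to\bigcup_n G_n$ on a totally ordered set $\overline W$ such that $\{i: W(i)\in G_n\}$ is finite for every $n$. Write $W\equiv V$ if there is an order isomorphism $\overline W\to\overline V$ preserving letters; $E$ is the empty word; $WV$ is the concatenation; $W^{-1}$ is obtained by reversing the order and inverting the letters. For $N\in\omega$ let $p_N(W)$ be the finite word of those letters of $W$ that lie in $G_0\cup\dots\cup G_N$; write $W\sim V$ if $p_N(W)=p_N(V)$ in the free product $*_{n\le N}G_n$ for all $N$. The words modulo $\sim$ form a group under concatenation. $V$ is a *subword* of $W$ if $W\equiv W_0VW_2$ for some words $W_0,W_2$. $W$ is *reduced* if its only subword $\sim E$ is $E$ and no two neighbouring letters lie in a common $G_n$. Every $\sim$-class contains a unique reduced word up to $\equiv$, so the set $\mathrm{Red}(\{G_n\})$ of reduced words is identified with this group. For a collection $\{W_x\}_{x\in X}$ of reduced words, $\mathrm{Fine}(\{W_x\}_{x\in X})$ is the subgroup generated by all subwords of the $W_x$. Let $\mathcal A(\{G_n\})$ be the quotient of $\mathrm{Red}(\{G_n\})$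 by the normal closure of the finite words, and $[[W]]$ the class of $W$ in it. An *interval* of a totally ordered set is an order-convex subset. A subset $\Lambda_0\subseteq\Lambda$ is *close* in $\Lambda$ if it meets every infinite interval of $\Lambda$. A *coi* from $\Lambda$ to $\Theta$ is an order isomorphism $\iota:\Lambda_0\to\Theta_0$ with $\Lambda_0$ close in $\Lambda$ and $\Theta_0$ close in $\Theta$; for an interval $I\subseteq\Lambda$, $\varpropto(I,\iota)$ is the smallest interval of $\Theta$ that includes $\iota(I\cap\Lambda_0)$. A *coi triple* $\mathrm{coi}(W,\iota,U)$ from $\mathrm{Red}(\{G_n\})$ to $\mathrm{Red}(\{K_n\})$ consists of reduced words $W\in\mathrm{Red}(\{G_n\})$, $U\in\mathrm{Red}(\{K_n\})$ and a coi $\iota$ from $\overline W$ to $\overline U$ (a coi from $W$ to $U$, for short). A collection $\{\mathrm{coi}(W_x,\iota_x,U_x)\}_{x\in X}$ is *coherent* if for all $x,y\in X$ and $\delta\in\{1,-1\}$: - for all intervals $I\subseteq\overline{W_x}$, $J\subseteq\overline{W_y}$ with $W_x\upharpoonright I\equiv(W_y\upharpoonright J)^\delta$ we have $[[U_x\upharpoonright\varpropto(I,\iota_x)]]=[[(U_y\upharpoonright\varpropto(J,\iota_y))^\delta]]$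 in $\mathcal A(\{K_n\})$; - for all intervals $I\subseteq\overline{U_x}$, $J\subseteq\overline{U_y}$ with $U_x\upharpoonright I\equiv(U_y\upharpoonright J)^\delta$ we have $[[W_x\upharpoonright\varpropto(I,\iota_x^{-1})]]=[[(W_y\upharpoonright\varpropto(J,\iota_y^{-1}))^\delta]]$ in $\mathcal A(\{G_n\})$. **Proposition.** Let $\{G_n\}_{n\in\omega}$ and $\{K_n\}_{n\in\omega}$ be sequences of groups without elements of order $2$, each group having an element of infinite order. Let $\{\mathrm{coi}(W_x,\iota_x,U_x)\}_{x\in X}$ be a coherent collection of coi triples from $\mathrm{Red}(\{G_n\})$ to $\mathrm{Red}(\{K_n\})$ with $|X|<2^{\aleph_0}$. 1. Let $W\in\mathrm{Red}(\{G_n\})$ be such that $\overline W=\prod_{s\in\mathbb Q}I_s$ (that is, $\overline W=\bigcup_{s\in\mathbb{Q}} I_s$ and every element of $I_s$ is below every element of $I_t$ whenever $s<t$) with each $I_s\ne\emptyset$, with $W\upharpoonright I_s\in\mathrm{Fine}(\{W_x\}_{x\in X})$ for each $s\in\mathbb Q$, and with $W\upharpoonright\bigcup_{s\in\Lambda}I_s\notin\mathrm{Fine}(\{W_x\}_{x\in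 X})$ for each interval $\Lambda\subseteq\mathbb Q$ with more than one point. Then there exist $U\in\mathrm{Red}(\{K_n\})$ and a coi $\iota$ from $W$ to $U$ such that $\{\mathrm{coi}(W_x,\iota_x,U_x)\}_{x\in X}\cup\{\mathrm{coi}(W,\iota,U)\}$ is coherent. 2. Let $U\in\mathrm{Red}(\{K_n\})$ be such that $\overline U=\prod_{s\in\mathbb Q}I_s$ (in the same sense) with each $I_s\ne\emptyset$, with $U\upharpoonright I_s\in\mathrm{Fine}(\{U_x\}_{x\in X})$ for each $s\in\mathbb Q$, and with $U\upharpoonright\bigcup_{s\in\Lambda}I_s\notin\mathrm{Fine}(\{U_x\}_{x\in X})$ for each interval $\Lambda\subseteq\mathbb Q$ with more than one point. Then there exist $W\in\mathrm{Red}(\{G_n\})$ and a coi $\iota$ from $W$ to $U$ such that $\{\mathrm{coi}(W_x,\iota_x,U_x)\}_{x\in X}\cup\{\mathrm{coi}(W,\iota,U)\}$ is coherent. -/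

import Mathlib

open Monoid (CoprodI)

namespace InfWord

universe u v

/-! ### Words -/

/-- The group `G n`, regarded as a subgroup of the free product of all the `G m`. In this way
the groups `G n` share their identity element and have no other elements in common, and the
union of the `factor G n` is the set of letters. -/
def factor (G : ℕ → Type u) [∀ n, Group (G n)] (n : ℕ) : Subgroup (CoprodI G) :=
  (CoprodI.of : G n →* CoprodI G).range

/-- A word: a function from a totally ordered set to the letters such that for each `n` only
finitely many positions carry a letter of `G n`. The domain is then countable, so that domains in
`Type` represent all words up to isomorphism. -/
structure Word (G : ℕ → Type u) [∀ n, Group (G n)] where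
  dom : Type
  [ord : LinearOrder dom]
  letter : dom → CoprodI G
  exists_mem : ∀ i, ∃ n, letter i ∈ factor G n
  finite_mem : ∀ n, {i | letter i ∈ factor G n}.Finite

attribute [instance] Word.ord

namespace Word

variable {G : ℕ → Type u} [∀ n, Group (G n)]

/-- `W ≡ V`: the words are the same up to an order isomorphism of their domains. -/
def Equi (W V : Word G) : Prop :=
  ∃ e : W.dom ≃o V.dom, ∀ i, W.letter i = V.letter (e i)

/-- The empty word. -/
def empty (G : ℕ → Type u) [∀ n, Group (G n)] : Word G where
  dom := Empty
  letter := Empty.elim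
  exists_mem i := i.elim
  finite_mem _ := Set.toFinite _

/-- The concatenation `W V`. -/
def concat (W V : Word G) : Word G where
  dom := W.dom ⊕ₗ V.dom
  letter i := Sum.elim W.letter V.letter (ofLex i)
  exists_mem i := by
    rcases h : ofLex i with a | a
    · simpa using W.exists_mem a
    · simpa using V.exists_mem a
  finite_mem n := by
    refine (((W.finite_mem n).image (fun a => toLex (Sum.inl a))).union
      ((V.finite_mem n).image (fun a => toLex (Sum.inr a)))).subset ?_
    rintro (a | a) hi
    · exact Or.inl ⟨a, hi, rfl⟩
    · exact Or.inr ⟨a, hi, rfl⟩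

/-- The inverse word: reverse the domain and invert the letters. -/
def inv (W : Word G) : Word G where
  dom := W.domᵒᵈ
  letter i := (W.letter (OrderDual.ofDual i))⁻¹
  exists_mem i := by
    obtain ⟨n, hn⟩ := W.exists_mem (OrderDual.ofDual i)
    exact ⟨n, inv_mem hn⟩
  finite_mem n := by
    refine ((W.finite_mem n).image OrderDual.toDual).subset ?_
    intro i hi
    exact ⟨OrderDual.ofDual i, (factor G n).inv_mem_iff.1 hi, rfl⟩

/-- `W ^ δ` for a sign `δ ∈ {-1, 1}`. -/
def signPow (W : Word G) (δ : ℤˣ) : Word G := if δ = 1 then W else W.inv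

/-- The restriction `W ↾ S` to a set of positions. -/
def restrict (W : Word G) (S : Set W.dom) : Word G where
  dom := S
  letter i := W.letter i
  exists_mem i := W.exists_mem i
  finite_mem n := Set.Finite.preimage (f := Subtype.val) Subtype.val_injective.injOn (W.finite_mem n)

/-- `V` is a subword of `W`: one can write `W ≡ W₀ V W₂`. -/
def IsSubword (V W : Word G) : Prop :=
  ∃ W₀ W₂ : Word G, W.Equi ((W₀.concat V).concat W₂)

theorem finite_le (W : Word G) (N : ℕ) :
    {i | ∃ n ≤ N, W.letter i ∈ factor G n}.Finite := by
  refine ((Set.finite_Iic N).biUnion (fun n _ => W.finite_mem n)).subset ?_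
  rintro i ⟨n, hn, hi⟩
  exact Set.mem_biUnion (Set.mem_Iic.2 hn) hi

/-- The finitely many positions of the truncated word `p_N(W)`. -/
noncomputable def truncDom (W : Word G) (N : ℕ) : Finset W.dom := (W.finite_le N).toFinset

/-- The element of the free product represented by the finite word `p_N(W)`: the product of its
letters in increasing order of position. It lies in the free factor `*_{n ≤ N} G n`. -/
noncomputable def trunc (W : Word G) (N : ℕ) : CoprodI G :=
  (((W.truncDom N).sort (· ≤ ·)).map W.letter).prod

/-- `W ∼ V`: for every `N` the words `p_N(W)` and `p_N(V)` are equal in the free product. -/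
def Sim (W V : Word G) : Prop := ∀ N, W.trunc N = V.trunc N

/-- `W` is reduced: only the empty subword is `∼` to the empty word, and neighbouring letters
never belong to a common group. -/
def IsReduced (W : Word G) : Prop :=
  (∀ W₀ W₁ W₂ : Word G, W.Equi ((W₀.concat W₁).concat W₂) →
    W₁.Sim (empty G) → W₁.Equi (empty G)) ∧
  ∀ i j : W.dom, i ⋖ j → ∀ n, ¬ (W.letter i ∈ factor G n ∧ W.letter j ∈ factor G n)

theorem mem_truncDom (W : Word G) (N : ℕ) (i : W.dom) :
    i ∈ W.truncDom N ↔ ∃ n ≤ N, W.letter i ∈ factor G n := by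
  simp [truncDom]

theorem trunc_empty (N : ℕ) : (empty G).trunc N = 1 := by
  have h : (empty G).truncDom N = ∅ := Finset.eq_empty_of_forall_notMem (fun i => i.elim)
  simp [trunc, h]

/-- A strictly increasing list of the truncated positions computes the truncation. -/
theorem trunc_eq (W : Word G) (N : ℕ) (l : List W.dom) (hl : l.Pairwise (· < ·))
    (hm : ∀ i, i ∈ l ↔ i ∈ W.truncDom N) : W.trunc N = (l.map W.letter).prod := by
  have hs : (W.truncDom N).sort (· ≤ ·) = l := by
    refine List.Perm.eq_of_pairwise (le := (· ≤ ·)) (fun a b _ _ h1 h2 => le_antisymm h1 h2)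
      (Finset.pairwise_sort _ _) (hl.imp le_of_lt) ?_
    rw [List.perm_ext_iff_of_nodup (Finset.sort_nodup _ _) (hl.imp ne_of_lt)]
    intro i
    rw [Finset.mem_sort, hm]
  rw [trunc, hs]

theorem sort_pairwise (W : Word G) (N : ℕ) :
    ((W.truncDom N).sort (· ≤ ·)).Pairwise (· < ·) :=
  (Finset.sortedLT_sort _).pairwise

/-- The positions of `W` in `W V`. -/
def inL (W V : Word G) (a : W.dom) : (W.concat V).dom := toLex (Sum.inl a)

/-- The positions of `V` in `W V`. -/
def inR (W V : Word G) (a : V.dom) : (W.concat V).dom := toLex (Sum.inr a)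

/-- The positions of `W` in the inverse word. -/
def toInv (W : Word G) (a : W.dom) : W.inv.dom := OrderDual.toDual a

theorem trunc_concat (W V : Word G) (N : ℕ) :
    (W.concat V).trunc N = W.trunc N * V.trunc N := by
  rw [trunc_eq (W.concat V) N
    (((W.truncDom N).sort (· ≤ ·)).map (inL W V) ++
      ((V.truncDom N).sort (· ≤ ·)).map (inR W V))]
  · rw [List.map_append, List.prod_append, List.map_map, List.map_map]
    rfl
  · rw [List.pairwise_append, List.pairwise_map, List.pairwise_map]
    refine ⟨(W.sort_pairwise N).imp (fun h => Sum.Lex.inl_lt_inl_iff.2 h),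
      (V.sort_pairwise N).imp (fun h => Sum.Lex.inr_lt_inr_iff.2 h), ?_⟩
    intro a ha b hb
    obtain ⟨x, -, rfl⟩ := List.mem_map.1 ha
    obtain ⟨y, -, rfl⟩ := List.mem_map.1 hb
    exact Sum.Lex.inl_lt_inr _ _
  · intro i
    rw [mem_truncDom, List.mem_append, List.mem_map, List.mem_map]
    simp only [Finset.mem_sort, mem_truncDom]
    constructor
    · rintro (⟨a, ha, rfl⟩ | ⟨a, ha, rfl⟩) <;> exact ha
    · intro h
      rcases i with a | a
      · exact Or.inl ⟨a, h, rfl⟩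
      · exact Or.inr ⟨a, h, rfl⟩

theorem trunc_inv (W : Word G) (N : ℕ) : W.inv.trunc N = (W.trunc N)⁻¹ := by
  rw [trunc_eq W.inv N
    ((((W.truncDom N).sort (· ≤ ·)).map W.toInv).reverse)]
  · rw [trunc, List.prod_inv_reverse, List.map_reverse, List.map_map, List.map_map]
    rfl
  · rw [List.pairwise_reverse, List.pairwise_map]
    exact (W.sort_pairwise N).imp (fun h => OrderDual.toDual_lt_toDual.2 h)
  · intro i
    rw [mem_truncDom, List.mem_reverse, List.mem_map]
    simp only [Finset.mem_sort, mem_truncDom]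
    constructor
    · rintro ⟨a, ⟨n, hn, ha⟩, rfl⟩
      exact ⟨n, hn, inv_mem ha⟩
    · rintro ⟨n, hn, ha⟩
      exact ⟨OrderDual.ofDual i, ⟨n, hn, inv_mem_iff.1 ha⟩, rfl⟩

/-- The equivalence relation `∼` on words. -/
def simSetoid (G : ℕ → Type u) [∀ n, Group (G n)] : Setoid (Word G) where
  r := Sim
  iseqv := ⟨fun _ _ => rfl, fun h N => (h N).symm, fun h k N => (h N).trans (k N)⟩

end Word

/-! ### The topologist's product and its quotient by the finite words -/

/-- The topologist's product: words modulo `∼`. Each class contains exactly one reduced word up to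
`≡`, so this group is canonically the group of reduced words. -/
def TopProd (G : ℕ → Type u) [∀ n, Group (G n)] : Type (max 1 u) := Quotient (Word.simSetoid G)

section

variable {G : ℕ → Type u} [∀ n, Group (G n)]

/-- The class of a word in the topologist's product. -/
def Word.cls (W : Word G) : TopProd G := Quotient.mk (Word.simSetoid G) W

/-- Multiplication is concatenation, inversion is word inversion, the identity is the empty
word. -/
instance : Group (TopProd G) where
  mul := Quotient.map₂ Word.concat (fun a b h c d k N => by
    rw [Word.trunc_concat, Word.trunc_concat, h N, k N])
  one := (Word.empty G).cls
  inv := Quotient.map Word.inv (fun a b h N => by rw [Word.trunc_inv, Word.trunc_inv, h N])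
  mul_assoc := by
    rintro ⟨a⟩ ⟨b⟩ ⟨c⟩
    exact Quotient.sound (fun N => by simp only [Word.trunc_concat, mul_assoc])
  one_mul := by
    rintro ⟨a⟩
    exact Quotient.sound (fun N => by rw [Word.trunc_concat, Word.trunc_empty, one_mul])
  mul_one := by
    rintro ⟨a⟩
    exact Quotient.sound (fun N => by rw [Word.trunc_concat, Word.trunc_empty, mul_one])
  inv_mul_cancel := by
    rintro ⟨a⟩
    exact Quotient.sound (fun N => by
      rw [Word.trunc_concat, Word.trunc_inv, Word.trunc_empty, inv_mul_cancel])

/-- `Fine({W_x})`: the subgroup generated by all subwords of the words `W_x`. -/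
def Fine {X : Type*} (W : X → Word G) : Subgroup (TopProd G) :=
  Subgroup.closure {g | ∃ x, ∃ V : Word G, V.IsSubword (W x) ∧ V.cls = g}

/-- The normal closure of the set of classes of finite words. -/
def finiteNormal (G : ℕ → Type u) [∀ n, Group (G n)] : Subgroup (TopProd G) :=
  Subgroup.normalClosure {g | ∃ V : Word G, Finite V.dom ∧ V.cls = g}

instance : (finiteNormal G).Normal := Subgroup.normalClosure_normal

/-- The group `𝒜({G_n})`, the topologist's product modulo the finite words. -/
abbrev Arch (G : ℕ → Type u) [∀ n, Group (G n)] : Type (max 1 u) := TopProd G ⧸ finiteNormal G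

/-- `[[W]]`, the class of the word `W` in `𝒜({G_n})`. -/
def Word.archCls (W : Word G) : Arch G := QuotientGroup.mk W.cls

end

/-! ### Close order isomorphisms -/

/-- `S` is close in `Λ`: it meets every infinite interval (order-convex subset) of `Λ`. -/
def Close {Λ : Type*} [LinearOrder Λ] (S : Set Λ) : Prop :=
  ∀ I : Set Λ, I.OrdConnected → I.Infinite → (I ∩ S).Nonempty

/-- A close order isomorphism (coi) from `Λ` to `Θ`. -/
structure Coi (Λ Θ : Type*) [LinearOrder Λ] [LinearOrder Θ] where
  source : Set Λ
  target : Set Θ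
  close_source : Close source
  close_target : Close target
  iso : source ≃o target

namespace Coi

variable {Λ Θ : Type*} [LinearOrder Λ] [LinearOrder Θ]

/-- The inverse coi. -/
def symm (ι : Coi Λ Θ) : Coi Θ Λ where
  source := ι.target
  target := ι.source
  close_source := ι.close_target
  close_target := ι.close_source
  iso := ι.iso.symm

/-- `∝(I, ι)`, the smallest interval of `Θ` which includes `ι(I ∩ source)`. -/
def hull (ι : Coi Λ Θ) (I : Set Λ) : Set Θ :=
  {θ | ∃ a b : ι.source, (a : Λ) ∈ I ∧ (b : Λ) ∈ I ∧ (ι.iso a : Θ) ≤ θ ∧ θ ≤ ι.iso b}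

end Coi

/-- A coi triple: reduced words `W`, `U` and a coi from the domain of `W` to that of `U`. -/
structure CoiTriple (G : ℕ → Type u) (K : ℕ → Type v) [∀ n, Group (G n)]
    [∀ n, Group (K n)] where
  W : Word G
  U : Word K
  reducedW : W.IsReduced
  reducedU : U.IsReduced
  coi : Coi W.dom U.dom

/-- Coherence of a collection of coi triples. -/
def Coherent {G : ℕ → Type u} {K : ℕ → Type v} [∀ n, Group (G n)] [∀ n, Group (K n)]
    (T : Set (CoiTriple G K)) : Prop :=
  (∀ s ∈ T, ∀ t ∈ T, ∀ (I : Set s.W.dom) (J : Set t.W.dom) (δ : ℤˣ),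
    I.OrdConnected → J.OrdConnected →
    (s.W.restrict I).Equi ((t.W.restrict J).signPow δ) →
    (s.U.restrict (s.coi.hull I)).archCls =
      ((t.U.restrict (t.coi.hull J)).signPow δ).archCls) ∧
  (∀ s ∈ T, ∀ t ∈ T, ∀ (I : Set s.U.dom) (J : Set t.U.dom) (ε : ℤˣ),
    I.OrdConnected → J.OrdConnected →
    (s.U.restrict I).Equi ((t.U.restrict J).signPow ε) →
    (s.W.restrict (s.coi.symm.hull I)).archCls =
      ((t.W.restrict (t.coi.symm.hull J)).signPow ε).archCls)

/-- `Λ` is the concatenation `∏_{s ∈ ℚ} I_s`: the sets `I_s` cover `Λ`, and all elements of `I_s`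
lie below all elements of `I_t` when `s < t`. In particular they are pairwise disjoint
intervals. -/
def IsRatConcat {Λ : Type*} [LinearOrder Λ] (I : ℚ → Set Λ) : Prop :=
  (⋃ s, I s) = Set.univ ∧ ∀ s t, s < t → ∀ a ∈ I s, ∀ b ∈ I t, a < b

/-- The word `W` is a `ℚ`-indexed concatenation of the nonempty blocks `W ↾ I_s`, each block lies
in `H`, and no concatenation of the blocks over an interval of `ℚ` with more than one point
lies in `H`. -/
structure IsRatBlockDecomp {G : ℕ → Type u} [∀ n, Group (G n)] (W : Word G)
    (H : Subgroup (TopProd G)) (I : ℚ → Set W.dom) : Prop where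
  concat : IsRatConcat I
  nonempty : ∀ s, (I s).Nonempty
  mem : ∀ s, (W.restrict (I s)).cls ∈ H
  notMem : ∀ Λ : Set ℚ, Λ.OrdConnected → Λ.Nontrivial → (W.restrict (⋃ s ∈ Λ, I s)).cls ∉ H

end InfWord

/-! Interchanging the two words of every triple exchanges the two parts, so a single construction is
needed (`Sys.exists_extension`): the word `W` is translated block by block.

A block of `W` lies in `Fine`. By `exists_pieces` such a reduced word is, but for finitely many
letters, a finite union of intervals that are copies, possibly inverted, of intervals of the given
words. Concatenating the corresponding intervals of the partner words translates the block
(`Sys.exists_isBlock`). Since finite words vanish in `Arch` and the translation of intervals is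
multiplicative (`Sys.Phi_union`), everything inside single blocks inherits coherence from the given
family (`Sys.CohOn.of_pieced`).

Equality modulo finite words does not survive infinite concatenation. Hence blocks that are equal or
inverse to each other must receive translations that are literally equal or inverse: one
representative per class is translated, and signed copies of the result are used throughout the
class. The sign is well defined because, without elements of order 2, a nonempty reduced word is
never its own inverse (`Word.exists_representatives`). An isomorphism between intervals that
respects the blocks then consists of two ends inside single blocks, where the inherited coherence
applies, and a middle made of full blocks, where the translations match exactly (`Sys.cohOn_self`).
That isomorphisms do respect the blocks (`Sys.IntrinsicBlocks`) follows for `W` from the assumption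
that no union of several blocks lies in `Fine`.

For the new word both reducedness and intrinsic blocks have to be arranged. Every nonempty
translated block contains two neighbouring placeholders, and all its letters of small index are
placeholders too. They are filled with powers of elements of infinite order, each placeholder using
a factor of its own and avoiding the finitely many values that other letters could cancel
(`Frame.exists_palette`).

Reducedness: a fresh letter can cancel only against copies of the same placeholder, so an innermost
cancellation of neighbouring placeholders exposes two mutually inverse blocks with a trivial stretch
between them (`Frame.Palette.exists_cancelling_blocks`). The same stretch of `W` would then be
trivial although `W` is reduced (`Frame.Palette.tr_eq_one`, `Frame.Palette.isReduced_word`).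

Intrinsic blocks: there are continuum many ways to choose the fresh letters along binary sequences.
A bad choice is recorded by some `x : X` and two positions of one word, and fewer than continuum
many such records exist; two sequences with the same record would have to agree
(`Frame.Palette.exists_intrinsicBlocks`).

The tool behind all arguments about cancellation is `Word.exists_cancellation`: the cancellation of
a trivial infinite word is a noncrossing partition of its positions, obtained as an ultrafilter
limit of the finite ones. -/

namespace InfWord

universe u v

/-! ### Ordered products over finite sets -/

section OrdProd

variable {α β : Type*} [LinearOrder α] [LinearOrder β] {M : Type*}

/-- The product of the values of `f` over `s`, taken in increasing order. -/
noncomputable def ordProd [Monoid M] (s : Finset α) (f : α → M) : M :=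
  ((s.sort (· ≤ ·)).map f).prod

theorem ordProd_eq [Monoid M] (s : Finset α) (f : α → M) (l : List α) (hl : l.Pairwise (· < ·))
    (hm : ∀ i, i ∈ l ↔ i ∈ s) : ordProd s f = (l.map f).prod := by
  have hs : s.sort (· ≤ ·) = l := by
    refine List.Perm.eq_of_pairwise (le := (· ≤ ·)) (fun a b _ _ h1 h2 => le_antisymm h1 h2)
      (Finset.pairwise_sort _ _) (hl.imp le_of_lt) ?_
    rw [List.perm_ext_iff_of_nodup (Finset.sort_nodup _ _) (hl.imp ne_of_lt)]
    intro i
    rw [Finset.mem_sort, hm]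
  rw [ordProd, hs]

theorem sort_pairwise_lt (s : Finset α) : (s.sort (· ≤ ·)).Pairwise (· < ·) :=
  (Finset.sortedLT_sort _).pairwise

@[simp] theorem ordProd_empty [Monoid M] (f : α → M) : ordProd ∅ f = 1 := by simp [ordProd]

@[simp] theorem ordProd_singleton [Monoid M] (a : α) (f : α → M) : ordProd {a} f = f a := by
  simp [ordProd]

theorem ordProd_union [Monoid M] [DecidableEq α] (s t : Finset α) (f : α → M)
    (h : ∀ a ∈ s, ∀ b ∈ t, a < b) : ordProd (s ∪ t) f = ordProd s f * ordProd t f := by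
  rw [ordProd_eq (s ∪ t) f (s.sort (· ≤ ·) ++ t.sort (· ≤ ·)), List.map_append, List.prod_append]
  · rfl
  · rw [List.pairwise_append]
    refine ⟨sort_pairwise_lt s, sort_pairwise_lt t, fun a ha b hb => ?_⟩
    rw [Finset.mem_sort] at ha hb
    exact h a ha b hb
  · intro i
    simp

theorem ordProd_congr [Monoid M] {s : Finset α} {f g : α → M} (h : ∀ a ∈ s, f a = g a) :
    ordProd s f = ordProd s g := by
  unfold ordProd
  congr 1
  refine List.map_congr_left fun a ha => h a ?_
  simpa using ha

theorem ordProd_image [Monoid M] [DecidableEq β] (s : Finset α) (g : α → β) (f : β → M)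
    (hg : ∀ a ∈ s, ∀ b ∈ s, a < b → g a < g b) :
    ordProd (s.image g) f = ordProd s (fun a => f (g a)) := by
  rw [ordProd_eq (s.image g) f ((s.sort (· ≤ ·)).map g), List.map_map]
  · rfl
  · rw [List.pairwise_map]
    refine (sort_pairwise_lt s).imp_of_mem ?_
    intro a b ha hb hab
    exact hg a (by simpa using ha) b (by simpa using hb) hab
  · intro i
    simp

theorem ordProd_image_anti [Group M] [DecidableEq β] (s : Finset α) (g : α → β) (f : β → M)
    (hg : ∀ a ∈ s, ∀ b ∈ s, a < b → g b < g a) :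
    ordProd (s.image g) f = (ordProd s (fun a => (f (g a))⁻¹))⁻¹ := by
  rw [ordProd_eq (s.image g) f ((s.sort (· ≤ ·)).map g).reverse, ordProd, List.prod_inv_reverse,
    List.map_map, List.map_reverse, List.map_map]
  · simp [Function.comp_def]
  · rw [List.pairwise_reverse, List.pairwise_map]
    refine (sort_pairwise_lt s).imp_of_mem ?_
    intro a b ha hb hab
    exact hg a (by simpa using ha) b (by simpa using hb) hab
  · intro i
    simp

theorem ordProd_split [Monoid M] [DecidableEq α] (s : Finset α) (f : α → M) {i : α} (hi : i ∈ s) :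
    ordProd s f = ordProd {a ∈ s | a < i} f * f i * ordProd {a ∈ s | i < a} f := by
  have h : s = ({a ∈ s | a < i} ∪ {i}) ∪ {a ∈ s | i < a} := by
    ext a
    simp only [Finset.mem_union, Finset.mem_filter, Finset.mem_singleton]
    constructor
    · intro ha
      rcases lt_trichotomy a i with h | h | h
      · exact Or.inl (Or.inl ⟨ha, h⟩)
      · exact Or.inl (Or.inr h)
      · exact Or.inr ⟨ha, h⟩
    · rintro ((h | rfl) | h)
      exacts [h.1, hi, h.1]
  conv_lhs => rw [h]
  rw [ordProd_union, ordProd_union, ordProd_singleton]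
  · intro a ha b hb
    simp only [Finset.mem_filter, Finset.mem_singleton] at ha hb
    exact hb ▸ ha.2
  · intro a ha b hb
    simp only [Finset.mem_filter, Finset.mem_union, Finset.mem_singleton] at ha hb
    rcases ha with ha | ha
    exacts [ha.2.trans hb.2, ha ▸ hb.2]

end OrdProd

/-! ### Maps that preserve or reverse the order according to a sign -/

section Signed

variable {α β γ : Type*} [LinearOrder α] [LinearOrder β] [LinearOrder γ]

/-- `a < b` or `b < a`, according to the sign. -/
def sLT (δ : ℤˣ) (a b : α) : Prop := if δ = 1 then a < b else b < a

@[simp] theorem sLT_one (a b : α) : sLT 1 a b ↔ a < b := by simp [sLT]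

@[simp] theorem sLT_neg_one (a b : α) : sLT (-1) a b ↔ b < a := by
  simp [sLT, show (-1 : ℤˣ) ≠ 1 by decide]

theorem sLT.ne {δ : ℤˣ} {a b : α} (h : sLT δ a b) : a ≠ b := by
  rcases Int.units_eq_one_or δ with rfl | rfl
  · exact ((sLT_one _ _).1 h).ne
  · exact ((sLT_neg_one _ _).1 h).ne'

/-- `f` is strictly monotone or antitone on `A`, according to the sign. -/
def SMono (δ : ℤˣ) (f : α → β) (A : Set α) : Prop :=
  ∀ a ∈ A, ∀ b ∈ A, a < b → sLT δ (f a) (f b)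

namespace SMono

variable {δ ε : ℤˣ} {f : α → β} {A B : Set α}

theorem mono (h : SMono δ f A) (hB : B ⊆ A) : SMono δ f B :=
  fun a ha b hb hab => h a (hB ha) b (hB hb) hab

theorem injOn (h : SMono δ f A) : Set.InjOn f A := by
  intro a ha b hb hab
  by_contra hne
  rcases lt_or_gt_of_ne hne with hlt | hlt
  · exact (h a ha b hb hlt).ne hab
  · exact (h b hb a ha hlt).ne hab.symm

theorem lt_iff (h : SMono 1 f A) {a b : α} (ha : a ∈ A) (hb : b ∈ A) : f a < f b ↔ a < b := by
  constructor
  · intro hab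
    by_contra hne
    rcases (not_lt.1 hne).lt_or_eq with hlt | rfl
    · exact lt_asymm hab ((sLT_one _ _).1 (h b hb a ha hlt))
    · exact lt_irrefl _ hab
  · exact fun hab => (sLT_one _ _).1 (h a ha b hb hab)

theorem lt_iff' (h : SMono (-1) f A) {a b : α} (ha : a ∈ A) (hb : b ∈ A) : f a < f b ↔ b < a := by
  constructor
  · intro hab
    by_contra hne
    rcases (not_lt.1 hne).lt_or_eq with hlt | rfl
    · exact lt_asymm hab ((sLT_neg_one _ _).1 (h a ha b hb hlt))
    · exact lt_irrefl _ hab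
  · exact fun hab => (sLT_neg_one _ _).1 (h b hb a ha hab)

theorem sLT_iff (h : SMono δ f A) {a b : α} (ha : a ∈ A) (hb : b ∈ A) :
    sLT ε (f a) (f b) ↔ sLT (ε * δ) a b := by
  rcases Int.units_eq_one_or δ with rfl | rfl
  · rcases Int.units_eq_one_or ε with rfl | rfl <;> simp [h.lt_iff, ha, hb]
  · rcases Int.units_eq_one_or ε with rfl | rfl <;> simp [h.lt_iff', ha, hb]

theorem comp {g : β → γ} (hg : SMono ε g (f '' A)) (h : SMono δ f A) :
    SMono (ε * δ) (fun a => g (f a)) A := by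
  intro a ha b hb hab
  rw [hg.sLT_iff ⟨a, ha, rfl⟩ ⟨b, hb, rfl⟩, h.sLT_iff ha hb]
  rcases Int.units_eq_one_or δ with rfl | rfl <;> rcases Int.units_eq_one_or ε with rfl | rfl <;>
    simpa

theorem invFunOn [Nonempty α] (h : SMono δ f A) : SMono δ (Function.invFunOn f A) (f '' A) := by
  rintro _ ⟨a, ha, rfl⟩ _ ⟨b, hb, rfl⟩ hab
  rw [h.injOn.leftInvOn_invFunOn ha, h.injOn.leftInvOn_invFunOn hb]
  rcases Int.units_eq_one_or δ with rfl | rfl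
  · simpa [h.lt_iff ha hb] using hab
  · simpa [h.lt_iff' ha hb] using hab

theorem between (h : SMono δ f A) {a b c : α} (ha : a ∈ A) (hb : b ∈ A) (hc : c ∈ A)
    (h1 : f a ≤ f c) (h2 : f c ≤ f b) : (a ≤ c ∧ c ≤ b) ∨ (b ≤ c ∧ c ≤ a) := by
  rcases Int.units_eq_one_or δ with rfl | rfl
  · left
    rw [← not_lt, ← not_lt, ← h.lt_iff hc ha, ← h.lt_iff hb hc, not_lt, not_lt]
    exact ⟨h1, h2⟩
  · right
    rw [← not_lt, ← not_lt, ← h.lt_iff' hc ha, ← h.lt_iff' hb hc, not_lt, not_lt]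
    exact ⟨h2, h1⟩

theorem ordConnected_image (h : SMono δ f A) (hfA : (f '' A).OrdConnected) (hB : B.OrdConnected)
    (hBA : B ⊆ A) : (f '' B).OrdConnected := by
  refine Set.ordConnected_def.2 ?_
  rintro _ ⟨a, ha, rfl⟩ _ ⟨b, hb, rfl⟩ z ⟨hz1, hz2⟩
  obtain ⟨c, hc, rfl⟩ := hfA.out ⟨a, hBA ha, rfl⟩ ⟨b, hBA hb, rfl⟩ ⟨hz1, hz2⟩
  refine ⟨c, ?_, rfl⟩
  rcases h.between (hBA ha) (hBA hb) hc hz1 hz2 with h3 | h3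
  · exact hB.out ha hb h3
  · exact hB.out hb ha h3

theorem ordConnected_preimage (h : SMono δ f A) (hA : A.OrdConnected) {C : Set β}
    (hC : C.OrdConnected) : (A ∩ f ⁻¹' C).OrdConnected := by
  refine Set.ordConnected_def.2 ?_
  rintro a ⟨ha, ha'⟩ b ⟨hb, hb'⟩ z ⟨hz1, hz2⟩
  have hz := hA.out ha hb ⟨hz1, hz2⟩
  refine ⟨hz, ?_⟩
  rcases hz1.lt_or_eq with hz1 | rfl
  · rcases hz2.lt_or_eq with hz2 | rfl
    · have h1 := h a ha z hz hz1
      have h2 := h z hz b hb hz2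
      rcases Int.units_eq_one_or δ with rfl | rfl
      · exact hC.out ha' hb' ⟨((sLT_one _ _).1 h1).le, ((sLT_one _ _).1 h2).le⟩
      · exact hC.out hb' ha' ⟨((sLT_neg_one _ _).1 h2).le, ((sLT_neg_one _ _).1 h1).le⟩
    · exact hb'
  · exact ha'

end SMono

end Signed

theorem zpow_unit_mul {M : Type*} [Group M] (a : M) (δ ε : ℤˣ) :
    a ^ ((δ * ε : ℤˣ) : ℤ) = (a ^ (δ : ℤ)) ^ (ε : ℤ) := by
  rw [Units.val_mul, zpow_mul]

theorem zpow_unit_self {M : Type*} [Group M] (a : M) (δ : ℤˣ) :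
    (a ^ (δ : ℤ)) ^ (δ : ℤ) = a := by
  rcases Int.units_eq_one_or δ with rfl | rfl <;> simp

theorem zpow_unit_eq_one {M : Type*} [Group M] {a : M} {δ : ℤˣ} : a ^ (δ : ℤ) = 1 ↔ a = 1 := by
  rcases Int.units_eq_one_or δ with rfl | rfl <;> simp

theorem zpow_unit_mem {M : Type*} [Group M] {H : Subgroup M} {a : M} {δ : ℤˣ} :
    a ^ (δ : ℤ) ∈ H ↔ a ∈ H := by
  rcases Int.units_eq_one_or δ with rfl | rfl <;> simp

end InfWord

namespace InfWord

universe u v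

variable {G : ℕ → Type u} [∀ n, Group (G n)]

/-! ### The factors of the free product -/

/-- The retraction onto `G n` that kills all other factors is injective on the factor `n` and
trivial on the factor `m`. -/
theorem eq_one_of_mem_factor {n m : ℕ} (hnm : n ≠ m) {g : CoprodI G} (hn : g ∈ factor G n)
    (hm : g ∈ factor G m) : g = 1 := by
  obtain ⟨a, rfl⟩ := hn
  obtain ⟨b, hb⟩ := hm
  have h := congrArg (CoprodI.lift fun i => Pi.mulSingle (M := fun i => G i →* G n) n
    (MonoidHom.id (G n)) i) hb
  rw [CoprodI.lift_of, CoprodI.lift_of, Pi.mulSingle_eq_same, Pi.mulSingle_eq_of_ne hnm.symm] at h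
  rw [show a = 1 from h.symm, map_one]

theorem exists_of_eq {n : ℕ} {g : CoprodI G} (hn : g ∈ factor G n) : ∃ a : G n, CoprodI.of a = g :=
  hn

namespace Word

/-! ### Truncations of restricted words -/

section

/-- The inclusion of the positions of `W ↾ A`. -/
def val (W : Word G) (A : Set W.dom) (a : (W.restrict A).dom) : W.dom := Subtype.val a

open scoped Classical in
/-- The truncation of the restricted word `W ↾ A`. -/
noncomputable def tr (W : Word G) (A : Set W.dom) (N : ℕ) : CoprodI G :=
  ordProd {i ∈ W.truncDom N | i ∈ A} W.letter

theorem trunc_restrict (W : Word G) (A : Set W.dom) (N : ℕ) :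
    (W.restrict A).trunc N = W.tr A N := by
  classical
  unfold tr
  rw [trunc, ordProd_eq _ _ ((((W.restrict A).truncDom N).sort (· ≤ ·)).map (W.val A)),
    List.map_map]
  · rfl
  · rw [List.pairwise_map]
    exact ((W.restrict A).sort_pairwise N).imp fun h => h
  · intro i
    simp only [List.mem_map, Finset.mem_sort, Finset.mem_filter, mem_truncDom]
    constructor
    · rintro ⟨a, ha, rfl⟩
      exact ⟨ha, Subtype.prop a⟩
    · rintro ⟨h, hA⟩
      exact ⟨⟨i, hA⟩, h, rfl⟩

theorem trunc_eq_tr (W : Word G) (N : ℕ) : W.trunc N = W.tr Set.univ N := by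
  classical
  simp [tr, trunc, ordProd]

theorem tr_union (W : Word G) {A B : Set W.dom} (h : ∀ a ∈ A, ∀ b ∈ B, a < b) (N : ℕ) :
    W.tr (A ∪ B) N = W.tr A N * W.tr B N := by
  classical
  unfold tr
  rw [← ordProd_union]
  · congr 1
    ext i
    simp only [Finset.mem_union, Finset.mem_filter, Set.mem_union]
    tauto
  · intro a ha b hb
    exact h a (Finset.mem_filter.1 ha).2 b (Finset.mem_filter.1 hb).2

theorem tr_eq_one_of_forall (W : Word G) {A : Set W.dom} {N : ℕ}
    (h : ∀ i ∈ A, i ∉ W.truncDom N) : W.tr A N = 1 := by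
  classical
  unfold tr
  rw [Finset.filter_eq_empty_iff.2 fun i hi hA => h i hA hi, ordProd_empty]

@[simp] theorem tr_empty (W : Word G) (N : ℕ) : W.tr ∅ N = 1 :=
  W.tr_eq_one_of_forall fun _ h => h.elim

theorem tr_singleton (W : Word G) {i : W.dom} {N : ℕ} (h : i ∈ W.truncDom N) :
    W.tr {i} N = W.letter i := by
  classical
  unfold tr
  convert ordProd_singleton i W.letter using 2
  ext j
  simp only [Finset.mem_filter, Set.mem_singleton_iff, Finset.mem_singleton]
  exact ⟨fun h => h.2, fun h' => h'.symm ▸ ⟨h, rfl⟩⟩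

/-- `f` carries `W ↾ A` onto `V ↾ f(A)`, inverted if `δ = -1`. -/
structure SMap (δ : ℤˣ) (W V : Word G) (f : W.dom → V.dom) (A : Set W.dom) : Prop where
  letter : ∀ a ∈ A, V.letter (f a) = W.letter a ^ (δ : ℤ)
  smono : SMono δ f A

theorem SMap.mono {δ : ℤˣ} {W V : Word G} {f : W.dom → V.dom} {A B : Set W.dom}
    (h : SMap δ W V f A) (hB : B ⊆ A) : SMap δ W V f B :=
  ⟨fun a ha => h.letter a (hB ha), h.smono.mono hB⟩

theorem SMap.comp {δ ε : ℤˣ} {W V Z : Word G} {f : W.dom → V.dom} {g : V.dom → Z.dom}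
    {A : Set W.dom} (hg : SMap ε V Z g (f '' A)) (h : SMap δ W V f A) :
    SMap (ε * δ) W Z (fun a => g (f a)) A :=
  ⟨fun a ha => by rw [hg.letter _ ⟨a, ha, rfl⟩, h.letter a ha, mul_comm, zpow_unit_mul],
    hg.smono.comp h.smono⟩

theorem SMap.invFunOn {δ : ℤˣ} {W V : Word G} [Nonempty W.dom] {f : W.dom → V.dom} {A : Set W.dom}
    (h : SMap δ W V f A) : SMap δ V W (Function.invFunOn f A) (f '' A) := by
  refine ⟨?_, h.smono.invFunOn⟩
  rintro _ ⟨a, ha, rfl⟩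
  rw [h.smono.injOn.leftInvOn_invFunOn ha, h.letter a ha, zpow_unit_self]

theorem SMap.id (W : Word G) (A : Set W.dom) : SMap 1 W W (fun a => a) A :=
  ⟨fun a _ => by simp, fun a _ b _ h => by simpa using h⟩

theorem SMap.mem_truncDom {δ : ℤˣ} {W V : Word G} {f : W.dom → V.dom} {A : Set W.dom}
    (h : SMap δ W V f A) {a : W.dom} (ha : a ∈ A) (N : ℕ) :
    f a ∈ V.truncDom N ↔ a ∈ W.truncDom N := by
  simp only [Word.mem_truncDom, h.letter a ha, zpow_unit_mem]

theorem SMap.tr_image {δ : ℤˣ} {W V : Word G} {f : W.dom → V.dom} {A : Set W.dom}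
    (h : SMap δ W V f A) (N : ℕ) : V.tr (f '' A) N = W.tr A N ^ (δ : ℤ) := by
  classical
  have him : {i ∈ V.truncDom N | i ∈ f '' A} = Finset.image f {i ∈ W.truncDom N | i ∈ A} := by
    ext i
    simp only [Finset.mem_filter, Finset.mem_image, Set.mem_image]
    constructor
    · rintro ⟨hi, a, ha, rfl⟩
      exact ⟨a, ⟨(h.mem_truncDom ha N).1 hi, ha⟩, rfl⟩
    · rintro ⟨a, ⟨hi, ha⟩, rfl⟩
      exact ⟨(h.mem_truncDom ha N).2 hi, a, ha, rfl⟩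
  unfold tr
  rw [him]
  have hA : ∀ a ∈ ({i ∈ W.truncDom N | i ∈ A} : Finset _), a ∈ A :=
    fun a ha => (Finset.mem_filter.1 ha).2
  rcases Int.units_eq_one_or δ with rfl | rfl
  · rw [ordProd_image _ _ _ fun a ha b hb hab => (sLT_one _ _).1
      (h.smono a (hA a ha) b (hA b hb) hab)]
    simp only [Units.val_one, zpow_one]
    exact ordProd_congr fun a ha => by simpa using h.letter a (hA a ha)
  · rw [ordProd_image_anti _ _ _ fun a ha b hb hab => (sLT_neg_one _ _).1
      (h.smono a (hA a ha) b (hA b hb) hab)]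
    simp only [Units.val_neg, Units.val_one, zpow_neg, zpow_one]
    congr 1
    exact ordProd_congr fun a ha => by simp [h.letter a (hA a ha)]

end

/-! ### The relations `≡` and signed maps -/

/-- Isomorphisms between restricted words are handled as total functions controlled only on `I`,
which makes composing and restricting them painless. Nonemptiness of `I` supplies the value used off
`I`. -/
theorem Equi.exists_smap {δ : ℤˣ} {W V : Word G} {I : Set W.dom} {J : Set V.dom}
    (h : (W.restrict I).Equi ((V.restrict J).signPow δ)) (hI : I.Nonempty) :
    ∃ f : W.dom → V.dom, SMap δ W V f I ∧ f '' I = J := by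
  classical
  rcases Int.units_eq_one_or δ with rfl | rfl
  · simp only [signPow, if_true] at h
    obtain ⟨e, he⟩ := h
    obtain ⟨i0, hi0⟩ := hI
    have hf : ∀ a (ha : a ∈ I), (if h : a ∈ I then (e ⟨a, h⟩ : J).1 else (e ⟨i0, hi0⟩ : J).1) =
        (e ⟨a, ha⟩ : J).1 := fun a ha => dif_pos ha
    refine ⟨fun a => if h : a ∈ I then (e ⟨a, h⟩ : J).1 else (e ⟨i0, hi0⟩ : J).1, ⟨?_, ?_⟩, ?_⟩
    · intro a ha
      simp only [hf a ha]
      simp only [Units.val_one, zpow_one]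
      exact (he ⟨a, ha⟩).symm
    · intro a ha b hb hab
      simp only [hf a ha, hf b hb, sLT_one]
      exact e.lt_iff_lt.2 (show (⟨a, ha⟩ : I) < ⟨b, hb⟩ from hab)
    · ext j
      constructor
      · rintro ⟨a, ha, rfl⟩
        simp only [hf a ha]
        exact (e ⟨a, ha⟩ : J).2
      · intro hj
        refine ⟨(e.symm ⟨j, hj⟩ : I).1, (e.symm ⟨j, hj⟩ : I).2, ?_⟩
        simp only [hf _ (e.symm ⟨j, hj⟩ : I).2]
        exact congrArg Subtype.val (e.apply_symm_apply ⟨j, hj⟩)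
  · simp only [signPow, show (-1 : ℤˣ) ≠ 1 by decide, if_false] at h
    obtain ⟨e, he⟩ := h
    let e' : I → J := fun a => OrderDual.ofDual (e a)
    have he' : ∀ a b : I, a < b → (e' b).1 < (e' a).1 := fun a b hab => e.lt_iff_lt.2 hab
    have hl : ∀ a : I, V.letter (e' a) = (W.letter a)⁻¹ := fun a => by
      rw [show W.letter a = (V.letter (e' a))⁻¹ from he a, inv_inv]
    obtain ⟨i0, hi0⟩ := hI
    have hf : ∀ a (ha : a ∈ I), (if h : a ∈ I then (e' ⟨a, h⟩).1 else (e' ⟨i0, hi0⟩).1) =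
        (e' ⟨a, ha⟩).1 := fun a ha => dif_pos ha
    refine ⟨fun a => if h : a ∈ I then (e' ⟨a, h⟩).1 else (e' ⟨i0, hi0⟩).1, ⟨?_, ?_⟩, ?_⟩
    · intro a ha
      simp only [hf a ha]
      simpa using hl ⟨a, ha⟩
    · intro a ha b hb hab
      simp only [hf a ha, hf b hb, sLT_neg_one]
      exact he' _ _ (show (⟨a, ha⟩ : I) < ⟨b, hb⟩ from hab)
    · ext j
      constructor
      · rintro ⟨a, ha, rfl⟩
        simp only [hf a ha]
        exact (e' ⟨a, ha⟩).2
      · intro hj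
        let a : I := e.symm (OrderDual.toDual ⟨j, hj⟩)
        refine ⟨a.1, a.2, ?_⟩
        simp only [hf _ a.2]
        have : e' a = ⟨j, hj⟩ := congrArg OrderDual.ofDual (e.apply_symm_apply _)
        exact congrArg Subtype.val this

theorem SMap.equi {δ : ℤˣ} {W V : Word G} {f : W.dom → V.dom} {I : Set W.dom}
    (h : SMap δ W V f I) : (W.restrict I).Equi ((V.restrict (f '' I)).signPow δ) := by
  rcases Int.units_eq_one_or δ with rfl | rfl
  · simp only [signPow, if_true]
    let e : I → f '' I := fun a => ⟨f a, a, a.2, rfl⟩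
    have he : StrictMono e := fun a b hab => (sLT_one _ _).1 (h.smono a a.2 b b.2 hab)
    have hs : Function.Surjective e := by
      rintro ⟨_, a, ha, rfl⟩
      exact ⟨⟨a, ha⟩, rfl⟩
    exact ⟨he.orderIsoOfSurjective e hs,
      fun a : I => (by simpa using (h.letter a a.2).symm : W.letter a = V.letter (f a))⟩
  · simp only [signPow, show (-1 : ℤˣ) ≠ 1 by decide, if_false]
    let e : I → (f '' I)ᵒᵈ := fun a => OrderDual.toDual ⟨f a, a, a.2, rfl⟩
    have he : StrictMono e := fun a b hab => (sLT_neg_one _ _).1 (h.smono a a.2 b b.2 hab)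
    have hs : Function.Surjective e := by
      intro j
      obtain ⟨a, ha, hj⟩ := (OrderDual.ofDual j).2
      exact ⟨⟨a, ha⟩, congrArg OrderDual.toDual (Subtype.ext hj)⟩
    exact ⟨he.orderIsoOfSurjective e hs,
      fun a : I => (by simp [h.letter a a.2] : W.letter a = (V.letter (f a))⁻¹)⟩

theorem Equi.symm {W V : Word G} (h : W.Equi V) : V.Equi W := by
  obtain ⟨e, he⟩ := h
  exact ⟨e.symm, fun i => by rw [he, e.apply_symm_apply]⟩

theorem equi_empty_of_isEmpty (W : Word G) [IsEmpty W.dom] : W.Equi (empty G) :=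
  ⟨⟨⟨fun i => isEmptyElim i, fun i => i.elim, fun i => isEmptyElim i, fun i => i.elim⟩,
    fun {i} => isEmptyElim i⟩, fun i => isEmptyElim i⟩

theorem Equi.isEmpty {W : Word G} (h : W.Equi (empty G)) : IsEmpty W.dom := by
  obtain ⟨e, -⟩ := h
  exact ⟨fun i => Empty.elim (e i)⟩

theorem sim_empty_iff {W : Word G} : W.Sim (empty G) ↔ ∀ N, W.trunc N = 1 := by
  simp [Sim, trunc_empty]

/-! ### Classes of restricted words -/

/-- The class of `W ↾ A` in the topologist's product. -/
def cl (W : Word G) (A : Set W.dom) : TopProd G := (W.restrict A).cls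

/-- The class of `W ↾ A` modulo the finite words. -/
def ar (W : Word G) (A : Set W.dom) : Arch G := (W.restrict A).archCls

theorem cls_eq_iff {W V : Word G} : W.cls = V.cls ↔ ∀ N, W.trunc N = V.trunc N :=
  Quotient.eq (r := simSetoid G)

theorem cls_concat (W V : Word G) : (W.concat V).cls = W.cls * V.cls := rfl

theorem cls_inv (W : Word G) : W.inv.cls = W.cls⁻¹ := rfl

theorem cls_empty : (empty G).cls = 1 := rfl

theorem cls_signPow (W : Word G) (δ : ℤˣ) : (W.signPow δ).cls = W.cls ^ (δ : ℤ) := by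
  rcases Int.units_eq_one_or δ with rfl | rfl
  · simp [signPow]
  · simp [signPow, show (-1 : ℤˣ) ≠ 1 by decide, cls_inv]

theorem archCls_signPow (W : Word G) (δ : ℤˣ) : (W.signPow δ).archCls = W.archCls ^ (δ : ℤ) := by
  rw [archCls, cls_signPow]
  rfl

theorem ar_eq (W : Word G) (A : Set W.dom) : W.ar A = QuotientGroup.mk (W.cl A) := rfl

theorem cl_eq_iff {W V : Word G} {A : Set W.dom} {B : Set V.dom} :
    W.cl A = V.cl B ↔ ∀ N, W.tr A N = V.tr B N := by
  rw [cl, cl, cls_eq_iff]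
  simp only [trunc_restrict]

theorem cl_eq_one_iff {W : Word G} {A : Set W.dom} : W.cl A = 1 ↔ ∀ N, W.tr A N = 1 := by
  rw [cl, ← cls_empty, cls_eq_iff]
  simp only [trunc_restrict, trunc_empty]

theorem cls_eq_cl (W : Word G) : W.cls = W.cl Set.univ := by
  rw [cl, cls_eq_iff]
  intro N
  rw [trunc_restrict, trunc_eq_tr]

theorem cl_empty (W : Word G) : W.cl ∅ = 1 := cl_eq_one_iff.2 fun N => tr_empty W N

theorem cl_union (W : Word G) {A B : Set W.dom} (h : ∀ a ∈ A, ∀ b ∈ B, a < b) :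
    W.cl (A ∪ B) = W.cl A * W.cl B := by
  rw [cl, cl, cl, ← cls_concat, cls_eq_iff]
  intro N
  rw [trunc_restrict, tr_union W h, trunc_concat, trunc_restrict, trunc_restrict]

theorem ar_union (W : Word G) {A B : Set W.dom} (h : ∀ a ∈ A, ∀ b ∈ B, a < b) :
    W.ar (A ∪ B) = W.ar A * W.ar B := by
  rw [ar_eq, cl_union W h]
  rfl

theorem ar_finite (W : Word G) {A : Set W.dom} (h : A.Finite) : W.ar A = 1 := by
  rw [ar_eq, QuotientGroup.eq_one_iff]
  exact Subgroup.subset_normalClosure ⟨W.restrict A, h, rfl⟩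

theorem SMap.cl_image {δ : ℤˣ} {W V : Word G} {f : W.dom → V.dom} {A : Set W.dom}
    (h : SMap δ W V f A) : V.cl (f '' A) = W.cl A ^ (δ : ℤ) := by
  rw [cl, cl, ← cls_signPow, cls_eq_iff]
  intro N
  rw [trunc_restrict, h.tr_image]
  rcases Int.units_eq_one_or δ with rfl | rfl
  · simp [signPow, trunc_restrict]
  · simp [signPow, show (-1 : ℤˣ) ≠ 1 by decide, trunc_inv, trunc_restrict]

theorem SMap.ar_image {δ : ℤˣ} {W V : Word G} {f : W.dom → V.dom} {A : Set W.dom}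
    (h : SMap δ W V f A) : V.ar (f '' A) = W.ar A ^ (δ : ℤ) := by
  rw [ar_eq, h.cl_image]
  rfl

theorem inL_lt_inL (W V : Word G) (a b : W.dom) : inL W V a < inL W V b ↔ a < b :=
  Sum.Lex.inl_lt_inl_iff

theorem inR_lt_inR (W V : Word G) (a b : V.dom) : inR W V a < inR W V b ↔ a < b :=
  Sum.Lex.inr_lt_inr_iff

theorem inL_lt_inR (W V : Word G) (a : W.dom) (b : V.dom) : inL W V a < inR W V b :=
  Sum.Lex.inl_lt_inr _ _

theorem not_inR_lt_inL (W V : Word G) (a : V.dom) (b : W.dom) : ¬ inR W V a < inL W V b :=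
  Sum.Lex.not_inr_lt_inl

theorem concat_cases (W V : Word G) (i : (W.concat V).dom) :
    (∃ a, i = inL W V a) ∨ ∃ a, i = inR W V a := by
  rcases i with a | a
  exacts [Or.inl ⟨a, rfl⟩, Or.inr ⟨a, rfl⟩]

/-! ### Reduced words and intervals -/

/-- The positions below (above) all positions of `A`. -/
theorem ordConnected_decomp {α : Type*} [LinearOrder α] {A : Set α} (hA : A.OrdConnected)
    (x : α) : (∀ a ∈ A, x < a) ∨ x ∈ A ∨ (∀ a ∈ A, a < x) := by
  by_contra hcon
  push Not at hcon
  obtain ⟨⟨a, ha, hax⟩, hx, b, hb, hbx⟩ := hcon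
  exact hx (hA.out ha hb ⟨hax, hbx⟩)

theorem isSubword_restrict (W : Word G) {A : Set W.dom} (hA : A.OrdConnected) :
    (W.restrict A).IsSubword W := by
  classical
  rcases A.eq_empty_or_nonempty with rfl | hne
  · refine ⟨W, empty G, ⟨⟨⟨fun a => toLex (Sum.inl (toLex (Sum.inl a))), fun b => ?_, ?_, ?_⟩, ?_⟩,
      ?_⟩⟩
    · rcases b with (b | b) | b
      exacts [b, b.2.elim, b.elim]
    · intro a
      rfl
    · rintro ((b | b) | b)
      exacts [rfl, b.2.elim, b.elim]
    · intro a b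
      exact (Sum.Lex.inl_le_inl_iff).trans Sum.Lex.inl_le_inl_iff
    · intro a
      rfl
  · let L : Set W.dom := {x | ∀ a ∈ A, x < a}
    let R : Set W.dom := {x | ∀ a ∈ A, a < x}
    refine ⟨W.restrict L, W.restrict R, Equi.symm ?_⟩
    let e : (((W.restrict L).concat (W.restrict A)).concat (W.restrict R)).dom → W.dom :=
      fun b => Sum.elim (fun b => Sum.elim (fun x : L => x.1) (fun x : A => x.1) (ofLex b))
        (fun x : R => x.1) (ofLex b)
    have he : StrictMono e := by
      rintro ((a | a) | a) ((b | b) | b) hab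
      · have h := (inL_lt_inL _ _ _ _).1 ((inL_lt_inL _ _ _ _).1 hab)
        exact h
      · exact a.2 b.1 b.2
      · obtain ⟨c, hc⟩ := hne
        exact (a.2 c hc).trans (b.2 c hc)
      · exact (not_inR_lt_inL _ _ _ _ ((inL_lt_inL _ _ _ _).1 hab)).elim
      · have h := (inR_lt_inR _ _ _ _).1 ((inL_lt_inL _ _ _ _).1 hab)
        exact h
      · exact b.2 a.1 a.2
      · exact (not_inR_lt_inL _ _ _ _ hab).elim
      · exact (not_inR_lt_inL _ _ _ _ hab).elim
      · have h := (inR_lt_inR _ _ _ _).1 hab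
        exact h
    have hs : Function.Surjective e := by
      intro x
      rcases ordConnected_decomp hA x with h | h | h
      · exact ⟨toLex (Sum.inl (toLex (Sum.inl ⟨x, h⟩))), rfl⟩
      · exact ⟨toLex (Sum.inl (toLex (Sum.inr ⟨x, h⟩))), rfl⟩
      · exact ⟨toLex (Sum.inr ⟨x, h⟩), rfl⟩
    refine ⟨he.orderIsoOfSurjective e hs, ?_⟩
    rintro ((a | a) | a) <;> rfl

theorem exists_of_equi_concat {W W₀ V W₂ : Word G} (h : W.Equi ((W₀.concat V).concat W₂)) :
    ∃ f : V.dom → W.dom, SMap 1 V W f Set.univ ∧ (f '' Set.univ).OrdConnected := by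
  obtain ⟨e, he⟩ := h
  let k : V.dom → ((W₀.concat V).concat W₂).dom := fun a => toLex (Sum.inl (toLex (Sum.inr a)))
  refine ⟨fun a => e.symm (k a), ⟨?_, ?_⟩, ?_⟩
  · intro a _
    rw [he, e.apply_symm_apply]
    simp only [Units.val_one, zpow_one]
    rfl
  · intro a _ b _ hab
    rw [sLT_one, e.symm.lt_iff_lt]
    exact Sum.Lex.inl_lt_inl_iff.2 (Sum.Lex.inr_lt_inr_iff.2 hab)
  · refine Set.ordConnected_def.2 ?_
    rintro _ ⟨a, -, rfl⟩ _ ⟨b, -, rfl⟩ x ⟨h1, h2⟩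
    rw [e.symm_apply_le] at h1
    rw [e.le_symm_apply] at h2
    suffices ∃ c, k c = e x by
      obtain ⟨c, hc⟩ := this
      exact ⟨c, trivial, by rw [e.symm_apply_eq, hc]⟩
    rcases hx : e x with (c | c) | c
    · rw [hx] at h1
      exact absurd (Sum.Lex.inl_le_inl_iff.1 h1) Sum.Lex.not_inr_le_inl
    · exact ⟨c, rfl⟩
    · rw [hx] at h2
      exact absurd h2 Sum.Lex.not_inr_le_inl

/-- Up to `≡` the subwords of `W` are its restrictions to intervals, so reducedness can be tested
inside `W` without auxiliary words. -/
theorem isReduced_iff {W : Word G} : W.IsReduced ↔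
    (∀ A : Set W.dom, A.OrdConnected → W.cl A = 1 → A = ∅) ∧
    ∀ i j : W.dom, i ⋖ j → ∀ n, ¬ (W.letter i ∈ factor G n ∧ W.letter j ∈ factor G n) := by
  refine and_congr_left' ⟨fun h A hA hcl => ?_, fun h W₀ W₁ W₂ hW hs => ?_⟩
  · obtain ⟨W₀, W₂, hW⟩ := W.isSubword_restrict hA
    have := (h W₀ (W.restrict A) W₂ hW
      (sim_empty_iff.2 fun N => by rw [trunc_restrict, cl_eq_one_iff.1 hcl])).isEmpty
    exact Set.isEmpty_coe_sort.1 this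
  · obtain ⟨f, hf, hc⟩ := exists_of_equi_concat hW
    have h1 : f '' Set.univ = ∅ := by
      refine h _ hc ?_
      rw [hf.cl_image, ← cls_eq_cl]
      simp only [Units.val_one, zpow_one, ← cls_empty]
      exact cls_eq_iff.2 hs
    have : IsEmpty W₁.dom := by
      rw [Set.image_univ, Set.range_eq_empty_iff] at h1
      exact h1
    exact equi_empty_of_isEmpty W₁

theorem IsSubword.exists_smap {V W : Word G} (h : V.IsSubword W) :
    ∃ f : V.dom → W.dom, SMap 1 V W f Set.univ ∧ (f '' Set.univ).OrdConnected := by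
  obtain ⟨W₀, W₂, hW⟩ := h
  exact exists_of_equi_concat hW

theorem IsReduced.eq_empty {W : Word G} (h : W.IsReduced) {A : Set W.dom} (hA : A.OrdConnected)
    (hcl : W.cl A = 1) : A = ∅ := (isReduced_iff.1 h).1 A hA hcl

/-- A trivial letter would be a nonempty subword equivalent to the empty word. Consequently each
letter of a reduced word lies in exactly one factor. -/
theorem IsReduced.letter_ne_one {W : Word G} (h : W.IsReduced) (i : W.dom) : W.letter i ≠ 1 := by
  intro hi
  have : ({i} : Set W.dom) = ∅ := by
    refine h.eq_empty Set.ordConnected_singleton (cl_eq_one_iff.2 fun N => ?_)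
    have hN : i ∈ W.truncDom N := (W.mem_truncDom N i).2 ⟨0, Nat.zero_le _, hi ▸ one_mem _⟩
    rw [tr_singleton W hN, hi]
  exact Set.singleton_ne_empty i this

open scoped Classical in
/-- The least index of a factor which contains the letter at position `i`. -/
noncomputable def idx (W : Word G) (i : W.dom) : ℕ := Nat.find (W.exists_mem i)

theorem idx_mem (W : Word G) (i : W.dom) : W.letter i ∈ factor G (W.idx i) := by
  classical exact Nat.find_spec (W.exists_mem i)

theorem mem_truncDom_iff_idx (W : Word G) (N : ℕ) (i : W.dom) :
    i ∈ W.truncDom N ↔ W.idx i ≤ N := by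
  classical
  rw [mem_truncDom, idx]
  constructor
  · rintro ⟨n, hn, h⟩
    exact (Nat.find_min' _ h).trans hn
  · exact fun h => ⟨_, h, W.idx_mem i⟩

theorem idx_eq {W : Word G} {i : W.dom} (hi : W.letter i ≠ 1) {n : ℕ}
    (h : W.letter i ∈ factor G n) : W.idx i = n := by
  by_contra hne
  exact hi (eq_one_of_mem_factor hne (W.idx_mem i) h)

end Word

end InfWord

namespace InfWord

universe u v

variable {G : ℕ → Type u} [∀ n, Group (G n)]

/-! ### Noncrossing cancellations -/

theorem isChain_idx_ne {α : Type*} [LinearOrder α] (idx : α → ℕ) :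
    ∀ l : List α, l.Pairwise (· < ·) →
      (∀ i ∈ l, ∀ j ∈ l, i < j → (∀ k ∈ l, ¬ (i < k ∧ k < j)) → idx i ≠ idx j) →
      l.IsChain fun a b => idx a ≠ idx b
  | [], _, _ => List.isChain_nil
  | [_], _, _ => List.isChain_singleton _
  | a :: b :: l, hl, h => by
    have hl' := List.pairwise_cons.1 hl
    rw [List.isChain_cons_cons]
    refine ⟨h a (by simp) b (by simp) (hl'.1 b (by simp)) ?_, isChain_idx_ne idx (b :: l) hl'.2 ?_⟩
    · rintro k hk ⟨h1, h2⟩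
      rcases List.mem_cons.1 hk with rfl | hk
      · exact lt_irrefl _ h1
      · rcases List.mem_cons.1 hk with rfl | hk
        · exact lt_irrefl _ h2
        · exact lt_asymm h2 ((List.pairwise_cons.1 hl'.2).1 k hk)
    · intro i hi j hj hij hk
      refine h i (List.mem_cons_of_mem _ hi) j (List.mem_cons_of_mem _ hj) hij ?_
      rintro k hk' ⟨h1, h2⟩
      rcases List.mem_cons.1 hk' with rfl | hk'
      · exact lt_asymm h1 (hl'.1 i hi)
      · exact hk k hk' ⟨h1, h2⟩

/-- A product of nontrivial letters, neighbours being of different index, is nontrivial. -/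
theorem ordProd_ne_one {α : Type*} [LinearOrder α] (idx : α → ℕ) (s : Finset α)
    (f : α → CoprodI G) (hf : ∀ i ∈ s, f i ∈ factor G (idx i)) (h1 : ∀ i ∈ s, f i ≠ 1)
    (hs : s.Nonempty)
    (hidx : ∀ i ∈ s, ∀ j ∈ s, i < j → (∀ k ∈ s, ¬ (i < k ∧ k < j)) → idx i ≠ idx j) :
    ordProd s f ≠ 1 := by
  classical
  intro hprod
  choose! g hg using fun i (hi : i ∈ s) => exists_of_eq (hf i hi)
  -- These letters form a normal form in the free product; by uniqueness of normal forms only the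
  -- empty one has product 1.
  let w : CoprodI.Word G :=
    { toList := (s.sort (· ≤ ·)).map fun i => ⟨idx i, g i⟩
      ne_one := by
        intro l hl
        obtain ⟨i, hi, rfl⟩ := List.mem_map.1 hl
        rw [Finset.mem_sort] at hi
        intro h
        exact h1 i hi (by rw [← hg i hi]; simp only at h; rw [h, map_one])
      chain_ne := by
        rw [List.isChain_map]
        refine isChain_idx_ne idx _ (sort_pairwise_lt s) ?_
        simpa only [Finset.mem_sort] using hidx }
  have hw : w.prod = 1 := by
    rw [← hprod, CoprodI.Word.prod, ordProd, List.map_map]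
    congr 1
    refine List.map_congr_left fun i hi => ?_
    rw [Finset.mem_sort] at hi
    exact hg i hi
  have hw' : w = CoprodI.Word.empty :=
    CoprodI.Word.equiv.symm.injective (hw.trans CoprodI.Word.prod_empty.symm)
  have hl : (s.sort (· ≤ ·)).map (fun i => (⟨idx i, g i⟩ : Σ i, G i)) = [] :=
    congrArg CoprodI.Word.toList hw'
  obtain ⟨i, hi⟩ := hs
  rw [List.map_eq_nil_iff] at hl
  have : i ∈ s.sort (· ≤ ·) := by simpa
  rw [hl] at this
  exact absurd this List.not_mem_nil

/-- A finite word which represents the identity of the free product has a noncrossing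
partition into classes of equal index such that every union of classes represents the identity. -/
theorem exists_noncrossing {α : Type*} [LinearOrder α] (idx : α → ℕ) :
    ∀ (n : ℕ) (s : Finset α) (f : α → CoprodI G), s.card = n →
      (∀ i ∈ s, f i ∈ factor G (idx i)) → ordProd s f = 1 →
      ∃ R : Setoid α, (∀ i ∈ s, ∀ j ∈ s, R i j → idx i = idx j) ∧
        (∀ i ∈ s, ∀ j ∈ s, ∀ k ∈ s, ∀ l ∈ s, i < j → j < k → k < l → R i k → R j l → R i j) ∧
        ∀ t ⊆ s, (∀ i ∈ t, ∀ j ∈ s, R i j → j ∈ t) → ordProd t f = 1 := by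
  classical
  intro n
  induction n with
  | zero =>
    intro s f hs _ _
    rw [Finset.card_eq_zero] at hs
    subst hs
    refine ⟨⊥, by simp, by simp, fun t ht _ => ?_⟩
    rw [Finset.subset_empty.1 ht, ordProd_empty]
  | succ n ih =>
    intro s f hs hf hprod
    -- A trivial letter is deleted and becomes a class by itself. Otherwise the product is not in
    -- normal form, so two neighbouring letters share an index and are merged into one.
    by_cases hone : ∃ i ∈ s, f i = 1
    · obtain ⟨i, hi, hfi⟩ := hone
      have herase : ∀ t : Finset α, ordProd (t.erase i) f = ordProd t f := by
        intro t
        by_cases hit : i ∈ t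
        · rw [ordProd_split t f hit, hfi, mul_one, ← ordProd_union]
          · congr 1
            ext a
            simp only [Finset.mem_erase, Finset.mem_union, Finset.mem_filter]
            constructor
            · rintro ⟨h1, h2⟩
              exact (lt_or_gt_of_ne h1).imp (fun h => ⟨h2, h⟩) fun h => ⟨h2, h⟩
            · rintro (h | h)
              exacts [⟨h.2.ne, h.1⟩, ⟨h.2.ne', h.1⟩]
          · intro a ha b hb
            exact (Finset.mem_filter.1 ha).2.trans (Finset.mem_filter.1 hb).2
        · rw [Finset.erase_eq_of_notMem hit]
      obtain ⟨R, hR1, hR2, hR3⟩ := ih (s.erase i) f (by rw [Finset.card_erase_of_mem hi, hs]; rfl)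
        (fun j hj => hf j (Finset.mem_of_mem_erase hj)) (by rw [herase, hprod])
      refine ⟨⟨fun a b => (a ≠ i ∧ b ≠ i ∧ R a b) ∨ a = b, ⟨fun a => Or.inr rfl, ?_, ?_⟩⟩, ?_, ?_, ?_⟩
      · rintro a b (⟨h1, h2, h3⟩ | rfl)
        exacts [Or.inl ⟨h2, h1, R.symm h3⟩, Or.inr rfl]
      · rintro a b c (⟨h1, h2, h3⟩ | rfl) (⟨h4, h5, h6⟩ | rfl)
        exacts [Or.inl ⟨h1, h5, R.trans h3 h6⟩, Or.inl ⟨h1, h2, h3⟩, Or.inl ⟨h4, h5, h6⟩, Or.inr rfl]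
      · rintro a ha b hb (⟨h1, h2, h3⟩ | rfl)
        · exact hR1 a (Finset.mem_erase.2 ⟨h1, ha⟩) b (Finset.mem_erase.2 ⟨h2, hb⟩) h3
        · rfl
      · rintro a ha b hb c hc d hd hab hbc hcd (⟨h1, h2, h3⟩ | rfl) (⟨h4, h5, h6⟩ | rfl)
        · exact Or.inl ⟨h1, h4, hR2 a (Finset.mem_erase.2 ⟨h1, ha⟩) b (Finset.mem_erase.2 ⟨h4, hb⟩)
            c (Finset.mem_erase.2 ⟨h2, hc⟩) d (Finset.mem_erase.2 ⟨h5, hd⟩) hab hbc hcd h3 h6⟩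
        · exact absurd (hbc.trans hcd) (lt_irrefl _)
        · exact absurd (hab.trans hbc) (lt_irrefl _)
        · exact absurd (hab.trans hbc) (lt_irrefl _)
      · intro t ht hsat
        rw [← herase]
        refine hR3 _ (Finset.erase_subset_erase _ ht) ?_
        intro a ha b hb hab
        rw [Finset.mem_erase] at ha hb ⊢
        exact ⟨hb.1, hsat a ha.2 b hb.2 (Or.inl ⟨ha.1, hb.1, hab⟩)⟩
    · push Not at hone
      have hne : s.Nonempty := Finset.card_pos.1 (by omega)
      have : ∃ i ∈ s, ∃ j ∈ s, i < j ∧ (∀ k ∈ s, ¬ (i < k ∧ k < j)) ∧ idx i = idx j := by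
        by_contra hcon
        refine ordProd_ne_one idx s f hf hone hne ?_ hprod
        intro i hi j hj hij hk he
        exact hcon ⟨i, hi, j, hj, hij, hk, he⟩
      obtain ⟨i, hi, j, hj, hij, hk, he⟩ := this
      let f' : α → CoprodI G := Function.update f i (f i * f j)
      -- Unions of classes contain both of `i`, `j` or neither, and for such sets merging does not
      -- change the product.
      have hmerge : ∀ t ⊆ s, (i ∈ t ↔ j ∈ t) → ordProd (t.erase j) f' = ordProd t f := by
        intro t ht hijt
        by_cases hit : i ∈ t
        · have hjt := hijt.1 hit
          have hit' : i ∈ t.erase j := Finset.mem_erase.2 ⟨hij.ne, hit⟩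
          have hjt' : j ∈ ({a ∈ t | i < a} : Finset α) := Finset.mem_filter.2 ⟨hjt, hij⟩
          rw [ordProd_split _ f' hit', ordProd_split t f hit, ordProd_split _ f hjt']
          have e1 : ({a ∈ {a ∈ t | i < a} | a < j} : Finset α) = ∅ := by
            rw [Finset.filter_eq_empty_iff]
            intro a ha haj
            rw [Finset.mem_filter] at ha
            exact hk a (ht ha.1) ⟨ha.2, haj⟩
          have e2 : ({a ∈ {a ∈ t | i < a} | j < a} : Finset α) = {a ∈ t.erase j | i < a} := by
            ext a
            simp only [Finset.mem_filter, Finset.mem_erase]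
            constructor
            · rintro ⟨⟨h1, h2⟩, h3⟩
              exact ⟨⟨h3.ne', h1⟩, h2⟩
            · rintro ⟨⟨h1, h2⟩, h3⟩
              refine ⟨⟨h2, h3⟩, ?_⟩
              rcases lt_or_gt_of_ne h1 with h | h
              · exact absurd ⟨h3, h⟩ (hk a (ht h2))
              · exact h
          have e3 : ({a ∈ t.erase j | a < i} : Finset α) = {a ∈ t | a < i} := by
            ext a
            simp only [Finset.mem_filter, Finset.mem_erase]
            exact ⟨fun h => ⟨h.1.2, h.2⟩, fun h => ⟨⟨(h.2.trans hij).ne, h.1⟩, h.2⟩⟩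
          rw [e1, e2, e3, ordProd_empty, one_mul]
          rw [ordProd_congr (f := f') (g := f) (s := {a ∈ t | a < i}),
            ordProd_congr (f := f') (g := f) (s := {a ∈ t.erase j | i < a})]
          · simp only [f', Function.update_self, mul_assoc]
          · intro a ha
            exact Function.update_of_ne (Finset.mem_filter.1 ha).2.ne' _ _
          · intro a ha
            exact Function.update_of_ne (Finset.mem_filter.1 ha).2.ne _ _
        · rw [Finset.erase_eq_of_notMem (fun h => hit (hijt.2 h))]
          refine ordProd_congr fun a ha => Function.update_of_ne ?_ _ _
          rintro rfl
          exact hit ha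
      obtain ⟨R, hR1, hR2, hR3⟩ := ih (s.erase j) f' (by rw [Finset.card_erase_of_mem hj, hs]; rfl)
        (by
          intro a ha
          by_cases hai : a = i
          · subst hai
            simp only [f', Function.update_self]
            exact mul_mem (hf a hi) (he ▸ hf j hj)
          · simp only [f', Function.update_of_ne hai]
            exact hf a (Finset.mem_of_mem_erase ha))
        (by rw [hmerge s subset_rfl (by simp [hi, hj]), hprod])
      -- The partition for the merged word is pulled back along `π`, which puts `j` into the class
      -- of `i`. As `i` and `j` are neighbours, `π` is monotone on `s` and the result remains
      -- noncrossing.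
      let π : α → α := fun a => if a = j then i else a
      have hπs : ∀ a ∈ s, π a ∈ s.erase j := by
        intro a ha
        simp only [π]
        split_ifs with h
        · exact Finset.mem_erase.2 ⟨hij.ne, hi⟩
        · exact Finset.mem_erase.2 ⟨h, ha⟩
      have hπidx : ∀ a, idx (π a) = idx a := by
        intro a
        simp only [π]
        split_ifs with h
        · rw [h, he]
        · rfl
      have hπmono : ∀ a ∈ s, ∀ b ∈ s, a < b → π a ≤ π b := by
        intro a ha b hb hab
        simp only [π]
        split_ifs with h1 h2 h2
        · exact le_rfl
        · exact (hij.trans (h1 ▸ hab)).le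
        · by_contra hlt
          exact hk a ha ⟨not_le.1 hlt, h2 ▸ hab⟩
        · exact hab.le
      refine ⟨R.comap π, ?_, ?_, ?_⟩
      · intro a ha b hb hab
        rw [← hπidx a, ← hπidx b]
        exact hR1 _ (hπs a ha) _ (hπs b hb) hab
      · intro a ha b hb c hc d hd hab hbc hcd h1 h2
        change R (π a) (π c) at h1
        change R (π b) (π d) at h2
        change R (π a) (π b)
        rcases (hπmono a ha b hb hab).lt_or_eq with h3 | h3
        · rcases (hπmono b hb c hc hbc).lt_or_eq with h4 | h4
          · rcases (hπmono c hc d hd hcd).lt_or_eq with h5 | h5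
            · exact hR2 _ (hπs a ha) _ (hπs b hb) _ (hπs c hc) _ (hπs d hd) h3 h4 h5 h1 h2
            · rw [h5] at h1
              exact R.trans h1 (R.symm h2)
          · rw [h4]
            exact h1
        · rw [h3]
      · intro t ht hsat
        have hπij : π i = π j := by simp [π]
        have hiff : i ∈ t ↔ j ∈ t :=
          ⟨fun h => hsat i h j hj (by change R (π i) (π j); rw [hπij]),
            fun h => hsat j h i hi (by change R (π j) (π i); rw [hπij])⟩
        rw [← hmerge t ht hiff]
        refine hR3 _ (Finset.erase_subset_erase _ ht) ?_
        intro a ha b hb hab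
        rw [Finset.mem_erase] at ha hb ⊢
        refine ⟨hb.1, hsat a ha.2 b hb.2 ?_⟩
        change R (π a) (π b)
        simpa [π, ha.1, hb.1] using hab

namespace Word

/-- A noncrossing partition of the positions of `Z` into classes of letters of equal index such
that every union of classes cancels. -/
structure Cancellation (Z : Word G) (R : Setoid Z.dom) : Prop where
  idx_eq : ∀ i j, R i j → Z.idx i = Z.idx j
  noncrossing : ∀ i j k l, i < j → j < k → k < l → R i k → R j l → R i j
  cl_eq_one : ∀ t : Set Z.dom, (∀ i ∈ t, ∀ j, R i j → j ∈ t) → Z.cl t = 1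

/-- Every truncation of `Z` is a finite trivial word and so has a noncrossing partition. The
partitions for different `N` need not be compatible; a nonprincipal ultrafilter on `ℕ` selects a
limit. -/
theorem exists_cancellation (Z : Word G) (hZ : Z.cls = 1) :
    ∃ R : Setoid Z.dom, Z.Cancellation R := by
  classical
  have hfin : ∀ N, ∃ R : Setoid Z.dom,
      (∀ i ∈ Z.truncDom N, ∀ j ∈ Z.truncDom N, R i j → Z.idx i = Z.idx j) ∧
      (∀ i ∈ Z.truncDom N, ∀ j ∈ Z.truncDom N, ∀ k ∈ Z.truncDom N, ∀ l ∈ Z.truncDom N,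
        i < j → j < k → k < l → R i k → R j l → R i j) ∧
      ∀ t ⊆ Z.truncDom N, (∀ i ∈ t, ∀ j ∈ Z.truncDom N, R i j → j ∈ t) →
        ordProd t Z.letter = 1 := by
    intro N
    refine exists_noncrossing Z.idx _ (Z.truncDom N) Z.letter rfl (fun i _ => Z.idx_mem i) ?_
    rw [cls_eq_cl, cl_eq_one_iff] at hZ
    have := hZ N
    rwa [← trunc_eq_tr] at this
  choose R hR1 hR2 hR3 using hfin
  let 𝒰 := Filter.hyperfilter ℕ
  have hlarge : ∀ M : ℕ, ∀ᶠ N in (𝒰 : Filter ℕ), M ≤ N := fun M =>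
    Nat.hyperfilter_le_atTop (Filter.eventually_ge_atTop M)
  have hmem : ∀ i, ∀ᶠ N in (𝒰 : Filter ℕ), i ∈ Z.truncDom N := fun i =>
    (hlarge (Z.idx i)).mono fun N hN => (Z.mem_truncDom_iff_idx N i).2 hN
  let S : Setoid Z.dom :=
    { r := fun i j => ∀ᶠ N in (𝒰 : Filter ℕ), R N i j
      iseqv := ⟨fun i => Filter.Eventually.of_forall fun N => (R N).refl i,
        fun h => h.mono fun N h => (R N).symm h,
        fun h h' => (h.and h').mono fun N h => (R N).trans h.1 h.2⟩ }
  refine ⟨S, ⟨?_, ?_, ?_⟩⟩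
  · intro i j hij
    obtain ⟨N, ⟨h1, h2⟩, h3⟩ := (((hmem i).and (hmem j)).and hij).exists
    exact hR1 N i h1 j h2 h3
  · intro i j k l hij hjk hkl h1 h2
    have h1 : ∀ᶠ N in (𝒰 : Filter ℕ), R N i k := h1
    have h2 : ∀ᶠ N in (𝒰 : Filter ℕ), R N j l := h2
    filter_upwards [hmem i, hmem j, hmem k, hmem l, h1, h2] with N ha hb hc hd he hf
    exact hR2 N i ha j hb k hc l hd hij hjk hkl he hf
  · intro t ht
    rw [cl_eq_one_iff]
    intro M
    have h1 : ∀ᶠ N in (𝒰 : Filter ℕ), ∀ i ∈ Z.truncDom M, ∀ j ∈ Z.truncDom M,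
        R N i j → S i j := by
      rw [Filter.eventually_all_finset]
      intro i _
      rw [Filter.eventually_all_finset]
      intro j _
      by_cases h : S i j
      · exact Filter.Eventually.of_forall fun N _ => h
      · have h' : ¬ ∀ᶠ N in (𝒰 : Filter ℕ), R N i j := h
        rw [← Ultrafilter.eventually_not] at h'
        exact h'.mono fun N hN hN' => absurd hN' hN
    obtain ⟨N, hN1, hN2⟩ := (h1.and (hlarge M)).exists
    -- On the finitely many positions visible at level `M`, a typical `R N` refines the limit.
    -- Equivalent letters have equal index, so the visible part of a saturated set is saturated for
    -- `R N`.
    refine hR3 N _ ?_ ?_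
    · intro i hi
      rw [Finset.mem_filter, mem_truncDom_iff_idx] at hi
      exact (Z.mem_truncDom_iff_idx N i).2 (hi.1.trans hN2)
    · intro i hi j hj hij
      rw [Finset.mem_filter] at hi ⊢
      have hi' := (Z.mem_truncDom_iff_idx M i).1 hi.1
      have he := hR1 N i ((Z.mem_truncDom_iff_idx N i).2 (hi'.trans hN2)) j hj hij
      have hjM : j ∈ Z.truncDom M := (Z.mem_truncDom_iff_idx M j).2 (he ▸ hi')
      exact ⟨hjM, ht i hi.2 j (hN1 i hi.1 j hjM hij)⟩

end Word

end InfWord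

namespace InfWord

universe u v

variable {G : ℕ → Type u} [∀ n, Group (G n)]

theorem SMono.covBy {α β : Type*} [LinearOrder α] [LinearOrder β] {δ : ℤˣ} {f : α → β}
    {C : Set α} (h : SMono δ f C) (hfC : (f '' C).OrdConnected) {i j : α} (hi : i ∈ C) (hj : j ∈ C)
    (hij : i ⋖ j) : f i ⋖ f j ∨ f j ⋖ f i := by
  have hs := h i hi j hj hij.lt
  have key : ∀ k ∈ C, ¬ (i < k ∧ k < j) := fun k _ hk => hij.2 hk.1 hk.2
  rcases Int.units_eq_one_or δ with rfl | rfl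
  · rw [sLT_one] at hs
    refine Or.inl ⟨hs, fun z h1 h2 => ?_⟩
    obtain ⟨k, hk, rfl⟩ := hfC.out ⟨i, hi, rfl⟩ ⟨j, hj, rfl⟩ ⟨h1.le, h2.le⟩
    exact key k hk ⟨(h.lt_iff hi hk).1 h1, (h.lt_iff hk hj).1 h2⟩
  · rw [sLT_neg_one] at hs
    refine Or.inr ⟨hs, fun z h1 h2 => ?_⟩
    obtain ⟨k, hk, rfl⟩ := hfC.out ⟨j, hj, rfl⟩ ⟨i, hi, rfl⟩ ⟨h1.le, h2.le⟩
    exact key k hk ⟨(h.lt_iff' hk hi).1 h2, (h.lt_iff' hj hk).1 h1⟩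

namespace Word

/-! ### Cancellations and reduced intervals -/

/-- `W` is reduced on the set `C`. -/
def RedOn (W : Word G) (C : Set W.dom) : Prop :=
  (∀ A ⊆ C, A.OrdConnected → W.cl A = 1 → A = ∅) ∧
    ∀ i ∈ C, ∀ j ∈ C, i ⋖ j → ∀ n, ¬ (W.letter i ∈ factor G n ∧ W.letter j ∈ factor G n)

theorem IsReduced.redOn {W : Word G} (h : W.IsReduced) (C : Set W.dom) : W.RedOn C :=
  ⟨fun _ _ hA hcl => h.eq_empty hA hcl, fun i _ j _ hij => (isReduced_iff.1 h).2 i j hij⟩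

theorem isReduced_of_redOn {W : Word G} (h : W.RedOn Set.univ) : W.IsReduced :=
  isReduced_iff.2 ⟨fun A hA hcl => h.1 A (Set.subset_univ _) hA hcl,
    fun i j => h.2 i trivial j trivial⟩

theorem RedOn.letter_ne_one {W : Word G} {C : Set W.dom} (h : W.RedOn C) {i : W.dom}
    (hi : i ∈ C) : W.letter i ≠ 1 := by
  intro h1
  have : ({i} : Set W.dom) = ∅ := by
    refine h.1 _ (Set.singleton_subset_iff.2 hi) Set.ordConnected_singleton
      (cl_eq_one_iff.2 fun N => ?_)
    have hN : i ∈ W.truncDom N := (W.mem_truncDom N i).2 ⟨0, Nat.zero_le _, h1 ▸ one_mem _⟩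
    rw [tr_singleton W hN, h1]
  exact Set.singleton_ne_empty i this

theorem SMap.redOn {δ : ℤˣ} {W V : Word G} {f : W.dom → V.dom} {C : Set W.dom}
    (h : SMap δ W V f C) (hfC : (f '' C).OrdConnected) (hV : V.RedOn (f '' C)) : W.RedOn C := by
  constructor
  · intro A hAC hA hcl
    have := hV.1 (f '' A) (Set.image_mono hAC) (h.smono.ordConnected_image hfC hA hAC)
      (by rw [(h.mono hAC).cl_image, hcl, one_zpow])
    exact Set.image_eq_empty.1 this
  · intro i hi j hj hij n hn
    have h1 : V.letter (f i) ∈ factor G n := by rw [h.letter i hi, zpow_unit_mem]; exact hn.1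
    have h2 : V.letter (f j) ∈ factor G n := by rw [h.letter j hj, zpow_unit_mem]; exact hn.2
    rcases h.smono.covBy hfC hi hj hij with h3 | h3
    · exact hV.2 _ ⟨i, hi, rfl⟩ _ ⟨j, hj, rfl⟩ h3 n ⟨h1, h2⟩
    · exact hV.2 _ ⟨j, hj, rfl⟩ _ ⟨i, hi, rfl⟩ h3 n ⟨h2, h1⟩

theorem RedOn.image {δ : ℤˣ} {W V : Word G} {f : W.dom → V.dom} {C : Set W.dom}
    (h : SMap δ W V f C) (hC : C.OrdConnected) (hW : W.RedOn C) : V.RedOn (f '' C) := by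
  rcases C.eq_empty_or_nonempty with rfl | ⟨i, -⟩
  · simp only [Set.image_empty]
    exact ⟨fun A hA _ _ => Set.subset_empty_iff.1 hA, fun i hi => hi.elim⟩
  have : Nonempty W.dom := ⟨i⟩
  have him : Function.invFunOn f C '' (f '' C) = C := h.smono.injOn.invFunOn_image subset_rfl
  refine h.invFunOn.redOn ?_ ?_ <;> rw [him] <;> assumption

namespace Cancellation

variable {Z : Word G} {R : Setoid Z.dom}

/-- A class that meets the gap between two consecutive members of another class cannot leave it
without crossing, so the gap is a union of classes and cancels. -/
theorem saturated_Ioo (h : Z.Cancellation R) {i j : Z.dom} (hij : R i j)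
    (hb : ∀ k, R i k → ¬ (i < k ∧ k < j)) :
    ∀ k ∈ Set.Ioo i j, ∀ l, R k l → l ∈ Set.Ioo i j := by
  intro k hk l hkl
  have hik : ¬ R i k := fun hik => hb k hik hk
  have hil : ¬ R i l := fun hil => hik (R.trans hil (R.symm hkl))
  by_contra hl
  rcases lt_trichotomy l i with h3 | h3 | h3
  · exact hil (R.symm (h.noncrossing l i k j h3 hk.1 hk.2 (R.symm hkl) hij))
  · exact hil (h3 ▸ R.refl l)
  · rcases lt_trichotomy l j with h4 | h4 | h4
    · exact hl ⟨h3, h4⟩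
    · exact hil (h4 ▸ hij)
    · exact hik (h.noncrossing i k j l hk.1 hk.2 h4 hij hkl)

theorem finite_class (h : Z.Cancellation R) (i : Z.dom) : {j | R i j}.Finite := by
  refine (Z.finite_mem (Z.idx i)).subset fun j hj => ?_
  change Z.letter j ∈ factor G (Z.idx i)
  rw [h.idx_eq i j hj]
  exact Z.idx_mem j

/-- Two consecutive members of a class inside a reduced interval enclose a gap that cancels and is
therefore empty. They are then neighbours in a common factor, which reducedness forbids. -/
theorem eq_of_redOn (h : Z.Cancellation R) {C : Set Z.dom} (hC : C.OrdConnected)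
    (hred : Z.RedOn C) {i j : Z.dom} (hi : i ∈ C) (hj : j ∈ C) (hij : R i j) : i = j := by
  wlog hlt : i < j generalizing i j
  · rcases (not_lt.1 hlt).lt_or_eq with h1 | h1
    · exact (this hj hi (R.symm hij) h1).symm
    · exact h1.symm
  exfalso
  obtain ⟨m, ⟨him, hm⟩, hmin⟩ := ((h.finite_class i).inter_of_left (Set.Ioi i)).exists_minimal
    ⟨j, hij, hlt⟩
  have hmj : m ≤ j := by
    by_contra hjm
    exact hjm (hmin ⟨hij, hlt⟩ (not_le.1 hjm).le)
  have hmC : m ∈ C := hC.out hi hj ⟨le_of_lt hm, hmj⟩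
  have hsat := h.saturated_Ioo him fun k hik hk => absurd (hmin ⟨hik, hk.1⟩ hk.2.le) (not_le.2 hk.2)
  have hemp := hred.1 (Set.Ioo i m)
    (Set.Ioo_subset_Icc_self.trans (hC.out hi hmC)) Set.ordConnected_Ioo (h.cl_eq_one _ hsat)
  refine hred.2 i hi m hmC ⟨hm, fun z h1 h2 => ?_⟩ (Z.idx i)
    ⟨Z.idx_mem i, h.idx_eq i m him ▸ Z.idx_mem m⟩
  exact Set.notMem_empty z (hemp ▸ ⟨h1, h2⟩)

theorem cl_class (h : Z.Cancellation R) (i : Z.dom) : Z.cl {j | R i j} = 1 :=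
  h.cl_eq_one _ fun _ hj _ hk => R.trans hj hk

end Cancellation

/-! ### Concatenations and inverses in terms of signed maps -/

theorem smap_inL (W V : Word G) : SMap 1 W (W.concat V) (inL W V) Set.univ :=
  ⟨fun a _ => by simp only [Units.val_one, zpow_one]; rfl,
    fun a _ b _ h => by rw [sLT_one, inL_lt_inL]; exact h⟩

theorem smap_inR (W V : Word G) : SMap 1 V (W.concat V) (inR W V) Set.univ :=
  ⟨fun a _ => by simp only [Units.val_one, zpow_one]; rfl,
    fun a _ b _ h => by rw [sLT_one, inR_lt_inR]; exact h⟩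

theorem smap_toInv (W : Word G) : SMap (-1) W W.inv W.toInv Set.univ :=
  ⟨fun a _ => by simp only [Units.val_neg, Units.val_one, zpow_neg, zpow_one]; rfl,
    fun a _ b _ h => (sLT_neg_one (W.toInv a) (W.toInv b)).2 (show W.toInv b < W.toInv a from h)⟩

theorem smap_val (W : Word G) (A : Set W.dom) : SMap 1 (W.restrict A) W (W.val A) Set.univ :=
  ⟨fun a _ => by simp only [Units.val_one, zpow_one]; rfl,
    fun a _ b _ h => by rw [sLT_one]; exact h⟩

theorem image_val_univ (W : Word G) (A : Set W.dom) : W.val A '' Set.univ = A := by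
  rw [Set.image_univ]
  exact Subtype.range_coe

theorem ordConnected_image_inL (W V : Word G) {A : Set W.dom} (hA : A.OrdConnected) :
    (inL W V '' A).OrdConnected := by
  refine Set.ordConnected_def.2 ?_
  rintro _ ⟨a, ha, rfl⟩ _ ⟨b, hb, rfl⟩ z ⟨h1, h2⟩
  rcases concat_cases W V z with ⟨c, rfl⟩ | ⟨c, rfl⟩
  · rw [← not_lt, inL_lt_inL, not_lt] at h1 h2
    exact ⟨c, hA.out ha hb ⟨h1, h2⟩, rfl⟩
  · exact absurd (inL_lt_inR W V b c) (not_lt.2 h2)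

theorem ordConnected_image_inR (W V : Word G) {A : Set V.dom} (hA : A.OrdConnected) :
    (inR W V '' A).OrdConnected := by
  refine Set.ordConnected_def.2 ?_
  rintro _ ⟨a, ha, rfl⟩ _ ⟨b, hb, rfl⟩ z ⟨h1, h2⟩
  rcases concat_cases W V z with ⟨c, rfl⟩ | ⟨c, rfl⟩
  · exact absurd (inL_lt_inR W V c a) (not_lt.2 h1)
  · rw [← not_lt, inR_lt_inR, not_lt] at h1 h2
    exact ⟨c, hA.out ha hb ⟨h1, h2⟩, rfl⟩

theorem ordConnected_image_toInv (W : Word G) {A : Set W.dom} (hA : A.OrdConnected) :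
    (W.toInv '' A).OrdConnected := by
  refine Set.ordConnected_def.2 ?_
  rintro _ ⟨a, ha, rfl⟩ _ ⟨b, hb, rfl⟩ z ⟨h1, h2⟩
  exact ⟨OrderDual.ofDual z, hA.out hb ha ⟨h2, h1⟩, rfl⟩

theorem cl_mem_fine_of_ordConnected {X : Type*} {𝒲 : X → Word G} {x : X} {A : Set (𝒲 x).dom}
    (hA : A.OrdConnected) : (𝒲 x).cl A ∈ Fine 𝒲 :=
  Subgroup.subset_closure ⟨x, _, isSubword_restrict _ hA, rfl⟩

/-! ### Words representing elements of `Fine` -/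

/-- `C` is carried, possibly inverted, onto an interval of one of the words `𝒲 x`. -/
def Piece {X : Type*} (𝒲 : X → Word G) (V : Word G) (C : Set V.dom) : Prop :=
  ∃ (x : X) (δ : ℤˣ) (f : V.dom → (𝒲 x).dom), SMap δ V (𝒲 x) f C ∧ (f '' C).OrdConnected

theorem Piece.preimage {X : Type*} {𝒲 : X → Word G} {V V' : Word G} {C : Set V.dom}
    (h : Piece 𝒲 V C) {ε : ℤˣ} {g : V'.dom → V.dom} {C' : Set V'.dom} (hg : SMap ε V' V g C')
    (hC : g '' C' = C) : Piece 𝒲 V' C' := by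
  subst hC
  obtain ⟨x, δ, f, hf, hc⟩ := h
  exact ⟨x, δ * ε, _, hf.comp hg, by rwa [Set.image_image] at hc⟩

/-- The colour `c` numbers the generators in a product of generators and their inverses, read from
left to right. The word `V` need not be reduced, but each colour class is a copy of an interval of
some `𝒲 x`. -/
theorem exists_word_of_mem_fine {X : Type*} {𝒲 : X → Word G} {g : TopProd G}
    (hg : g ∈ Fine 𝒲) : ∃ (V : Word G) (k : ℕ) (c : V.dom → ℕ), V.cls = g ∧ Monotone c ∧
      (∀ v, c v < k) ∧ ∀ v, Piece 𝒲 V {w | c w = c v} := by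
  refine Subgroup.closure_induction ?_ ?_ ?_ ?_ hg
  · rintro _ ⟨x, V, hV, rfl⟩
    refine ⟨V, 1, fun _ => 0, rfl, monotone_const, fun _ => Nat.zero_lt_one, fun v => ?_⟩
    obtain ⟨f, hf, hc⟩ := hV.exists_smap
    have hu : {w : V.dom | (fun _ : V.dom => 0) w = (fun _ : V.dom => 0) v} = Set.univ :=
      Set.eq_univ_of_forall fun _ => rfl
    exact ⟨x, 1, f, by rw [hu]; exact ⟨hf, hc⟩⟩
  · exact ⟨empty G, 0, fun v => v.elim, rfl, fun v => v.elim, fun v => v.elim, fun v => v.elim⟩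
  · rintro _ _ - - ⟨V, k, c, rfl, hc, hk, hp⟩ ⟨V', k', c', rfl, hc', hk', hp'⟩
    let C : (V.concat V').dom → ℕ := fun i => Sum.elim c (fun v => k + c' v) (ofLex i)
    have hL : ∀ a, C (inL V V' a) = c a := fun a => rfl
    have hR : ∀ a, C (inR V V' a) = k + c' a := fun a => rfl
    have hLR : ∀ a b, C (inL V V' a) ≠ C (inR V V' b) := fun a b => by
      have := hk a
      rw [hL, hR]
      omega
    refine ⟨V.concat V', k + k', C, rfl, ?_, ?_, ?_⟩
    · intro i j hij
      rcases concat_cases V V' i with ⟨a, rfl⟩ | ⟨a, rfl⟩ <;>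
      rcases concat_cases V V' j with ⟨b, rfl⟩ | ⟨b, rfl⟩
      · rw [← not_lt, inL_lt_inL, not_lt] at hij
        exact hc hij
      · have := hk a
        rw [hL, hR]
        omega
      · exact absurd (inL_lt_inR V V' b a) (not_lt.2 hij)
      · rw [← not_lt, inR_lt_inR, not_lt] at hij
        exact Nat.add_le_add_left (hc' hij) k
    · intro i
      rcases concat_cases V V' i with ⟨a, rfl⟩ | ⟨a, rfl⟩
      · have := hk a
        rw [hL]
        omega
      · have := hk' a
        rw [hR]
        omega
    · intro i
      rcases concat_cases V V' i with ⟨a, rfl⟩ | ⟨a, rfl⟩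
      · have : Nonempty V.dom := ⟨a⟩
        have hs : {w | C w = C (inL V V' a)} = inL V V' '' {w | c w = c a} := by
          ext w
          constructor
          · intro hw
            rcases concat_cases V V' w with ⟨b, rfl⟩ | ⟨b, rfl⟩
            exacts [⟨b, hw, rfl⟩, absurd (Eq.symm hw) (hLR a b)]
          · rintro ⟨b, hb, rfl⟩
            exact hb
        rw [hs]
        have hm := (smap_inL V V').mono (Set.subset_univ {w | c w = c a})
        exact (hp a).preimage hm.invFunOn (hm.smono.injOn.invFunOn_image subset_rfl)
      · have : Nonempty V'.dom := ⟨a⟩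
        have hs : {w | C w = C (inR V V' a)} = inR V V' '' {w | c' w = c' a} := by
          ext w
          constructor
          · intro hw
            rcases concat_cases V V' w with ⟨b, rfl⟩ | ⟨b, rfl⟩
            exacts [absurd hw (hLR b a), ⟨b, Nat.add_left_cancel hw, rfl⟩]
          · rintro ⟨b, hb, rfl⟩
            exact congrArg (k + ·) hb
        rw [hs]
        have hm := (smap_inR V V').mono (Set.subset_univ {w | c' w = c' a})
        exact (hp' a).preimage hm.invFunOn (hm.smono.injOn.invFunOn_image subset_rfl)
  · rintro _ - ⟨V, k, c, rfl, hc, hk, hp⟩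
    refine ⟨V.inv, k, fun i => k - 1 - c (OrderDual.ofDual i), rfl, ?_, ?_, ?_⟩
    · intro i j hij
      exact Nat.sub_le_sub_left (hc hij) _
    · intro i
      have := hk (OrderDual.ofDual i)
      dsimp only
      omega
    · intro i
      have hs : {w : V.inv.dom | k - 1 - c (OrderDual.ofDual w) = k - 1 - c (OrderDual.ofDual i)} =
          V.toInv '' {w | c w = c (OrderDual.ofDual i)} := by
        ext w
        constructor
        · intro hw
          refine ⟨OrderDual.ofDual w, ?_, rfl⟩
          have h1 := hk (OrderDual.ofDual w)
          have h2 := hk (OrderDual.ofDual i)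
          simp only [Set.mem_ofPred_eq] at hw ⊢
          omega
        · rintro ⟨b, hb, rfl⟩
          exact congrArg (k - 1 - ·) hb
      have : Nonempty V.dom := ⟨OrderDual.ofDual i⟩
      rw [hs]
      have hm := (smap_toInv V).mono (Set.subset_univ {w | c w = c (OrderDual.ofDual i)})
      exact (hp (OrderDual.ofDual i)).preimage hm.invFunOn (hm.smono.injOn.invFunOn_image subset_rfl)

end Word

end InfWord

/-! ### Structure of the reduced words in `Fine` -/

namespace InfWord

universe u v

variable {G : ℕ → Type u} [∀ n, Group (G n)]

namespace Word

theorem cl_mem_of_finite (W : Word G) (H : Subgroup (TopProd G)) {S : Set W.dom} (hS : S.Finite)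
    (h : ∀ i ∈ S, W.cl {i} ∈ H) : W.cl S ∈ H := by
  classical
  obtain ⟨s, rfl⟩ := hS.exists_finset_coe
  induction s using Finset.induction_on_max with
  | empty =>
    rw [Finset.coe_empty, cl_empty]
    exact one_mem H
  | insert a s hmax ih =>
    rw [Finset.coe_insert, Set.insert_eq, Set.union_comm, cl_union]
    · exact mul_mem (ih s.finite_toSet fun i hi => h i (by simpa using Or.inr hi))
        (h a (by simp))
    · rintro x hx y rfl
      exact hmax x hx

/-- A reduced word whose class lies in `Fine 𝒲` is, up to finitely many positions, covered by
finitely many disjoint intervals that come from intervals of the words `𝒲 x`. -/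
theorem exists_pieces {X : Type*} {𝒲 : X → Word G} (h𝒲 : ∀ x, (𝒲 x).IsReduced) {W : Word G}
    (hW : W.IsReduced) (hmem : W.cls ∈ Fine 𝒲) :
    ∃ (k : ℕ) (D : ℕ → Set W.dom), (∀ j, (D j).OrdConnected) ∧
      (∀ i j j', i ∈ D j → i ∈ D j' → j = j') ∧ (∀ i j, i ∈ D j → j < k) ∧
      (∀ j, (D j).Nonempty → Piece 𝒲 W (D j)) ∧ {i | ∀ j, i ∉ D j}.Finite ∧
      ∀ i, W.cl {i} ∈ Fine 𝒲 := by
  classical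
  obtain ⟨V, k, c, hVW, hc, hk, hp⟩ := exists_word_of_mem_fine hmem
  -- The trivial word `W⁻¹V` shows how the reduced word `W` arises from the product `V`. A class
  -- contains at most one position of `W` (`r1`) and at most one of each colour of `V` (`r2`), and
  -- every position of `W` is linked to `V` (`r3`). As `W` appears reversed, noncrossing makes the
  -- links increasing (`nc`).
  let Z := W.inv.concat V
  let a : W.dom → Z.dom := fun i => inL W.inv V (W.toInv i)
  let b : V.dom → Z.dom := inR W.inv V
  have hZ : Z.cls = 1 := by rw [cls_concat, hVW, cls_inv, inv_mul_cancel]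
  obtain ⟨R, hR⟩ := Z.exists_cancellation hZ
  have ha : SMap (-1) W Z a Set.univ := by
    have := ((smap_inL W.inv V).mono (Set.subset_univ (W.toInv '' Set.univ))).comp W.smap_toInv
    simpa using this
  have hb : SMap 1 V Z b Set.univ := smap_inR W.inv V
  have hab : ∀ i v, a i < b v := fun i v => inL_lt_inR _ _ _ _
  have hcases : ∀ z : Z.dom, (∃ i, z = a i) ∨ ∃ v, z = b v := fun z => by
    rcases concat_cases W.inv V z with ⟨i, rfl⟩ | ⟨v, rfl⟩
    exacts [Or.inl ⟨OrderDual.ofDual i, rfl⟩, Or.inr ⟨v, rfl⟩]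
  have ha_lt : ∀ i j, a i < a j ↔ j < i := fun i j => ha.smono.lt_iff' trivial trivial
  have hb_lt : ∀ i j, b i < b j ↔ i < j := fun i j => hb.smono.lt_iff trivial trivial
  have ha_inj : ∀ i j, a i = a j → i = j := fun i j h => ha.smono.injOn trivial trivial h
  have hb_inj : ∀ i j, b i = b j → i = j := fun i j h => hb.smono.injOn trivial trivial h
  have hane : ∀ i v, a i ≠ b v := fun i v => (hab i v).ne
  -- positions of `W`, and positions of one piece of `V`, are inequivalent
  have r1 : ∀ i i', R (a i) (a i') → i = i' := by
    intro i i' h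
    have hcon : (a '' Set.univ).OrdConnected := by
      have := ordConnected_image_inL W.inv V
        (ordConnected_image_toInv W (A := Set.univ) Set.ordConnected_univ)
      rwa [Set.image_image] at this
    exact ha_inj _ _ (hR.eq_of_redOn hcon ((hW.redOn Set.univ).image ha Set.ordConnected_univ)
      ⟨i, trivial, rfl⟩ ⟨i', trivial, rfl⟩ h)
  have hfib : ∀ v, ({w | c w = c v} : Set V.dom).OrdConnected := fun v =>
    Set.ordConnected_def.2 fun x hx y hy z hz =>
      le_antisymm ((hc hz.2).trans (le_of_eq hy)) ((le_of_eq hx.symm).trans (hc hz.1))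
  have hVred : ∀ v, V.RedOn {w | c w = c v} := fun v => by
    obtain ⟨x, δ, f, hf, hfc⟩ := hp v
    exact hf.redOn hfc ((h𝒲 x).redOn _)
  have r2 : ∀ v v', R (b v) (b v') → c v = c v' → v = v' := by
    intro v v' h hcv
    exact hb_inj _ _ (hR.eq_of_redOn (ordConnected_image_inR W.inv V (hfib v))
      ((hVred v).image (hb.mono (Set.subset_univ _)) (hfib v)) ⟨v, rfl, rfl⟩ ⟨v', hcv.symm, rfl⟩ h)
  have hsingle : ∀ z : Z.dom, Z.letter z ≠ 1 → ∃ z', z' ≠ z ∧ R z z' := by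
    intro z hz
    by_contra hcon
    push Not at hcon
    have h1 := hR.cl_class z
    rw [show {j | R z j} = {z} from ?_, cl_eq_one_iff] at h1
    · have h2 := h1 (Z.idx z)
      rw [tr_singleton Z ((Z.mem_truncDom_iff_idx _ _).2 le_rfl)] at h2
      exact hz h2
    · ext j
      constructor
      · intro hj
        by_contra hne
        exact hcon j hne hj
      · rintro rfl
        exact R.refl j
  have r3 : ∀ i, ∃ v, R (a i) (b v) := by
    intro i
    obtain ⟨z, hz, hRz⟩ := hsingle (a i) (by
      rw [ha.letter i trivial, Ne, zpow_unit_eq_one]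
      exact hW.letter_ne_one i)
    rcases hcases z with ⟨i', rfl⟩ | ⟨v, rfl⟩
    · exact absurd (congrArg a (r1 i i' hRz).symm) hz
    · exact ⟨v, hRz⟩
  have nc : ∀ i i' v v', i < i' → R (a i) (b v) → R (a i') (b v') → v < v' := by
    intro i i' v v' hii h h'
    rcases lt_trichotomy v v' with h1 | h1 | h1
    · exact h1
    · subst h1
      exact absurd (r1 i i' (R.trans h (R.symm h'))) hii.ne
    · have := hR.noncrossing (a i') (a i) (b v') (b v) ((ha_lt _ _).2 hii) (hab _ _)
        ((hb_lt _ _).2 h1) h' h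
      exact absurd (r1 i' i this) hii.ne'
  choose p hpR using r3
  -- `D j` collects the letters of `W` that come from the colour `j` alone, hence from a single
  -- letter of `V`.
  let D : ℕ → Set W.dom := fun j => {i | ∀ v, R (a i) (b v) → c v = j}
  have hDp : ∀ {i j}, i ∈ D j → c (p i) = j := fun {i j} hi => hi _ (hpR i)
  have hDu : ∀ {i j v}, i ∈ D j → R (a i) (b v) → v = p i := fun {i j v} hi hv =>
    r2 _ _ (R.trans (R.symm hv) (hpR i)) ((hi v hv).trans (hDp hi).symm)
  have hDconn : ∀ j, (D j).OrdConnected := by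
    intro j
    refine Set.ordConnected_def.2 fun i1 h1 i2 h2 i hi v hv => ?_
    rcases hi.1.lt_or_eq with h3 | rfl
    · rcases hi.2.lt_or_eq with h4 | rfl
      · have h5 := hc (nc _ _ _ _ h3 (hpR i1) hv).le
        have h6 := hc (nc _ _ _ _ h4 hv (hpR i2)).le
        rw [hDp h1] at h5
        rw [hDp h2] at h6
        exact le_antisymm h6 h5
      · exact h2 v hv
    · exact h1 v hv
  have hmono : ∀ j, SMono 1 p (D j) := fun j i _ i' _ h =>
    (sLT_one _ _).2 (nc i i' _ _ h (hpR i) (hpR i'))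
  have hVone : ∀ v, V.letter v ≠ 1 := fun v => (hVred v).letter_ne_one rfl
  have himg : ∀ j, (p '' D j).OrdConnected := by
    intro j
    refine Set.ordConnected_def.2 ?_
    rintro _ ⟨i1, h1, rfl⟩ _ ⟨i2, h2, rfl⟩ v hv
    rcases hv.1.lt_or_eq with hv1 | rfl
    swap
    · exact ⟨i1, h1, rfl⟩
    rcases hv.2.lt_or_eq with hv2 | rfl
    swap
    · exact ⟨i2, h2, rfl⟩
    have hcv : c v = j :=
      le_antisymm ((hc hv.2).trans_eq (hDp h2)) ((hDp h1).symm.trans_le (hc hv.1))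
    -- The nontrivial letter at `v` must cancel with something. A partner in `W` lies between `i1`
    -- and `i2`, as required. A partner in `V` has another colour, so it lies beyond `p i1` or `p
    -- i2`, and noncrossing links it to `i1`, or `v` to `i2`; both are excluded.
    obtain ⟨z, hz, hRz⟩ := hsingle (b v) (by
      rw [hb.letter v trivial, Ne, zpow_unit_eq_one]
      exact hVone v)
    rcases hcases z with ⟨i, rfl⟩ | ⟨w, rfl⟩
    · have hRi := R.symm hRz
      have hi1 : i1 ≤ i := by
        by_contra hlt
        exact lt_asymm hv1 (nc _ _ _ _ (not_le.1 hlt) hRi (hpR i1))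
      have hi2 : i ≤ i2 := by
        by_contra hlt
        exact lt_asymm hv2 (nc _ _ _ _ (not_le.1 hlt) (hpR i2) hRi)
      have hi := (hDconn j).out h1 h2 ⟨hi1, hi2⟩
      exact ⟨i, hi, (hDu hi hRi).symm⟩
    · exfalso
      have hcw : c w ≠ j := fun h => hz (congrArg b (r2 _ _ hRz (hcv.trans h.symm)).symm)
      rcases lt_or_ge w (p i1) with h3 | h3
      · have := hR.noncrossing (a i1) (b w) (b (p i1)) (b v) (hab _ _) ((hb_lt _ _).2 h3)
          ((hb_lt _ _).2 hv1) (hpR i1) (R.symm hRz)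
        exact hcw (h1 w this)
      · have h4 : p i2 < w := by
          by_contra hle
          exact hcw (le_antisymm ((hc (not_lt.1 hle)).trans_eq (hDp h2))
            ((hDp h1).symm.trans_le (hc h3)))
        have := hR.noncrossing (a i2) (b v) (b (p i2)) (b w) (hab _ _) ((hb_lt _ _).2 hv2)
          ((hb_lt _ _).2 h4) (hpR i2) hRz
        exact hv2.ne (hDu h2 this)
  have hclass : ∀ i, {z | R (a i) z} = {a i} ∪ b '' {v | R (a i) (b v)} := by
    intro i
    ext z
    rcases hcases z with ⟨i', rfl⟩ | ⟨v, rfl⟩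
    · constructor
      · intro h
        rw [r1 i i' h]
        exact Or.inl rfl
      · rintro (h | ⟨v, -, h⟩)
        · rw [h]
          exact R.refl _
        · exact absurd h.symm (hane i' v)
    · constructor
      · exact fun h => Or.inr ⟨v, h, rfl⟩
      · rintro (h | ⟨w, hw, h⟩)
        · exact absurd h.symm (hane i v)
        · rw [← h]
          exact hw
  have hclone : ∀ i, W.cl {i} = V.cl {v | R (a i) (b v)} := by
    intro i
    have h1 := hR.cl_class (a i)
    rw [hclass, cl_union, (hb.mono (Set.subset_univ _)).cl_image] at h1
    · have h2 := (ha.mono (Set.subset_univ {i})).cl_image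
      rw [Set.image_singleton] at h2
      rw [h2] at h1
      simp only [Units.val_neg, Units.val_one, zpow_neg, zpow_one] at h1
      rw [inv_mul_eq_one] at h1
      exact h1
    · rintro _ rfl _ ⟨v, -, rfl⟩
      exact hab i v
  have hletter : ∀ j, ∀ i ∈ D j, V.letter (p i) = W.letter i := by
    intro j i hi
    have h1 := hclone i
    rw [show {v | R (a i) (b v)} = {p i} from ?_, cl_eq_iff] at h1
    · have h2 := h1 (max (W.idx i) (V.idx (p i)))
      rw [tr_singleton, tr_singleton] at h2
      · exact h2.symm
      · exact (mem_truncDom_iff_idx _ _ _).2 (le_max_right _ _)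
      · exact (mem_truncDom_iff_idx _ _ _).2 (le_max_left _ _)
    · ext v
      constructor
      · exact fun hv => hDu hi hv
      · rintro rfl
        exact hpR i
  refine ⟨k, D, hDconn, ?_, ?_, ?_, ?_, ?_⟩
  · intro i j j' hi hi'
    rw [← hDp hi, hDp hi']
  · intro i j hi
    rw [← hDp hi]
    exact hk _
  · rintro j ⟨i, hi⟩
    obtain ⟨x, δ, f, hf, hfc⟩ := hp (p i)
    have hsub : p '' D j ⊆ {w | c w = c (p i)} := by
      rintro _ ⟨i', hi', rfl⟩
      exact (hDp hi').trans (hDp hi).symm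
    have hpm : SMap 1 W V p (D j) :=
      ⟨fun i hi => by simpa using hletter j i hi, hmono j⟩
    refine ⟨x, δ * 1, _, (hf.mono hsub).comp hpm, ?_⟩
    have := hf.smono.ordConnected_image hfc (himg j) hsub
    rwa [Set.image_image] at this
  · refine Set.Finite.of_finite_image (f := fun i => c '' {v | R (a i) (b v)}) ?_ ?_
    · refine Set.Finite.subset (Set.finite_Iio k).powerset ?_
      rintro _ ⟨i, -, rfl⟩ _ ⟨v, -, rfl⟩
      exact hk v
    · intro i hi i' hi' he
      by_contra hne
      have key : ∀ i i' : W.dom, i < i' → (∀ j, i ∉ D j) →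
          c '' {v | R (a i) (b v)} = c '' {v | R (a i') (b v)} → False := by
        intro i i' hlt hi he
        have : ∃ v, R (a i) (b v) ∧ c v ≠ c (p i) := by
          by_contra hcon
          push Not at hcon
          exact hi (c (p i)) hcon
        obtain ⟨v, hv, hne⟩ := this
        have h1 : c v ∈ c '' {v | R (a i') (b v)} := he ▸ ⟨v, hv, rfl⟩
        have h2 : c (p i) ∈ c '' {v | R (a i') (b v)} := he ▸ ⟨p i, hpR i, rfl⟩
        obtain ⟨v', hv', hcv'⟩ := h1
        obtain ⟨w', hw', hcw'⟩ := h2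
        have h3 := hc (nc i i' _ _ hlt hv hw').le
        have h4 := hc (nc i i' _ _ hlt (hpR i) hv').le
        omega
      rcases lt_or_gt_of_ne hne with h | h
      · exact key i i' h hi he
      · exact key i' i h hi' he.symm
  · intro i
    rw [hclone]
    refine cl_mem_of_finite V _ ?_ ?_
    · exact Set.Finite.preimage (hb.smono.injOn.mono (Set.subset_univ _)) (hR.finite_class (a i))
    · intro v _
      obtain ⟨x, δ, f, hf, hfc⟩ := hp v
      have h1 := (hf.mono (Set.singleton_subset_iff.2 (rfl : v ∈ {w | c w = c v}))).cl_image
      rw [Set.image_singleton] at h1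
      have h2 : (𝒲 x).cl {f v} ∈ Fine 𝒲 := cl_mem_fine_of_ordConnected Set.ordConnected_singleton
      rw [h1] at h2
      rcases Int.units_eq_one_or δ with rfl | rfl
      · simpa using h2
      · simpa using h2

end Word

end InfWord

namespace InfWord

universe u v

/-! ### Induction over intervals -/

/-- An interval inside `D` is a finite ordered concatenation of points of `E` and of intervals
within single members of `𝒞` that avoid `E`. The members of `𝒞` may overlap: they are removed one at
a time, after an outer induction has split the interval at its points in `E`. -/
theorem interval_induction {Λ : Type*} [LinearOrder Λ] {P : Set Λ → Prop}
    (hu : ∀ A B : Set Λ, A.OrdConnected → B.OrdConnected → (A ∪ B).OrdConnected →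
      (∀ a ∈ A, ∀ b ∈ B, a < b) → P A → P B → P (A ∪ B)) (h0 : P ∅)
    {𝒞 : Set (Set Λ)} (hfin : 𝒞.Finite) {E : Set Λ} (hE : E.Finite)
    (hC : ∀ C ∈ 𝒞, C.OrdConnected) {D : Set Λ} (hD : D ⊆ ⋃₀ 𝒞 ∪ E)
    (hPE : ∀ e ∈ E, e ∈ D → P {e})
    (hPC : ∀ C ∈ 𝒞, ∀ I ⊆ C, I ⊆ D → I.OrdConnected → Disjoint I E → P I) :
    ∀ I ⊆ D, I.OrdConnected → P I := by
  have split : ∀ (I J : Set Λ), I.OrdConnected → J ⊆ I → J.OrdConnected → J.Nonempty →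
      P {i ∈ I | ∀ j ∈ J, i < j} → P J → P {i ∈ I | ∀ j ∈ J, j < i} → P I := by
    intro I J hI hJI hJ hne h1 h2 h3
    have hL : ({i ∈ I | ∀ j ∈ J, i < j} : Set Λ).OrdConnected :=
      Set.ordConnected_def.2 fun x hx y hy z hz =>
        ⟨hI.out hx.1 hy.1 hz, fun j hj => hz.2.trans_lt (hy.2 j hj)⟩
    have hR : ({i ∈ I | ∀ j ∈ J, j < i} : Set Λ).OrdConnected :=
      Set.ordConnected_def.2 fun x hx y hy z hz =>
        ⟨hI.out hx.1 hy.1 hz, fun j hj => (hx.2 j hj).trans_le hz.1⟩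
    have hI' : I = ({i ∈ I | ∀ j ∈ J, i < j} ∪ J) ∪ {i ∈ I | ∀ j ∈ J, j < i} := by
      ext i
      constructor
      · intro hi
        rcases Word.ordConnected_decomp hJ i with h | h | h
        exacts [Or.inl (Or.inl ⟨hi, h⟩), Or.inl (Or.inr h), Or.inr ⟨hi, h⟩]
      · rintro ((h | h) | h)
        exacts [h.1, hJI h, h.1]
    have hLJ : ({i ∈ I | ∀ j ∈ J, i < j} ∪ J).OrdConnected := by
      refine Set.ordConnected_def.2 ?_
      intro x hx y hy z hz
      obtain ⟨j0, hj0⟩ := hne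
      have hyJ : ∃ j ∈ J, y ≤ j := by
        rcases hy with h | h
        exacts [⟨j0, hj0, (h.2 j0 hj0).le⟩, ⟨y, h, le_rfl⟩]
      obtain ⟨j, hj, hyj⟩ := hyJ
      have hxI : x ∈ I := hx.elim (fun h => h.1) fun h => hJI h
      have hzI := hI.out hxI (hJI hj) ⟨hz.1, hz.2.trans hyj⟩
      rcases Word.ordConnected_decomp hJ z with h | h | h
      · exact Or.inl ⟨hzI, h⟩
      · exact Or.inr h
      · exact absurd (h j hj) (not_lt.2 (hz.2.trans hyj))
    have hlt : ∀ a ∈ ({i ∈ I | ∀ j ∈ J, i < j} ∪ J), ∀ b ∈ {i ∈ I | ∀ j ∈ J, j < i}, a < b := by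
      rintro a (ha | ha) b hb
      · obtain ⟨j0, hj0⟩ := hne
        exact (ha.2 j0 hj0).trans (hb.2 j0 hj0)
      · exact hb.2 a ha
    rw [hI']
    refine hu _ _ hLJ hR (hI' ▸ hI) hlt ?_ h3
    exact hu _ _ hL hJ hLJ (fun a ha b hb => ha.2 b hb) h1 h2
  have step1 : ∀ I ⊆ D, I.OrdConnected → Disjoint I E → I ⊆ ⋃₀ 𝒞 → P I := by
    refine hfin.induction_on_subset (motive := fun 𝒟 _ =>
      ∀ I ⊆ D, I.OrdConnected → Disjoint I E → I ⊆ ⋃₀ 𝒟 → P I) 𝒞 ?_ ?_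
    · intro I _ _ _ hI
      rw [Set.sUnion_empty, Set.subset_empty_iff] at hI
      rwa [hI]
    · intro C 𝒟 hC𝒞 _ _ ih I hID hI hIE hIC
      have hsub : ∀ J ⊆ I, (∀ j ∈ J, j ∉ C) → J ⊆ ⋃₀ 𝒟 := by
        intro J hJ hJC j hj
        obtain ⟨C', hC', hjC'⟩ := hIC (hJ hj)
        rcases Set.mem_insert_iff.1 hC' with rfl | h
        · exact absurd hjC' (hJC j hj)
        · exact ⟨C', h, hjC'⟩
      rcases (I ∩ C).eq_empty_or_nonempty with h | h
      · exact ih I hID hI hIE (hsub I subset_rfl fun j hj hjC => h.subset ⟨hj, hjC⟩)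
      · have hLs : {i ∈ I | ∀ j ∈ I ∩ C, i < j} ⊆ I := fun i hi => hi.1
        have hRs : {i ∈ I | ∀ j ∈ I ∩ C, j < i} ⊆ I := fun i hi => hi.1
        refine split I (I ∩ C) hI Set.inter_subset_left (hI.inter (hC C hC𝒞)) h ?_ ?_ ?_
        · refine ih _ (hLs.trans hID) ?_ (hIE.mono_left hLs)
            (hsub _ hLs fun j hj hjC => lt_irrefl _ (hj.2 j ⟨hj.1, hjC⟩))
          exact Set.ordConnected_def.2 fun x hx y hy z hz =>
            ⟨hI.out hx.1 hy.1 hz, fun j hj => hz.2.trans_lt (hy.2 j hj)⟩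
        · exact hPC C hC𝒞 _ Set.inter_subset_right (Set.inter_subset_left.trans hID)
            (hI.inter (hC C hC𝒞)) (hIE.mono_left Set.inter_subset_left)
        · refine ih _ (hRs.trans hID) ?_ (hIE.mono_left hRs)
            (hsub _ hRs fun j hj hjC => lt_irrefl _ (hj.2 j ⟨hj.1, hjC⟩))
          exact Set.ordConnected_def.2 fun x hx y hy z hz =>
            ⟨hI.out hx.1 hy.1 hz, fun j hj => (hx.2 j hj).trans_le hz.1⟩
  have step2 : ∀ (n : ℕ) (I : Set Λ), I ⊆ D → I.OrdConnected → (I ∩ E).ncard = n → P I := by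
    intro n
    induction n using Nat.strong_induction_on with
    | _ n ih =>
      intro I hID hI hn
      rcases (I ∩ E).eq_empty_or_nonempty with h | ⟨e, heI, heE⟩
      · refine step1 I hID hI (Set.disjoint_iff_inter_eq_empty.2 h) fun i hi => ?_
        rcases hD (hID hi) with h' | h'
        · exact h'
        · exact absurd ⟨hi, h'⟩ (fun h'' : i ∈ I ∩ E => h.subset h'')
      · have hless : ∀ J ⊆ I, e ∉ J → (J ∩ E).ncard < n := by
          intro J hJ heJ
          rw [← hn]
          refine Set.ncard_lt_ncard ?_ (hE.inter_of_right I)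
          refine ⟨Set.inter_subset_inter_left _ hJ, fun h' => heJ (h' ⟨heI, heE⟩).1⟩
        have hLs : {i ∈ I | ∀ j ∈ ({e} : Set Λ), i < j} ⊆ I := fun i hi => hi.1
        have hRs : {i ∈ I | ∀ j ∈ ({e} : Set Λ), j < i} ⊆ I := fun i hi => hi.1
        refine split I {e} hI (Set.singleton_subset_iff.2 heI) Set.ordConnected_singleton
          (Set.singleton_nonempty e) ?_ (hPE e heE (hID heI)) ?_
        · refine ih _ (hless _ hLs fun h' => lt_irrefl _ (h'.2 e rfl)) _ (hLs.trans hID) ?_ rfl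
          exact Set.ordConnected_def.2 fun x hx y hy z hz =>
            ⟨hI.out hx.1 hy.1 hz, fun j hj => hz.2.trans_lt (hy.2 j hj)⟩
        · refine ih _ (hless _ hRs fun h' => lt_irrefl _ (h'.2 e rfl)) _ (hRs.trans hID) ?_ rfl
          exact Set.ordConnected_def.2 fun x hx y hy z hz =>
            ⟨hI.out hx.1 hy.1 hz, fun j hj => (hx.2 j hj).trans_le hz.1⟩
  exact fun I hID hI => step2 _ I hID hI rfl

/-! ### Close order isomorphisms as relations -/

/-- The interval of `Θ` spanned by the points related to a point of `I`. -/
def hullR {Λ Θ : Type*} [LinearOrder Θ] (Γ : Λ → Θ → Prop) (I : Set Λ) : Set Θ :=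
  {θ | ∃ a b x y, a ∈ I ∧ b ∈ I ∧ Γ a x ∧ Γ b y ∧ x ≤ θ ∧ θ ≤ y}

theorem hullR_ordConnected {Λ Θ : Type*} [LinearOrder Θ] (Γ : Λ → Θ → Prop) (I : Set Λ) :
    (hullR Γ I).OrdConnected :=
  Set.ordConnected_def.2 fun _ ⟨a, _, x, _, ha, _, hx, _, h1, _⟩ _ ⟨_, b, _, y, _, hb, _, hy, _, h4⟩
    _ hz => ⟨a, b, x, y, ha, hb, hx, hy, h1.trans hz.1, hz.2.trans h4⟩

theorem hullR_mono {Λ Θ : Type*} [LinearOrder Θ] (Γ : Λ → Θ → Prop) {I J : Set Λ} (h : I ⊆ J) :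
    hullR Γ I ⊆ hullR Γ J :=
  fun _ ⟨a, b, x, y, ha, hb, h'⟩ => ⟨a, b, x, y, h ha, h hb, h'⟩

section Rel

variable {Λ Θ : Type*} [LinearOrder Λ] [LinearOrder Θ]

/-- The relation `Γ` is the graph of a close order isomorphism. -/
structure CoiRel (Γ : Λ → Θ → Prop) : Prop where
  lt_iff : ∀ a b x y, Γ a x → Γ b y → (a < b ↔ x < y)
  close_left : Close {a | ∃ x, Γ a x}
  close_right : Close {x | ∃ a, Γ a x}

namespace CoiRel

variable {Γ : Λ → Θ → Prop}

theorem swap (h : CoiRel Γ) : CoiRel fun x a => Γ a x :=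
  ⟨fun x y a b hx hy => (h.lt_iff a b x y hx hy).symm, h.close_right, h.close_left⟩

theorem le_iff (h : CoiRel Γ) {a b : Λ} {x y : Θ} (hx : Γ a x) (hy : Γ b y) : a ≤ b ↔ x ≤ y := by
  rw [← not_lt, ← not_lt, h.lt_iff b a y x hy hx]

theorem eq_right (h : CoiRel Γ) {a : Λ} {x y : Θ} (hx : Γ a x) (hy : Γ a y) : x = y :=
  le_antisymm ((h.le_iff hx hy).1 le_rfl) ((h.le_iff hy hx).1 le_rfl)

theorem eq_left (h : CoiRel Γ) {a b : Λ} {x : Θ} (hx : Γ a x) (hy : Γ b x) : a = b :=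
  h.swap.eq_right hx hy

/-- The close order isomorphism with graph `Γ`. -/
noncomputable def toCoi (h : CoiRel Γ) : Coi Λ Θ where
  source := {a | ∃ x, Γ a x}
  target := {x | ∃ a, Γ a x}
  close_source := h.close_left
  close_target := h.close_right
  iso :=
    { toFun := fun a => ⟨a.2.choose, a, a.2.choose_spec⟩
      invFun := fun x => ⟨x.2.choose, x, x.2.choose_spec⟩
      left_inv := fun a => Subtype.ext
        (h.eq_left (⟨_, a.2.choose_spec⟩ : ∃ a', Γ a' a.2.choose).choose_spec a.2.choose_spec)
      right_inv := fun x => Subtype.ext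
        (h.eq_right (⟨_, x.2.choose_spec⟩ : ∃ y, Γ x.2.choose y).choose_spec x.2.choose_spec)
      map_rel_iff' := fun {a b} => (h.le_iff a.2.choose_spec b.2.choose_spec).symm }

end CoiRel

/-- The graph of a close order isomorphism. -/
def Coi.graph (ι : Coi Λ Θ) (a : Λ) (x : Θ) : Prop := ∃ ha : a ∈ ι.source, (ι.iso ⟨a, ha⟩ : Θ) = x

theorem Coi.graph_coiRel (ι : Coi Λ Θ) : CoiRel ι.graph := by
  refine ⟨?_, ?_, ?_⟩
  · rintro a b _ _ ⟨ha, rfl⟩ ⟨hb, rfl⟩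
    exact (ι.iso.lt_iff_lt (x := ⟨a, ha⟩) (y := ⟨b, hb⟩)).symm
  · convert ι.close_source using 1
    ext a
    exact ⟨fun ⟨_, ha, _⟩ => ha, fun ha => ⟨_, ha, rfl⟩⟩
  · convert ι.close_target using 1
    ext x
    constructor
    · rintro ⟨a, ha, rfl⟩
      exact (ι.iso ⟨a, ha⟩).2
    · intro hx
      exact ⟨(ι.iso.symm ⟨x, hx⟩).1, (ι.iso.symm ⟨x, hx⟩).2, by simp⟩

theorem Coi.hull_eq (ι : Coi Λ Θ) (I : Set Λ) : ι.hull I = hullR ι.graph I := by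
  ext θ
  constructor
  · rintro ⟨a, b, ha, hb, h1, h2⟩
    exact ⟨a, b, _, _, ha, hb, ⟨a.2, rfl⟩, ⟨b.2, rfl⟩, h1, h2⟩
  · rintro ⟨a, b, _, _, ha, hb, ⟨ha', rfl⟩, ⟨hb', rfl⟩, h1, h2⟩
    exact ⟨⟨a, ha'⟩, ⟨b, hb'⟩, ha, hb, h1, h2⟩

theorem Coi.graph_symm (ι : Coi Λ Θ) (x : Θ) (a : Λ) : ι.symm.graph x a ↔ ι.graph a x := by
  constructor
  · rintro ⟨hx, rfl⟩
    exact ⟨(ι.iso.symm ⟨x, hx⟩).2, congrArg Subtype.val (ι.iso.apply_symm_apply ⟨x, hx⟩)⟩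
  · rintro ⟨ha, rfl⟩
    exact ⟨(ι.iso ⟨a, ha⟩).2, congrArg Subtype.val (ι.iso.symm_apply_apply ⟨a, ha⟩)⟩

theorem CoiRel.graph_toCoi {Γ : Λ → Θ → Prop} (h : CoiRel Γ) (a : Λ) (x : Θ) :
    h.toCoi.graph a x ↔ Γ a x := by
  constructor
  · rintro ⟨⟨y, hy⟩, rfl⟩
    exact (⟨y, hy⟩ : ∃ x, Γ a x).choose_spec
  · intro hx
    exact ⟨⟨x, hx⟩, h.eq_right (⟨x, hx⟩ : ∃ x, Γ a x).choose_spec hx⟩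

theorem CoiRel.mem_of_mem_hullR {Γ : Λ → Θ → Prop} (h : CoiRel Γ) {I : Set Λ} (hI : I.OrdConnected)
    {c : Λ} {θ : Θ} (hc : Γ c θ) (hθ : θ ∈ hullR Γ I) : c ∈ I := by
  obtain ⟨a, b, x, y, ha, hb, hx, hy, h1, h2⟩ := hθ
  exact hI.out ha hb ⟨(h.le_iff hx hc).2 h1, (h.le_iff hc hy).2 h2⟩

theorem CoiRel.finite_hullR_singleton {Γ : Λ → Θ → Prop} (h : CoiRel Γ) (a : Λ) :
    (hullR Γ {a}).Finite := by
  refine Set.Subsingleton.finite ?_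
  rintro θ ⟨_, _, x, y, rfl, rfl, hx, hy, h1, h2⟩ θ' ⟨_, _, x', y', rfl, rfl, hx', hy', h1', h2'⟩
  obtain rfl := h.eq_right hx hy
  obtain rfl := h.eq_right hx hx'
  obtain rfl := h.eq_right hx hy'
  exact (le_antisymm h2 h1).trans (le_antisymm h1' h2')

end Rel

/-! ### Systems and coherence -/

variable {G : ℕ → Type u} [∀ n, Group (G n)] {K : ℕ → Type v} [∀ n, Group (K n)]

/-- A pair of words with a relation between their positions. -/
structure Sys (G : ℕ → Type u) (K : ℕ → Type v) [∀ n, Group (G n)] [∀ n, Group (K n)] where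
  W : Word G
  U : Word K
  rel : W.dom → U.dom → Prop

namespace Sys

/-- Interchange of the two words. -/
def swap (S : Sys G K) : Sys K G := ⟨S.U, S.W, fun x a => S.rel a x⟩

/-- The class of the subword of `U` which corresponds to the interval `I` of `W`. -/
def Phi (S : Sys G K) (I : Set S.W.dom) : Arch K := S.U.ar (hullR S.rel I)

theorem Phi_empty (S : Sys G K) : S.Phi ∅ = 1 := by
  refine S.U.ar_finite ?_
  convert Set.finite_empty
  exact Set.eq_empty_of_forall_notMem fun θ ⟨a, _, _, _, ha, _⟩ => ha.elim

theorem Phi_singleton {S : Sys G K} (h : CoiRel S.rel) (a : S.W.dom) : S.Phi {a} = 1 :=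
  S.U.ar_finite (h.finite_hullR_singleton a)

/-- The hull of `A ∪ B` consists of the two hulls and the gap between them. An infinite gap would
contain a related point, by closeness, whose partner would lie in `A` or `B` by convexity. So the
gap is finite and vanishes in `Arch`. -/
theorem Phi_union {S : Sys G K} (h : CoiRel S.rel) {A B : Set S.W.dom}
    (hAB : (A ∪ B).OrdConnected) (hlt : ∀ a ∈ A, ∀ b ∈ B, a < b) :
    S.Phi (A ∪ B) = S.Phi A * S.Phi B := by
  by_cases hA : ∃ a ∈ A, ∃ x, S.rel a x
  swap
  · have h1 : hullR S.rel A = ∅ := Set.eq_empty_of_forall_notMem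
      fun θ ⟨a, _, x, _, ha, _, hx, _⟩ => hA ⟨a, ha, x, hx⟩
    have h2 : hullR S.rel (A ∪ B) = hullR S.rel B := by
      refine Set.Subset.antisymm ?_ (hullR_mono _ Set.subset_union_right)
      rintro θ ⟨a, b, x, y, ha, hb, hx, hy, h3⟩
      exact ⟨a, b, x, y, ha.resolve_left fun h => hA ⟨a, h, x, hx⟩,
        hb.resolve_left fun h => hA ⟨b, h, y, hy⟩, hx, hy, h3⟩
    rw [Phi, Phi, Phi, h1, h2, S.U.ar_finite Set.finite_empty, one_mul]
  by_cases hB : ∃ b ∈ B, ∃ x, S.rel b x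
  swap
  · have h1 : hullR S.rel B = ∅ := Set.eq_empty_of_forall_notMem
      fun θ ⟨a, _, x, _, ha, _, hx, _⟩ => hB ⟨a, ha, x, hx⟩
    have h2 : hullR S.rel (A ∪ B) = hullR S.rel A := by
      refine Set.Subset.antisymm ?_ (hullR_mono _ Set.subset_union_left)
      rintro θ ⟨a, b, x, y, ha, hb, hx, hy, h3⟩
      exact ⟨a, b, x, y, ha.resolve_right fun h => hB ⟨a, h, x, hx⟩,
        hb.resolve_right fun h => hB ⟨b, h, y, hy⟩, hx, hy, h3⟩
    rw [Phi, Phi, Phi, h1, h2, S.U.ar_finite Set.finite_empty, mul_one]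
  obtain ⟨a0, ha0, x0, hx0⟩ := hA
  obtain ⟨b0, hb0, y0, hy0⟩ := hB
  have hAltB : ∀ θ ∈ hullR S.rel A, ∀ θ' ∈ hullR S.rel B, θ < θ' := by
    rintro θ ⟨_, b, _, y, _, hb, _, hy, _, h2⟩ θ' ⟨a', _, x', _, ha', _, hx', _, h1', _⟩
    exact h2.trans_lt (((h.lt_iff _ _ _ _ hy hx').1 (hlt b hb a' ha')).trans_le h1')
  let gap : Set S.U.dom := {θ | (∀ x ∈ hullR S.rel A, x < θ) ∧ ∀ y ∈ hullR S.rel B, θ < y}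
  have hself : ∀ {I : Set S.W.dom} {a x}, a ∈ I → S.rel a x → x ∈ hullR S.rel I :=
    fun {I a x} ha hx => ⟨a, a, x, x, ha, ha, hx, hx, le_rfl, le_rfl⟩
  have hgap : gap.Finite := by
    by_contra hinf
    have hconn : gap.OrdConnected := Set.ordConnected_def.2 fun θ hθ θ' hθ' z hz =>
      ⟨fun x hx => (hθ.1 x hx).trans_le hz.1, fun y hy => hz.2.trans_lt (hθ'.2 y hy)⟩
    obtain ⟨θ, hθ, c, hc⟩ := h.close_right gap hconn hinf
    have h1 := (h.lt_iff _ _ _ _ hx0 hc).2 (hθ.1 x0 (hself ha0 hx0))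
    have h2 := (h.lt_iff _ _ _ _ hc hy0).2 (hθ.2 y0 (hself hb0 hy0))
    rcases hAB.out (Or.inl ha0) (Or.inr hb0) ⟨h1.le, h2.le⟩ with hcA | hcB
    · exact lt_irrefl _ (hθ.1 θ (hself hcA hc))
    · exact lt_irrefl _ (hθ.2 θ (hself hcB hc))
  have hdec : hullR S.rel (A ∪ B) = (hullR S.rel A ∪ gap) ∪ hullR S.rel B := by
    refine Set.Subset.antisymm ?_ ?_
    · intro θ hθ
      rcases Word.ordConnected_decomp (hullR_ordConnected S.rel A) θ with h1 | h1 | h1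
      · obtain ⟨a, b, x, y, ha, hb, hx, hy, h2, h3⟩ := hθ
        rcases ha with ha | ha
        · exact absurd (h1 x (hself ha hx)) (not_lt.2 h2)
        · exact absurd ((h1 x0 (hself ha0 hx0)).trans (hAltB x0 (hself ha0 hx0) x (hself ha hx)))
            (not_lt.2 h2)
      · exact Or.inl (Or.inl h1)
      rcases Word.ordConnected_decomp (hullR_ordConnected S.rel B) θ with h4 | h4 | h4
      · exact Or.inl (Or.inr ⟨h1, h4⟩)
      · exact Or.inr h4
      · obtain ⟨a, b, x, y, ha, hb, hx, hy, h2, h3⟩ := hθ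
        rcases hb with hb | hb
        · exact absurd (h1 y (hself hb hy)) (not_lt.2 h3)
        · exact absurd (h4 y (hself hb hy)) (not_lt.2 h3)
    · rintro θ ((h1 | h1) | h1)
      · exact hullR_mono _ Set.subset_union_left h1
      · exact ⟨a0, b0, x0, y0, Or.inl ha0, Or.inr hb0, hx0, hy0, (h1.1 x0 (hself ha0 hx0)).le,
          (h1.2 y0 (hself hb0 hy0)).le⟩
      · exact hullR_mono _ Set.subset_union_right h1
  rw [Phi, Phi, Phi, hdec, Word.ar_union, Word.ar_union, S.U.ar_finite hgap, mul_one]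
  · exact fun θ hθ θ' hθ' => hθ'.1 θ hθ
  · rintro θ (hθ | hθ) θ' hθ'
    exacts [hAltB θ hθ θ' hθ', hθ.2 θ' hθ']

/-- Coherence of two systems on given sets of positions. -/
def CohOn (S S' : Sys G K) (D : Set S.W.dom) (D' : Set S'.W.dom) : Prop :=
  ∀ (δ : ℤˣ) (f : S.W.dom → S'.W.dom) (I : Set S.W.dom), I.OrdConnected → I ⊆ D →
    Word.SMap δ S.W S'.W f I → (f '' I).OrdConnected → f '' I ⊆ D' →
    S'.Phi (f '' I) = S.Phi I ^ (δ : ℤ)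

theorem CohOn.symm {S S' : Sys G K} {D : Set S.W.dom} {D' : Set S'.W.dom} (h : CohOn S S' D D') :
    CohOn S' S D' D := by
  intro δ f I hI hID hf hfI hfD
  rcases I.eq_empty_or_nonempty with rfl | ⟨i, hi⟩
  · rw [Set.image_empty, Phi_empty, Phi_empty, one_zpow]
  have : Nonempty S'.W.dom := ⟨i⟩
  have him := hf.smono.injOn.invFunOn_image subset_rfl
  have := h δ (Function.invFunOn f I) (f '' I) hfI hfD hf.invFunOn (by rwa [him]) (by rwa [him])
  rw [him] at this
  rw [this, zpow_unit_self]

theorem CohOn.union {S S' : Sys G K} (hS : CoiRel S.rel) (hS' : CoiRel S'.rel) {δ : ℤˣ}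
    {f : S.W.dom → S'.W.dom} {A B : Set S.W.dom} (hAB : (A ∪ B).OrdConnected)
    (hlt : ∀ a ∈ A, ∀ b ∈ B, a < b) (hf : SMono δ f (A ∪ B))
    (hfAB : (f '' (A ∪ B)).OrdConnected) (hA : S'.Phi (f '' A) = S.Phi A ^ (δ : ℤ))
    (hB : S'.Phi (f '' B) = S.Phi B ^ (δ : ℤ)) :
    S'.Phi (f '' (A ∪ B)) = S.Phi (A ∪ B) ^ (δ : ℤ) := by
  rw [Phi_union hS hAB hlt]
  rcases Int.units_eq_one_or δ with rfl | rfl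
  · rw [Set.image_union] at hfAB ⊢
    rw [Phi_union hS' hfAB, hA, hB]
    · simp
    · rintro _ ⟨a, ha, rfl⟩ _ ⟨b, hb, rfl⟩
      exact (sLT_one _ _).1 (hf a (Or.inl ha) b (Or.inr hb) (hlt a ha b hb))
  · rw [Set.image_union, Set.union_comm] at hfAB ⊢
    rw [Phi_union hS' hfAB, hA, hB]
    · simp
    · rintro _ ⟨b, hb, rfl⟩ _ ⟨a, ha, rfl⟩
      exact (sLT_neg_one _ _).1 (hf a (Or.inl ha) b (Or.inr hb) (hlt a ha b hb))

/-- `D` is covered, up to finitely many positions, by finitely many intervals which, away from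
these positions, correspond to intervals of the systems `𝒯 x`. -/
def Pieced {X : Type*} (S : Sys G K) (𝒯 : X → Sys G K) (D : Set S.W.dom) : Prop :=
  ∃ (𝒞 : Set (Set S.W.dom)) (E : Set S.W.dom), 𝒞.Finite ∧ E.Finite ∧ D ⊆ ⋃₀ 𝒞 ∪ E ∧
    ∀ C ∈ 𝒞, C.OrdConnected ∧ ∃ (x : X) (δ : ℤˣ) (f : S.W.dom → (𝒯 x).W.dom),
      SMono δ f C ∧ (f '' C).OrdConnected ∧
      (∀ a ∈ C, a ∉ E → (𝒯 x).W.letter (f a) = S.W.letter a ^ (δ : ℤ)) ∧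
      ∀ I ⊆ C, I.OrdConnected → (𝒯 x).Phi (f '' I) = S.Phi I ^ (δ : ℤ)

/-- Both sides are multiplicative, so an interval within one piece and off the exceptional set
suffices. It has one copy in some `𝒯 x` and another in `S'`; these are copies of each other, and
`hc'` compares them. -/
theorem CohOn.of_pieced {X : Type*} {S S' : Sys G K} {𝒯 : X → Sys G K} (hS : CoiRel S.rel)
    (hS' : CoiRel S'.rel) {D : Set S.W.dom} {D' : Set S'.W.dom} (hD : S.Pieced 𝒯 D)
    (hc' : ∀ x, CohOn S' (𝒯 x) D' Set.univ) : CohOn S S' D D' := by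
  obtain ⟨𝒞, E, h𝒞, hE, hDC, hC⟩ := hD
  suffices h : ∀ I ⊆ D, I.OrdConnected → ∀ (δ : ℤˣ) (f : S.W.dom → S'.W.dom),
      Word.SMap δ S.W S'.W f I → (f '' I).OrdConnected → f '' I ⊆ D' →
      S'.Phi (f '' I) = S.Phi I ^ (δ : ℤ) from
    fun δ f I hI hID hf h1 h2 => h I hID hI δ f hf h1 h2
  refine interval_induction (P := fun I => ∀ (δ : ℤˣ) (f : S.W.dom → S'.W.dom),
      Word.SMap δ S.W S'.W f I → (f '' I).OrdConnected → f '' I ⊆ D' →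
      S'.Phi (f '' I) = S.Phi I ^ (δ : ℤ)) ?_ ?_ h𝒞 hE (fun C h => (hC C h).1) hDC ?_ ?_
  · intro A B hA hB hAB hlt ihA ihB δ f hf hc hsub
    have hAi : f '' A ⊆ f '' (A ∪ B) := Set.image_mono Set.subset_union_left
    have hBi : f '' B ⊆ f '' (A ∪ B) := Set.image_mono Set.subset_union_right
    refine CohOn.union hS hS' hAB hlt hf.smono hc ?_ ?_
    · exact ihA δ f (hf.mono Set.subset_union_left)
        (hf.smono.ordConnected_image hc hA Set.subset_union_left) (hAi.trans hsub)
    · exact ihB δ f (hf.mono Set.subset_union_right)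
        (hf.smono.ordConnected_image hc hB Set.subset_union_right) (hBi.trans hsub)
  · intro δ f _ _ _
    rw [Set.image_empty, Phi_empty, Phi_empty, one_zpow]
  · intro e _ _ δ f _ _ _
    rw [Set.image_singleton, Phi_singleton hS, Phi_singleton hS', one_zpow]
  · intro C hCC I hIC hID hI hIE δ f hf hfI hfD
    obtain ⟨-, x, ε, g, hg1, hg2, hg3, hg4⟩ := hC C hCC
    rcases I.eq_empty_or_nonempty with rfl | ⟨i, hi⟩
    · rw [Set.image_empty, Phi_empty, Phi_empty, one_zpow]
    have : Nonempty S.W.dom := ⟨i⟩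
    have him := hf.smono.injOn.invFunOn_image subset_rfl
    have hgI : Word.SMap ε S.W (𝒯 x).W g I :=
      ⟨fun a ha => hg3 a (hIC ha) (Set.disjoint_left.1 hIE ha), hg1.mono hIC⟩
    have hgI' : Word.SMap ε S.W (𝒯 x).W g (Function.invFunOn f I '' (f '' I)) := by rwa [him]
    have h1 := hc' x (ε * δ) _ (f '' I) hfI hfD (hgI'.comp hf.invFunOn)
    rw [show (fun a => g (Function.invFunOn f I a)) '' (f '' I) = g '' I by
      rw [← Set.image_image g (Function.invFunOn f I), him]] at h1
    have h2 := h1 (hg1.ordConnected_image hg2 hI hIC) (Set.subset_univ _)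
    rw [hg4 I hIC hI, mul_comm, zpow_unit_mul] at h2
    have h3 := congrArg (fun z => (z ^ (ε : ℤ)) ^ (δ : ℤ)) h2
    simp only [zpow_unit_self] at h3
    exact h3.symm

theorem Pieced.cohOn {X : Type*} {S : Sys G K} {𝒯 : X → Sys G K} (hS : CoiRel S.rel)
    (h𝒯 : ∀ x, CoiRel (𝒯 x).rel) (hc : ∀ x y, CohOn (𝒯 x) (𝒯 y) Set.univ Set.univ)
    {D : Set S.W.dom} (hD : S.Pieced 𝒯 D) (x : X) : CohOn S (𝒯 x) D Set.univ :=
  CohOn.of_pieced hS (h𝒯 x) hD (hc x)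

end Sys

/-- The system of a coi triple. -/
def CoiTriple.sys (t : CoiTriple G K) : Sys G K := ⟨t.W, t.U, t.coi.graph⟩

theorem CoiTriple.sys_coiRel (t : CoiTriple G K) : CoiRel t.sys.rel := t.coi.graph_coiRel

theorem CoiTriple.hull_symm_eq (t : CoiTriple G K) (I : Set t.U.dom) :
    t.coi.symm.hull I = hullR t.sys.swap.rel I := by
  rw [Coi.hull_eq]
  congr 1
  ext x a
  exact t.coi.graph_symm x a

theorem Word.Equi.eq_empty {δ : ℤˣ} {W V : Word G} {J : Set V.dom}
    (h : (W.restrict ∅).Equi ((V.restrict J).signPow δ)) : J = ∅ := by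
  refine Set.eq_empty_of_forall_notMem fun j hj => ?_
  obtain ⟨e, -⟩ := h
  rcases Int.units_eq_one_or δ with rfl | rfl
  · simp only [Word.signPow] at e
    exact (e.symm ⟨j, hj⟩ : (∅ : Set W.dom)).2
  · simp only [Word.signPow] at e
    exact (e.symm (OrderDual.toDual ⟨j, hj⟩) : (∅ : Set W.dom)).2

theorem Sys.cohOn_univ_iff {S S' : Sys G K} : S.CohOn S' Set.univ Set.univ ↔
    ∀ (I : Set S.W.dom) (J : Set S'.W.dom) (δ : ℤˣ), I.OrdConnected → J.OrdConnected →
      (S.W.restrict I).Equi ((S'.W.restrict J).signPow δ) →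
      (S.U.restrict (hullR S.rel I)).archCls =
        ((S'.U.restrict (hullR S'.rel J)).signPow δ).archCls := by
  constructor
  · intro h I J δ hI hJ he
    rw [Word.archCls_signPow]
    change S.Phi I = S'.Phi J ^ (δ : ℤ)
    rcases I.eq_empty_or_nonempty with rfl | hne
    · rw [he.eq_empty, S.Phi_empty, S'.Phi_empty, one_zpow]
    · obtain ⟨f, hf, rfl⟩ := he.exists_smap hne
      rw [h δ f I hI (Set.subset_univ _) hf hJ (Set.subset_univ _), zpow_unit_self]
  · intro h δ f I hI _ hf hfI _
    have := h I (f '' I) δ hI hfI hf.equi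
    rw [Word.archCls_signPow] at this
    change S.Phi I = S'.Phi (f '' I) ^ (δ : ℤ) at this
    rw [this, zpow_unit_self]

/-- In this form the two halves of coherence are one statement about a system and its `swap`, so
every later argument serves both directions. -/
theorem coherent_iff {T : Set (CoiTriple G K)} : Coherent T ↔ ∀ s ∈ T, ∀ t ∈ T,
    s.sys.CohOn t.sys Set.univ Set.univ ∧ s.sys.swap.CohOn t.sys.swap Set.univ Set.univ := by
  simp only [Sys.cohOn_univ_iff]
  constructor
  · intro h s hs t ht
    refine ⟨fun (I : Set s.W.dom) (J : Set t.W.dom) δ hI hJ he => ?_,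
      fun (I : Set s.U.dom) (J : Set t.U.dom) δ hI hJ he => ?_⟩
    · have := h.1 s hs t ht I J δ hI hJ he
      rwa [Coi.hull_eq, Coi.hull_eq] at this
    · have := h.2 s hs t ht I J δ hI hJ he
      rwa [CoiTriple.hull_symm_eq, CoiTriple.hull_symm_eq] at this
  · intro h
    refine ⟨fun s hs t ht I J δ hI hJ he => ?_, fun s hs t ht I J δ hI hJ he => ?_⟩
    · rw [Coi.hull_eq, Coi.hull_eq]
      exact (h s hs t ht).1 I J δ hI hJ he
    · rw [CoiTriple.hull_symm_eq, CoiTriple.hull_symm_eq]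
      exact (h s hs t ht).2 I J δ hI hJ he

end InfWord

namespace InfWord

universe u v

/-! ### Coherence for concatenations indexed by the rationals -/

theorem IsRatConcat.exists_index {Λ : Type*} [LinearOrder Λ] {I : ℚ → Set Λ} (h : IsRatConcat I) :
    ∃ β : Λ → ℚ, Monotone β ∧ ∀ q, I q = {a | β a = q} := by
  have hex : ∀ a, ∃ q, a ∈ I q := fun a => by
    have : a ∈ ⋃ s, I s := h.1 ▸ Set.mem_univ a
    exact Set.mem_iUnion.1 this
  choose β hβ using hex
  refine ⟨β, fun a b hab => ?_, fun q => ?_⟩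
  · by_contra hlt
    exact lt_irrefl _ ((h.2 _ _ (not_le.1 hlt) b (hβ b) a (hβ a)).trans_le hab)
  · ext a
    constructor
    · intro ha
      by_contra hne
      rcases lt_or_gt_of_ne hne with h1 | h1
      · exact lt_irrefl _ (h.2 _ _ h1 a (hβ a) a ha)
      · exact lt_irrefl _ (h.2 _ _ h1 a ha a (hβ a))
    · rintro rfl
      exact hβ a

theorem ordConnected_fiber {Λ : Type*} [LinearOrder Λ] {β : Λ → ℚ} (hβ : Monotone β) (q : ℚ) :
    ({a | β a = q} : Set Λ).OrdConnected :=
  Set.ordConnected_def.2 fun _ hx _ hy _ hz =>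
    le_antisymm ((hβ hz.2).trans_eq hy) ((Eq.symm hx).trans_le (hβ hz.1))

theorem lt_of_index_lt {Λ : Type*} [LinearOrder Λ] {β : Λ → ℚ} (hβ : Monotone β) {a b : Λ}
    (h : β a < β b) : a < b := by
  by_contra hlt
  exact not_lt.2 (hβ (not_lt.1 hlt)) h

variable {G : ℕ → Type u} [∀ n, Group (G n)] {K : ℕ → Type v} [∀ n, Group (K n)]

/-- The points of `A` which lie in blocks strictly between two blocks that meet `A`. -/
def middle {Λ : Type*} (β : Λ → ℚ) (A : Set Λ) : Set Λ :=
  {a | a ∈ A ∧ (∃ b ∈ A, β b < β a) ∧ ∃ b ∈ A, β a < β b}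

section Middle

variable {Λ : Type*} [LinearOrder Λ] {β : Λ → ℚ}

theorem mem_middle_of_between (hβ : Monotone β) {A : Set Λ} (hA : A.OrdConnected) {x y z : Λ}
    (hx : x ∈ A) (hy : y ∈ A) (h1 : β x < β z) (h2 : β z < β y) : z ∈ middle β A :=
  ⟨hA.out hx hy ⟨(lt_of_index_lt hβ h1).le, (lt_of_index_lt hβ h2).le⟩, ⟨x, hx, h1⟩, ⟨y, hy, h2⟩⟩

theorem mem_middle_of_eq (hβ : Monotone β) {A : Set Λ} (hA : A.OrdConnected) {x z : Λ}
    (hx : x ∈ middle β A) (h : β z = β x) : z ∈ middle β A := by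
  obtain ⟨_, ⟨b, hb, hb'⟩, ⟨c, hc, hc'⟩⟩ := hx
  exact mem_middle_of_between hβ hA hb hc (h ▸ hb') (h ▸ hc')

/-- The set of block indices in the middle has no least or greatest element, as `ℚ` is dense. Hence
each of its blocks is enclosed by related points of other middle blocks, and the hull consists of
full blocks. -/
theorem hullR_middle {Θ : Type*} [LinearOrder Θ] {Γ : Λ → Θ → Prop} {β' : Θ → ℚ}
    (hβ : Monotone β) (hβ' : Monotone β') (hrel : ∀ a x, Γ a x → β a = β' x)
    (hne : ∀ q, ∃ a x, β a = q ∧ Γ a x) {A : Set Λ} (hA : A.OrdConnected) :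
    hullR Γ (middle β A) = {x | ∃ a ∈ middle β A, β a = β' x} := by
  ext θ
  constructor
  · rintro ⟨a, b, x, y, ha, hb, hx, hy, h1, h2⟩
    obtain ⟨c, _, hc, _⟩ := hne (β' θ)
    refine ⟨c, ?_, hc⟩
    have h3 := hβ' h1
    have h4 := hβ' h2
    rw [← hrel _ _ hx, ← hc] at h3
    rw [← hrel _ _ hy, ← hc] at h4
    obtain ⟨-, ⟨d, hd, hd'⟩, -⟩ := ha
    obtain ⟨-, -, ⟨e, he, he'⟩⟩ := hb
    exact mem_middle_of_between hβ hA hd he (hd'.trans_le h3) (h4.trans_lt he')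
  · rintro ⟨m, ⟨-, ⟨d, hd, hd'⟩, ⟨e, he, he'⟩⟩, hmθ⟩
    obtain ⟨q1, h1, h2⟩ := exists_between hd'
    obtain ⟨q2, h3, h4⟩ := exists_between he'
    obtain ⟨a, x, rfl, hx⟩ := hne q1
    obtain ⟨b, y, rfl, hy⟩ := hne q2
    refine ⟨a, b, x, y, mem_middle_of_between hβ hA hd he h1 (h2.trans he'),
      mem_middle_of_between hβ hA hd he (hd'.trans h3) h4, hx, hy, ?_, ?_⟩
    · exact (lt_of_index_lt hβ' (by rw [← hrel _ _ hx, ← hmθ]; exact h2)).le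
    · exact (lt_of_index_lt hβ' (by rw [← hrel _ _ hy, ← hmθ]; exact h3)).le

end Middle

namespace Sys

variable {X : Type*} {S : Sys G K} {𝒯 : X → Sys G K} {β : S.W.dom → ℚ} {β' : S.U.dom → ℚ}

/-- The blocks of `W` are intrinsic: an interval which is a copy of an interval within one block,
or of an interval of some `𝒯 x`, lies within one block. -/
structure IntrinsicBlocks (W : Word G) (𝒲 : X → Word G) (β : W.dom → ℚ) : Prop where
  self : ∀ (δ : ℤˣ) (f : W.dom → W.dom) (A : Set W.dom), A.OrdConnected → Word.SMap δ W W f A →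
    (f '' A).OrdConnected → (∀ a ∈ A, ∀ b ∈ A, β (f a) = β (f b)) → ∀ a ∈ A, ∀ b ∈ A, β a = β b
  other : ∀ (x : X) (δ : ℤˣ) (f : W.dom → (𝒲 x).dom) (A : Set W.dom), A.OrdConnected →
    Word.SMap δ W (𝒲 x) f A → (f '' A).OrdConnected → ∀ a ∈ A, ∀ b ∈ A, β a = β b

/-- One direction is the field `self` for `f` over a block of the image; the other is `self` for the
inverse of `f` over a block of the source. -/
theorem IntrinsicBlocks.index_eq_iff {W : Word G} {𝒲 : X → Word G} {β : W.dom → ℚ}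
    (h : IntrinsicBlocks W 𝒲 β) (hβ : Monotone β) {δ : ℤˣ} {f : W.dom → W.dom} {A : Set W.dom}
    (hA : A.OrdConnected) (hf : Word.SMap δ W W f A) (hfA : (f '' A).OrdConnected) {a b : W.dom}
    (ha : a ∈ A) (hb : b ∈ A) : β (f a) = β (f b) ↔ β a = β b := by
  have : Nonempty W.dom := ⟨a⟩
  constructor
  · intro hab
    have hC := hf.smono.ordConnected_preimage hA (ordConnected_fiber hβ (β (f a)))
    exact h.self δ f _ hC (hf.mono Set.inter_subset_left)
      (hf.smono.ordConnected_image hfA hC Set.inter_subset_left)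
      (fun x hx y hy => Eq.trans hx.2 (Eq.symm hy.2)) a ⟨ha, rfl⟩ b ⟨hb, hab.symm⟩
  · intro hab
    have hC : (A ∩ {x | β x = β a}).OrdConnected := hA.inter (ordConnected_fiber hβ _)
    have hsub : A ∩ {x | β x = β a} ⊆ A := Set.inter_subset_left
    have him := hf.smono.injOn.invFunOn_image hsub
    refine h.self δ (Function.invFunOn f A) (f '' (A ∩ {x | β x = β a}))
      (hf.smono.ordConnected_image hfA hC hsub) (hf.invFunOn.mono (Set.image_mono hsub))
      (by rwa [him]) ?_ _ ⟨a, ⟨ha, rfl⟩, rfl⟩ _ ⟨b, ⟨hb, hab.symm⟩, rfl⟩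
    rintro _ ⟨x, hx, rfl⟩ _ ⟨y, hy, rfl⟩
    rw [hf.smono.injOn.leftInvOn_invFunOn hx.1, hf.smono.injOn.leftInvOn_invFunOn hy.1]
    exact Eq.trans hx.2 (Eq.symm hy.2)

/-- As blocks are intrinsic, `f` permutes them. The two end parts of `A` lie in single blocks and
are compared through the family `𝒯`. The middle part may have infinitely many blocks, so it needs
genuine isomorphisms of the translated blocks, which `hblock` provides. -/
theorem cohOn_self (hS : CoiRel S.rel) (h𝒯 : ∀ x, CoiRel (𝒯 x).rel)
    (hc : ∀ x y, (𝒯 x).CohOn (𝒯 y) Set.univ Set.univ) (hβ : Monotone β) (hβ' : Monotone β')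
    (hrel : ∀ a x, S.rel a x → β a = β' x) (hne : ∀ q, ∃ a x, β a = q ∧ S.rel a x)
    (hint : IntrinsicBlocks S.W (fun x => (𝒯 x).W) β) (hp : ∀ q, S.Pieced 𝒯 {a | β a = q})
    (hblock : ∀ (q q' : ℚ) (δ : ℤˣ) (f : S.W.dom → S.W.dom),
      Word.SMap δ S.W S.W f {a | β a = q} → f '' {a | β a = q} = {a | β a = q'} →
      ∃ g : S.U.dom → S.U.dom, Word.SMap δ S.U S.U g {x | β' x = q} ∧
        g '' {x | β' x = q} = {x | β' x = q'}) :
    S.CohOn S Set.univ Set.univ := by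
  intro δ f A hA _ hf hfA _
  have hone : ∀ B ⊆ A, B.OrdConnected → (∀ a ∈ B, ∀ b ∈ B, β a = β b) →
      S.Phi (f '' B) = S.Phi B ^ (δ : ℤ) := by
    intro B hBA hB hBβ
    rcases B.eq_empty_or_nonempty with rfl | ⟨a, ha⟩
    · rw [Set.image_empty, Phi_empty, one_zpow]
    refine CohOn.of_pieced hS hS (hp (β a)) (Pieced.cohOn hS h𝒯 hc (hp (β (f a)))) δ f B hB
      (fun b hb => hBβ b hb a ha) (hf.mono hBA) (hf.smono.ordConnected_image hfA hB hBA) ?_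
    rintro _ ⟨b, hb, rfl⟩
    exact (hint.index_eq_iff hβ hA hf hfA (hBA hb) (hBA ha)).2 (hBβ b hb a ha)
  have hlt_iff : ∀ {a b}, a ∈ A → b ∈ A → β a < β b → sLT δ (β (f a)) (β (f b)) := by
    intro a b ha hb hab
    have h1 := hf.smono a ha b hb (lt_of_index_lt hβ hab)
    have h2 : β (f a) ≠ β (f b) := fun h => hab.ne ((hint.index_eq_iff hβ hA hf hfA ha hb).1 h)
    rcases Int.units_eq_one_or δ with rfl | rfl
    · rw [sLT_one] at h1 ⊢
      exact lt_of_le_of_ne (hβ h1.le) h2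
    · rw [sLT_neg_one] at h1 ⊢
      exact lt_of_le_of_ne (hβ h1.le) h2.symm
  have hmid : f '' middle β A = middle β (f '' A) := by
    ext z
    constructor
    · rintro ⟨a, ⟨ha, ⟨b, hb, hba⟩, ⟨c, hc, hac⟩⟩, rfl⟩
      have h1 := hlt_iff hb ha hba
      have h2 := hlt_iff ha hc hac
      rcases Int.units_eq_one_or δ with rfl | rfl
      · rw [sLT_one] at h1 h2
        exact ⟨⟨a, ha, rfl⟩, ⟨_, ⟨b, hb, rfl⟩, h1⟩, ⟨_, ⟨c, hc, rfl⟩, h2⟩⟩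
      · rw [sLT_neg_one] at h1 h2
        exact ⟨⟨a, ha, rfl⟩, ⟨_, ⟨c, hc, rfl⟩, h2⟩, ⟨_, ⟨b, hb, rfl⟩, h1⟩⟩
    · rintro ⟨⟨a, ha, rfl⟩, ⟨_, ⟨b, hb, rfl⟩, hba⟩, ⟨_, ⟨c, hc, rfl⟩, hac⟩⟩
      refine ⟨a, ⟨ha, ?_⟩, rfl⟩
      have hba' : β b ≠ β a := fun h => hba.ne ((hint.index_eq_iff hβ hA hf hfA hb ha).2 h)
      have hac' : β a ≠ β c := fun h => hac.ne ((hint.index_eq_iff hβ hA hf hfA ha hc).2 h)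
      rcases Int.units_eq_one_or δ with rfl | rfl
      · refine ⟨⟨b, hb, lt_of_le_of_ne (not_lt.1 fun h => ?_) hba'⟩,
          ⟨c, hc, lt_of_le_of_ne (not_lt.1 fun h => ?_) hac'⟩⟩
        · exact lt_asymm hba ((sLT_one _ _).1 (hlt_iff ha hb h))
        · exact lt_asymm hac ((sLT_one _ _).1 (hlt_iff hc ha h))
      · refine ⟨⟨c, hc, lt_of_le_of_ne (not_lt.1 fun h => ?_) hac'.symm⟩,
          ⟨b, hb, lt_of_le_of_ne (not_lt.1 fun h => ?_) hba'.symm⟩⟩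
        · exact lt_asymm hac ((sLT_neg_one _ _).1 (hlt_iff ha hc h))
        · exact lt_asymm hba ((sLT_neg_one _ _).1 (hlt_iff hb ha h))
  have hfull : ∀ a ∈ middle β A, f '' {x | β x = β a} = {x | β x = β (f a)} := by
    intro a ha
    ext z
    constructor
    · rintro ⟨x, hx, rfl⟩
      exact (hint.index_eq_iff hβ hA hf hfA (mem_middle_of_eq hβ hA ha hx).1 ha.1).2 hx
    · intro hz
      have hz' : z ∈ middle β (f '' A) :=
        mem_middle_of_eq hβ hfA (hmid ▸ (⟨a, ha, rfl⟩ : f a ∈ f '' middle β A)) hz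
      rw [← hmid] at hz'
      obtain ⟨x, hx, rfl⟩ := hz'
      exact ⟨x, (hint.index_eq_iff hβ hA hf hfA hx.1 ha.1).1 hz, rfl⟩
  have hM : S.Phi (f '' middle β A) = S.Phi (middle β A) ^ (δ : ℤ) := by
    have hex : ∀ q, ∃ g : S.U.dom → S.U.dom, ∀ a ∈ middle β A, β a = q →
        Word.SMap δ S.U S.U g {x | β' x = q} ∧ g '' {x | β' x = q} = {x | β' x = β (f a)} := by
      intro q
      by_cases hq : ∃ a ∈ middle β A, β a = q
      · obtain ⟨a, ha, rfl⟩ := hq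
        obtain ⟨g, hg1, hg2⟩ := hblock (β a) (β (f a)) δ f
          (hf.mono fun x hx => (mem_middle_of_eq hβ hA ha hx).1) (hfull a ha)
        refine ⟨g, fun b hb hba => ⟨hg1, ?_⟩⟩
        rw [hg2, (hint.index_eq_iff hβ hA hf hfA hb.1 ha.1).2 hba]
      · exact ⟨id, fun a ha haq => absurd ⟨a, ha, haq⟩ hq⟩
    choose g hg using hex
    have hgβ : ∀ a ∈ middle β A, ∀ x, β a = β' x → β' (g (β' x) x) = β (f a) := by
      intro a ha x hx
      have : g (β' x) x ∈ g (β' x) '' {y | β' y = β' x} := ⟨x, rfl, rfl⟩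
      rw [(hg _ a ha hx).2] at this
      exact this
    -- The isomorphisms of the single blocks are glued into one signed map. Between different blocks
    -- its monotonicity is that of `f`.
    have hsm : Word.SMap δ S.U S.U (fun x => g (β' x) x) {x | ∃ a ∈ middle β A, β a = β' x} := by
      refine ⟨?_, ?_⟩
      · rintro x ⟨a, ha, hax⟩
        exact (hg _ a ha hax).1.letter x rfl
      · rintro x ⟨a, ha, hax⟩ y ⟨b, hb, hby⟩ hxy
        rcases (hβ' hxy.le).lt_or_eq with h | h
        · have h1 := hlt_iff ha.1 hb.1 (by rwa [hax, hby])
          rw [← hgβ a ha x hax, ← hgβ b hb y hby] at h1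
          rcases Int.units_eq_one_or δ with rfl | rfl
          · rw [sLT_one] at h1 ⊢
            exact lt_of_index_lt hβ' h1
          · rw [sLT_neg_one] at h1 ⊢
            exact lt_of_index_lt hβ' h1
        · have := (hg _ a ha hax).1.smono x rfl y h.symm hxy
          simpa only [h] using this
    have himg : (fun x => g (β' x) x) '' {x | ∃ a ∈ middle β A, β a = β' x} =
        {x | ∃ a ∈ middle β (f '' A), β a = β' x} := by
      ext z
      constructor
      · rintro ⟨x, ⟨a, ha, hax⟩, rfl⟩
        exact ⟨f a, hmid ▸ ⟨a, ha, rfl⟩, (hgβ a ha x hax).symm⟩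
      · rintro ⟨b, hb, hbz⟩
        rw [← hmid] at hb
        obtain ⟨a, ha, rfl⟩ := hb
        have hz : z ∈ g (β a) '' {y | β' y = β a} := by
          rw [(hg _ a ha rfl).2]
          exact hbz.symm
        obtain ⟨x, hx, rfl⟩ := hz
        refine ⟨x, ⟨a, ha, Eq.symm hx⟩, ?_⟩
        have hx : β' x = β a := hx
        simp only [hx]
    rw [hmid, Phi, Phi, hullR_middle hβ hβ' hrel hne hA, hullR_middle hβ hβ' hrel hne hfA, ← himg]
    exact hsm.ar_image
  let L : Set S.W.dom := {a | a ∈ A ∧ ¬ ∃ b ∈ A, β b < β a}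
  let R : Set S.W.dom := {a | a ∈ A ∧ (∃ b ∈ A, β b < β a) ∧ ¬ ∃ b ∈ A, β a < β b}
  have hLβ : ∀ a ∈ L, ∀ b ∈ L, β a = β b := fun a ha b hb =>
    le_antisymm (not_lt.1 fun h => ha.2 ⟨b, hb.1, h⟩) (not_lt.1 fun h => hb.2 ⟨a, ha.1, h⟩)
  have hRβ : ∀ a ∈ R, ∀ b ∈ R, β a = β b := fun a ha b hb =>
    le_antisymm (not_lt.1 fun h => hb.2.2 ⟨a, ha.1, h⟩) (not_lt.1 fun h => ha.2.2 ⟨b, hb.1, h⟩)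
  have hLc : L.OrdConnected := Set.ordConnected_def.2 fun x hx y hy z hz =>
    ⟨hA.out hx.1 hy.1 hz, fun ⟨b, hb, hbz⟩ => hy.2 ⟨b, hb, hbz.trans_le (hβ hz.2)⟩⟩
  have hRc : R.OrdConnected := Set.ordConnected_def.2 fun x hx y hy z hz =>
    ⟨hA.out hx.1 hy.1 hz, by
      obtain ⟨b, hb, hbx⟩ := hx.2.1
      exact ⟨b, hb, hbx.trans_le (hβ hz.1)⟩,
      fun ⟨b, hb, hbz⟩ => hx.2.2 ⟨b, hb, (hβ hz.1).trans_lt hbz⟩⟩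
  have hdec : A = (L ∪ middle β A) ∪ R := by
    ext a
    constructor
    · intro ha
      by_cases h1 : ∃ b ∈ A, β b < β a
      · by_cases h2 : ∃ b ∈ A, β a < β b
        · exact Or.inl (Or.inr ⟨ha, h1, h2⟩)
        · exact Or.inr ⟨ha, h1, h2⟩
      · exact Or.inl (Or.inl ⟨ha, h1⟩)
    · rintro ((h | h) | h) <;> exact h.1
  have hLM : ∀ a ∈ L, ∀ b ∈ middle β A, a < b := fun a ha b hb => by
    obtain ⟨c, hc, hcb⟩ := hb.2.1
    exact lt_of_index_lt hβ ((not_lt.1 fun h => ha.2 ⟨c, hc, h⟩).trans_lt hcb)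
  have hLMR : ∀ a ∈ L ∪ middle β A, ∀ b ∈ R, a < b := by
    rintro a (ha | ha) b hb
    · obtain ⟨c, hc, hcb⟩ := hb.2.1
      exact lt_of_index_lt hβ ((not_lt.1 fun h => ha.2 ⟨c, hc, h⟩).trans_lt hcb)
    · obtain ⟨c, hc, hac⟩ := ha.2.2
      exact lt_of_index_lt hβ (hac.trans_le (not_lt.1 fun h => hb.2.2 ⟨c, hc, h⟩))
  have hsubLM : L ∪ middle β A ⊆ A := by
    rintro a (h | h) <;> exact h.1
  have hLMc : (L ∪ middle β A).OrdConnected := by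
    refine Set.ordConnected_def.2 fun x hx y hy z hz => ?_
    have hzA := hA.out (hsubLM hx) (hsubLM hy) hz
    rw [hdec] at hzA
    refine hzA.resolve_right fun hzR => ?_
    exact not_lt.2 hz.2 (hLMR y hy z hzR)
  have hfLM : (f '' (L ∪ middle β A)).OrdConnected :=
    hf.smono.ordConnected_image hfA hLMc hsubLM
  have h1 := CohOn.union hS hS hLMc hLM (hf.smono.mono hsubLM) hfLM
    (hone L (fun a ha => ha.1) hLc hLβ) hM
  have h2 := CohOn.union hS hS (hdec ▸ hA) hLMR (hdec ▸ hf.smono) (hdec ▸ hfA) h1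
    (hone R (fun a ha => ha.1) hRc hRβ)
  rwa [← hdec] at h2

/-- A copy of an interval of some `𝒯 x` stays inside one block, where coherence is inherited from
the family. -/
theorem cohOn_other (hS : CoiRel S.rel) (h𝒯 : ∀ x, CoiRel (𝒯 x).rel)
    (hc : ∀ x y, (𝒯 x).CohOn (𝒯 y) Set.univ Set.univ)
    (hint : IntrinsicBlocks S.W (fun x => (𝒯 x).W) β) (hp : ∀ q, S.Pieced 𝒯 {a | β a = q})
    (x : X) : S.CohOn (𝒯 x) Set.univ Set.univ := by
  intro δ f A hA _ hf hfA _
  rcases A.eq_empty_or_nonempty with rfl | ⟨a, ha⟩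
  · rw [Set.image_empty, Phi_empty, Phi_empty, one_zpow]
  exact Pieced.cohOn hS h𝒯 hc (hp (β a)) x δ f A hA
    (fun b hb => hint.other x δ f A hA hf hfA b hb a ha) hf hfA (Set.subset_univ _)

end Sys

end InfWord

namespace InfWord

universe u v

variable {G : ℕ → Type u} [∀ n, Group (G n)]

namespace Word

/-! ### The blocks of a word decomposed along the rationals -/

theorem IsReduced.restrict {W : Word G} (hW : W.IsReduced) {A : Set W.dom} (hA : A.OrdConnected) :
    (W.restrict A).IsReduced := by
  have himg := W.image_val_univ A
  refine isReduced_of_redOn ((W.smap_val A).redOn ?_ ?_)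
  · rwa [himg]
  · exact hW.redOn _

theorem exists_pieces_of_interval {X : Type*} {𝒲 : X → Word G} (h𝒲 : ∀ x, (𝒲 x).IsReduced)
    {W : Word G} (hW : W.IsReduced) {A : Set W.dom} (hA : A.OrdConnected) (hmem : W.cl A ∈ Fine 𝒲) :
    ∃ (k : ℕ) (D : ℕ → Set W.dom), (∀ j, (D j).OrdConnected) ∧ (∀ j, D j ⊆ A) ∧
      (∀ i j j', i ∈ D j → i ∈ D j' → j = j') ∧ (∀ i j, i ∈ D j → j < k) ∧
      (∀ j, (D j).Nonempty → Piece 𝒲 W (D j)) ∧ {i ∈ A | ∀ j, i ∉ D j}.Finite ∧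
      ∀ i ∈ A, W.cl {i} ∈ Fine 𝒲 := by
  obtain ⟨k, D, h1, h2, h3, h4, h5, h6⟩ := exists_pieces h𝒲 (hW.restrict hA) hmem
  have hval := W.smap_val A
  have hinj : ∀ a b, W.val A a = W.val A b → a = b := fun a b h => hval.smono.injOn trivial trivial h
  have himg := W.image_val_univ A
  refine ⟨k, fun j => W.val A '' D j, ?_, ?_, ?_, ?_, ?_, ?_, ?_⟩
  · intro j
    exact hval.smono.ordConnected_image (himg.symm ▸ hA) (h1 j) (Set.subset_univ _)
  · rintro j _ ⟨i, -, rfl⟩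
    exact i.2
  · rintro _ j j' ⟨i, hi, rfl⟩ ⟨i', hi', he⟩
    rw [hinj _ _ he] at hi'
    exact h2 i j j' hi hi'
  · rintro _ j ⟨i, hi, rfl⟩
    exact h3 i j hi
  · rintro j ⟨_, i, hi, rfl⟩
    have : Nonempty (W.restrict A).dom := ⟨i⟩
    exact (h4 j ⟨i, hi⟩).preimage (hval.mono (Set.subset_univ _)).invFunOn
      (hval.smono.injOn.mono (Set.subset_univ _) |>.invFunOn_image subset_rfl)
  · refine (h5.image (W.val A)).subset ?_
    rintro i ⟨hi, hiD⟩
    exact ⟨⟨i, hi⟩, fun j hj => hiD j ⟨_, hj, rfl⟩, rfl⟩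
  · intro i hi
    obtain ⟨z, rfl⟩ : ∃ z, W.val A z = i := ⟨⟨i, hi⟩, rfl⟩
    have h7 := (hval.mono (Set.subset_univ {z})).cl_image
    rw [Set.image_singleton] at h7
    rw [show W.cl {W.val A z} = (W.restrict A).cl {z} by simpa using h7]
    exact h6 _

theorem Piece.cl_mem {X : Type*} {𝒲 : X → Word G} {W : Word G} {C B : Set W.dom}
    (h : Piece 𝒲 W C) (hB : B.OrdConnected) (hBC : B ⊆ C) : W.cl B ∈ Fine 𝒲 := by
  obtain ⟨x, δ, f, hf, hfc⟩ := h
  have h1 : (𝒲 x).cl (f '' B) ∈ Fine 𝒲 :=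
    cl_mem_fine_of_ordConnected (hf.smono.ordConnected_image hfc hB hBC)
  rwa [(hf.mono hBC).cl_image, zpow_unit_mem] at h1

/-- An interval of a word that is pieced together from intervals of the `𝒲 x` is pieced together in
the same manner; the exceptional letters belong to `Fine` individually. -/
theorem cl_mem_fine_of_subset {X : Type*} {𝒲 : X → Word G} (h𝒲 : ∀ x, (𝒲 x).IsReduced)
    {W : Word G} (hW : W.IsReduced) {A : Set W.dom} (hA : A.OrdConnected) (hmem : W.cl A ∈ Fine 𝒲)
    {B : Set W.dom} (hB : B.OrdConnected) (hBA : B ⊆ A) : W.cl B ∈ Fine 𝒲 := by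
  obtain ⟨k, D, h1, h2, -, h3, h4, h5, h6⟩ := exists_pieces_of_interval h𝒲 hW hA hmem
  refine interval_induction (P := fun I => W.cl I ∈ Fine 𝒲) (𝒞 := D '' Set.Iio k) (D := A)
    (E := {i ∈ A | ∀ j, i ∉ D j}) ?_ ?_ ((Set.finite_Iio k).image D) h5 ?_ ?_ ?_ ?_ B hBA hB
  · intro I J _ _ _ hlt hI hJ
    rw [cl_union W hlt]
    exact mul_mem hI hJ
  · rw [cl_empty]
    exact one_mem _
  · rintro _ ⟨j, -, rfl⟩
    exact h1 j
  · intro i hi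
    by_cases h : ∃ j, i ∈ D j
    · obtain ⟨j, hj⟩ := h
      exact Or.inl ⟨_, ⟨j, h3 i j hj, rfl⟩, hj⟩
    · exact Or.inr ⟨hi, fun j hj => h ⟨j, hj⟩⟩
  · exact fun i _ hi => h6 i hi
  · rintro _ ⟨j, -, rfl⟩ I hI _ hIc _
    rcases I.eq_empty_or_nonempty with rfl | ⟨i, hi⟩
    · rw [cl_empty]
      exact one_mem _
    · exact (h4 j ⟨i, hI hi⟩).cl_mem hIc hI

/-- An interval meeting the blocks `β a < β b` contains all blocks strictly between them, and by
density of `ℚ` there is more than one; their union is an interval whose class is not in `H`. -/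
theorem index_eq_of_forall_mem {W : Word G} {H : Subgroup (TopProd G)} {β : W.dom → ℚ}
    (hβ : Monotone β) (hW : IsRatBlockDecomp W H fun q => {a | β a = q}) {A : Set W.dom}
    (hA : A.OrdConnected) (h : ∀ B ⊆ A, B.OrdConnected → W.cl B ∈ H) {a b : W.dom} (ha : a ∈ A)
    (hb : b ∈ A) : β a = β b := by
  wlog hab : β a < β b generalizing a b
  · rcases (not_lt.1 hab).lt_or_eq with h1 | h1
    · exact (this hb ha h1).symm
    · exact h1.symm
  exfalso
  refine hW.notMem (Set.Ioo (β a) (β b)) Set.ordConnected_Ioo ?_ ?_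
  · obtain ⟨q, h1, h2⟩ := exists_between hab
    obtain ⟨r, h3, h4⟩ := exists_between h2
    exact ⟨q, ⟨h1, h2⟩, r, ⟨h1.trans h3, h4⟩, h3.ne⟩
  · have hs : (⋃ s ∈ Set.Ioo (β a) (β b), {a | β a = s}) = {z | β a < β z ∧ β z < β b} := by
      ext z
      simp
    rw [hs]
    refine h _ ?_ ?_
    · intro z hz
      exact hA.out ha hb ⟨(lt_of_index_lt hβ hz.1).le, (lt_of_index_lt hβ hz.2).le⟩
    · exact Set.ordConnected_def.2 fun x hx y hy z hz =>
        ⟨hx.1.trans_le (hβ hz.1), (hβ hz.2).trans_lt hy.2⟩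

theorem intrinsicBlocks_of_isRatBlockDecomp {X : Type*} {𝒲 : X → Word G}
    (h𝒲 : ∀ x, (𝒲 x).IsReduced) {W : Word G} (hred : W.IsReduced) {β : W.dom → ℚ}
    (hβ : Monotone β) (hW : IsRatBlockDecomp W (Fine 𝒲) fun q => {a | β a = q}) :
    Sys.IntrinsicBlocks W 𝒲 β := by
  constructor
  · intro δ f A hA hf hfA hone a ha b hb
    refine index_eq_of_forall_mem hβ hW hA (fun B hBA hB => ?_) ha hb
    have h1 := cl_mem_fine_of_subset h𝒲 hred (ordConnected_fiber hβ (β (f a))) (hW.mem _)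
      (hf.smono.ordConnected_image hfA hB hBA) (by
        rintro _ ⟨c, hc, rfl⟩
        exact hone c (hBA hc) a ha)
    rwa [(hf.mono hBA).cl_image, zpow_unit_mem] at h1
  · intro x δ f A hA hf hfA a ha b hb
    exact index_eq_of_forall_mem hβ hW hA
      (fun B hBA hB => Piece.cl_mem ⟨x, δ, f, hf, hfA⟩ hB hBA) ha hb

/-! ### Blocks up to inversion -/

/-- A fixed point of the reversal `f` would carry a letter equal to its inverse, hence an element of
order 2. Without fixed points `A` is a lower part `L` followed by `f '' L`, and the latter is
inverse to `L`; so `A` cancels. -/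
theorem IsReduced.eq_empty_of_inverse (hG : ∀ n (g : G n), orderOf g ≠ 2) {W : Word G}
    (hW : W.IsReduced) {A : Set W.dom} (hA : A.OrdConnected) {f : W.dom → W.dom}
    (hf : SMap (-1) W W f A) (hfA : f '' A = A) : A = ∅ := by
  have hfmem : ∀ a ∈ A, f a ∈ A := fun a ha => hfA ▸ ⟨a, ha, rfl⟩
  have hfix : ∀ a ∈ A, f a ≠ a := by
    intro a ha h
    have h1 := hf.letter a ha
    rw [h] at h1
    simp only [Units.val_neg, Units.val_one, zpow_neg, zpow_one] at h1
    obtain ⟨g, hg⟩ := exists_of_eq (W.idx_mem a)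
    have hne : g ≠ 1 := fun h' => hW.letter_ne_one a (by rw [← hg, h', map_one])
    refine hG _ g (orderOf_eq_prime ?_ hne)
    refine CoprodI.of_injective _ ?_
    rw [map_pow, hg, map_one, sq]
    nth_rewrite 2 [h1]
    exact mul_inv_cancel _
  let L : Set W.dom := {a | a ∈ A ∧ a < f a}
  have hL : L ⊆ A := fun a ha => ha.1
  have hanti : ∀ a ∈ A, ∀ b ∈ A, a < b → f b < f a := fun a ha b hb h =>
    (sLT_neg_one _ _).1 (hf.smono a ha b hb h)
  have hfL : f '' L = {a | a ∈ A ∧ f a < a} := by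
    ext z
    constructor
    · rintro ⟨a, ha, rfl⟩
      exact ⟨hfmem a ha.1, hanti a ha.1 _ (hfmem a ha.1) ha.2⟩
    · rintro ⟨hz, hfz⟩
      rw [← hfA] at hz
      obtain ⟨a, ha, rfl⟩ := hz
      refine ⟨a, ⟨ha, ?_⟩, rfl⟩
      by_contra h
      have h1 := lt_of_le_of_ne (not_lt.1 h) (hfix a ha)
      exact lt_asymm hfz (hanti _ (hfmem a ha) a ha h1)
  have hdec : A = L ∪ f '' L := by
    rw [hfL]
    ext a
    constructor
    · intro ha
      rcases lt_or_gt_of_ne (hfix a ha) with h | h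
      exacts [Or.inr ⟨ha, h⟩, Or.inl ⟨ha, h⟩]
    · rintro (h | h) <;> exact h.1
  refine hW.eq_empty hA ?_
  rw [hdec, cl_union, (hf.mono hL).cl_image]
  · simp
  · rw [hfL]
    intro a ha b hb
    by_contra h
    rcases (not_lt.1 h).lt_or_eq with h1 | rfl
    · exact lt_asymm ((ha.2.trans (hanti b hb.1 a ha.1 h1)).trans hb.2) h1
    · exact lt_asymm ha.2 hb.2

/-- Representatives of the blocks up to signed isomorphism. The sign of the isomorphism of a block
with its representative is determined. -/
theorem exists_representatives (hG : ∀ n (g : G n), orderOf g ≠ 2) {W : Word G}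
    (hW : W.IsReduced) {β : W.dom → ℚ} (hβ : Monotone β) (hne : ∀ q, ∃ a, β a = q) :
    ∃ (rep : ℚ → ℚ) (ε : ℚ → ℤˣ) (e : ℚ → W.dom → W.dom),
      (∀ q, SMap (ε q) W W (e q) {a | β a = q} ∧ e q '' {a | β a = q} = {a | β a = rep q}) ∧
      (∀ (q q' : ℚ) (δ : ℤˣ) (f : W.dom → W.dom), SMap δ W W f {a | β a = q} →
        f '' {a | β a = q} = {a | β a = q'} → rep q = rep q' ∧ ε q = δ * ε q') ∧
      ∀ r, {q | rep q = r}.Finite := by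
  have : Nonempty W.dom := ⟨(hne 0).choose⟩
  let s : Setoid ℚ :=
    { r := fun q q' => ∃ (δ : ℤˣ) (f : W.dom → W.dom), SMap δ W W f {a | β a = q} ∧
        f '' {a | β a = q} = {a | β a = q'}
      iseqv := by
        refine ⟨fun q => ⟨1, _, SMap.id W _, by simp⟩, ?_, ?_⟩
        · rintro q q' ⟨δ, f, hf, hfi⟩
          exact ⟨δ, _, hfi ▸ hf.invFunOn, hfi ▸ hf.smono.injOn.invFunOn_image subset_rfl⟩
        · rintro q q' q'' ⟨δ, f, hf, hfi⟩ ⟨δ', f', hf', hfi'⟩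
          refine ⟨δ' * δ, _, SMap.comp (by rwa [hfi]) hf, ?_⟩
          rw [← Set.image_image f' f, hfi, hfi'] }
  let rep : ℚ → ℚ := fun q => (Quotient.mk s q).out
  have hrep : ∀ q, ∃ (δ : ℤˣ) (f : W.dom → W.dom), SMap δ W W f {a | β a = q} ∧
      f '' {a | β a = q} = {a | β a = rep q} := fun q =>
    s.symm (Quotient.exact (Quotient.out_eq (Quotient.mk s q)))
  choose ε e he using hrep
  refine ⟨rep, ε, e, he, ?_, ?_⟩
  · intro q q' δ f hf hfi
    have hr : rep q = rep q' := congrArg Quotient.out (Quotient.sound (s := s) ⟨δ, f, hf, hfi⟩)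
    refine ⟨hr, ?_⟩
    obtain ⟨h1, h2⟩ := he q
    obtain ⟨h3, h4⟩ := he q'
    have h5 := h1.invFunOn
    have h6 := h1.smono.injOn.invFunOn_image (s₁ := {a | β a = q}) subset_rfl
    rw [h2] at h5 h6
    have h7 : SMap (δ * ε q) W W _ {a | β a = rep q} := SMap.comp (by rwa [h6]) h5
    have h8 : (fun a => f (Function.invFunOn (e q) {a | β a = q} a)) '' {a | β a = rep q} =
        {a | β a = q'} := by
      rw [← Set.image_image f, h6, hfi]
    have h9 : SMap (ε q' * (δ * ε q)) W W _ {a | β a = rep q} := SMap.comp (by rwa [h8]) h7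
    have h10 : (fun a => e q' (f (Function.invFunOn (e q) {a | β a = q} a))) ''
        {a | β a = rep q} = {a | β a = rep q} := by
      rw [← Set.image_image (e q'), h8, h4, hr]
    -- The composite is a signed automorphism of the representative block, and a negative sign would
    -- make that reduced block its own inverse.
    have h11 : ε q' * (δ * ε q) = 1 := by
      rcases Int.units_eq_one_or (ε q' * (δ * ε q)) with h | h
      · exact h
      · rw [h] at h9
        have := hW.eq_empty_of_inverse hG (ordConnected_fiber hβ (rep q)) h9 h10
        obtain ⟨a, ha⟩ := hne (rep q)
        exact absurd (this ▸ (show a ∈ {a | β a = rep q} from ha)) (Set.notMem_empty a)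
    have h12 : ε q = δ * ε q' := by
      rcases Int.units_eq_one_or (ε q) with h | h <;> rcases Int.units_eq_one_or (ε q') with h' | h' <;>
      rcases Int.units_eq_one_or δ with h'' | h'' <;> rw [h, h', h''] at h11 ⊢ <;> revert h11 <;> decide
    exact h12
  · intro r
    obtain ⟨a, ha⟩ := hne r
    -- Every block of the class contains a letter from the factor of the fixed letter at `a`, and
    -- `W` has only finitely many of these.
    refine Set.Finite.subset ((W.finite_mem (W.idx a)).image β) ?_
    rintro q rfl
    obtain ⟨h1, h2⟩ := he q
    have : a ∈ e q '' {a | β a = q} := h2 ▸ ha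
    obtain ⟨b, hb, hba⟩ := this
    refine ⟨b, ?_, hb⟩
    have h3 := h1.letter b hb
    have h4 := W.idx_mem a
    rw [← hba, h3, zpow_unit_mem] at h4
    change W.letter b ∈ factor G (W.idx a)
    rw [← hba]
    exact h4

end Word

end InfWord

namespace InfWord

universe u v

variable {G : ℕ → Type u} [∀ n, Group (G n)] {K : ℕ → Type v} [∀ n, Group (K n)]

/-! ### Changing finitely many letters -/

theorem SMono.image_lt {α β : Type*} [LinearOrder α] [LinearOrder β] {δ : ℤˣ} {f : α → β}
    {A B : Set α} (hf : SMono δ f (A ∪ B)) (hlt : ∀ a ∈ A, ∀ b ∈ B, a < b) :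
    (δ = 1 ∧ ∀ x ∈ f '' A, ∀ y ∈ f '' B, x < y) ∨ (δ = -1 ∧ ∀ y ∈ f '' B, ∀ x ∈ f '' A, y < x) := by
  rcases Int.units_eq_one_or δ with rfl | rfl
  · left
    refine ⟨rfl, ?_⟩
    rintro _ ⟨a, ha, rfl⟩ _ ⟨b, hb, rfl⟩
    exact (sLT_one _ _).1 (hf a (Or.inl ha) b (Or.inr hb) (hlt a ha b hb))
  · right
    refine ⟨rfl, ?_⟩
    rintro _ ⟨b, hb, rfl⟩ _ ⟨a, ha, rfl⟩
    exact (sLT_neg_one _ _).1 (hf a (Or.inl ha) b (Or.inr hb) (hlt a ha b hb))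

/-- Finitely many altered letters can be split off as one-letter words, which vanish in `Arch`. This
is what permits placeholders to be filled freely. -/
theorem SMono.ar_image {δ : ℤˣ} {W V : Word G} {f : W.dom → V.dom} {A E : Set W.dom}
    (hf : SMono δ f A) (hA : A.OrdConnected) (hE : E.Finite)
    (hl : ∀ a ∈ A, a ∉ E → V.letter (f a) = W.letter a ^ (δ : ℤ)) :
    V.ar (f '' A) = W.ar A ^ (δ : ℤ) := by
  refine interval_induction (P := fun I => I ⊆ A → V.ar (f '' I) = W.ar I ^ (δ : ℤ)) (𝒞 := {A})
    (D := A) ?_ ?_ (Set.finite_singleton A) hE ?_ (fun a ha => Or.inl (by simpa)) ?_ ?_ A subset_rfl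
    hA subset_rfl
  · intro I J _ _ _ hlt hI hJ hIJ
    have hI := hI (Set.subset_union_left.trans hIJ)
    have hJ := hJ (Set.subset_union_right.trans hIJ)
    rcases (hf.mono hIJ).image_lt hlt with ⟨rfl, h⟩ | ⟨rfl, h⟩
    · rw [Set.image_union, Word.ar_union _ h, Word.ar_union _ hlt, hI, hJ]
      simp
    · rw [Set.image_union, Set.union_comm, Word.ar_union _ h, Word.ar_union _ hlt, hI, hJ]
      simp
  · intro _
    rw [Set.image_empty, V.ar_finite Set.finite_empty, W.ar_finite Set.finite_empty, one_zpow]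
  · rintro _ rfl
    exact hA
  · intro e _ _ _
    rw [Set.image_singleton, V.ar_finite (Set.finite_singleton _),
      W.ar_finite (Set.finite_singleton _), one_zpow]
  · intro C _ I _ hIA _ hIE _
    exact Word.SMap.ar_image
      ⟨fun a ha => hl a (hIA ha) (Set.disjoint_left.1 hIE ha), hf.mono hIA⟩

namespace Sys

variable {X : Type*}

/-! ### Partial isomorphisms of systems -/

/-- The part of `S` on the intervals `D` and `R` is carried to a part of `S'` with sign `δ`, up to
finitely many letters. -/
structure Match (δ : ℤˣ) (S S' : Sys G K) (D : Set S.W.dom) (R : Set S.U.dom)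
    (e : S.W.dom → S'.W.dom) (h : S.U.dom → S'.U.dom) : Prop where
  left : SMono δ e D
  right : SMono δ h R
  conn_left : D.OrdConnected
  conn_right : R.OrdConnected
  conn_image_left : (e '' D).OrdConnected
  conn_image_right : (h '' R).OrdConnected
  finite_left : {a | a ∈ D ∧ S'.W.letter (e a) ≠ S.W.letter a ^ (δ : ℤ)}.Finite
  finite_right : {x | x ∈ R ∧ S'.U.letter (h x) ≠ S.U.letter x ^ (δ : ℤ)}.Finite
  rel_iff : ∀ a ∈ D, ∀ x ∈ R, S.rel a x ↔ S'.rel (e a) (h x)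
  mem_right : ∀ a ∈ D, ∀ x, S.rel a x → x ∈ R
  mem_left : ∀ x ∈ R, ∀ a, S.rel a x → a ∈ D
  mem_image_right : ∀ a ∈ D, ∀ x, S'.rel (e a) x → x ∈ h '' R
  mem_image_left : ∀ x ∈ R, ∀ a, S'.rel a (h x) → a ∈ e '' D

namespace Match

variable {δ : ℤˣ} {S S' : Sys G K} {D : Set S.W.dom} {R : Set S.U.dom} {e : S.W.dom → S'.W.dom}
  {h : S.U.dom → S'.U.dom}

theorem swap (m : Match δ S S' D R e h) : Match δ S.swap S'.swap R D h e :=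
  ⟨m.right, m.left, m.conn_right, m.conn_left, m.conn_image_right, m.conn_image_left,
    m.finite_right, m.finite_left, fun x hx a ha => m.rel_iff a ha x hx, m.mem_left, m.mem_right,
    m.mem_image_left, m.mem_image_right⟩

theorem hullR_image (m : Match δ S S' D R e h) {I : Set S.W.dom} (hID : I ⊆ D) :
    hullR S'.rel (e '' I) = h '' hullR S.rel I := by
  have hsub : ∀ x ∈ hullR S.rel I, x ∈ R := by
    rintro θ ⟨a, b, x, y, ha, hb, hx, hy, h1, h2⟩
    exact m.conn_right.out (m.mem_right a (hID ha) x hx) (m.mem_right b (hID hb) y hy) ⟨h1, h2⟩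
  ext θ
  constructor
  · rintro ⟨_, _, x', y', ⟨a, ha, rfl⟩, ⟨b, hb, rfl⟩, hx, hy, h1, h2⟩
    obtain ⟨x, hxR, rfl⟩ := m.mem_image_right a (hID ha) x' hx
    obtain ⟨y, hyR, rfl⟩ := m.mem_image_right b (hID hb) y' hy
    obtain ⟨z, hzR, rfl⟩ := m.conn_image_right.out ⟨x, hxR, rfl⟩ ⟨y, hyR, rfl⟩ ⟨h1, h2⟩
    have hx := (m.rel_iff a (hID ha) x hxR).2 hx
    have hy := (m.rel_iff b (hID hb) y hyR).2 hy
    refine ⟨z, ?_, rfl⟩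
    rcases m.right.between hxR hyR hzR h1 h2 with h3 | h3
    · exact ⟨a, b, x, y, ha, hb, hx, hy, h3⟩
    · exact ⟨b, a, y, x, hb, ha, hy, hx, h3⟩
  · rintro ⟨θ, hθ, rfl⟩
    have hθR := hsub θ hθ
    obtain ⟨a, b, x, y, ha, hb, hx, hy, h1, h2⟩ := hθ
    have hxR := m.mem_right a (hID ha) x hx
    have hyR := m.mem_right b (hID hb) y hy
    have hx := (m.rel_iff a (hID ha) x hxR).1 hx
    have hy := (m.rel_iff b (hID hb) y hyR).1 hy
    have hle : ∀ u ∈ R, ∀ w ∈ R, u ≤ w → (δ = 1 → h u ≤ h w) ∧ (δ = -1 → h w ≤ h u) := by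
      intro u hu w hw huw
      rcases huw.lt_or_eq with hlt | rfl
      · have h3 := m.right u hu w hw hlt
        exact ⟨fun e => by subst e; exact ((sLT_one _ _).1 h3).le,
          fun e => by subst e; exact ((sLT_neg_one _ _).1 h3).le⟩
      · exact ⟨fun _ => le_rfl, fun _ => le_rfl⟩
    rcases Int.units_eq_one_or δ with hδ | hδ
    · exact ⟨_, _, _, _, ⟨a, ha, rfl⟩, ⟨b, hb, rfl⟩, hx, hy, (hle x hxR θ hθR h1).1 hδ,
        (hle θ hθR y hyR h2).1 hδ⟩
    · exact ⟨_, _, _, _, ⟨b, hb, rfl⟩, ⟨a, ha, rfl⟩, hy, hx, (hle θ hθR y hyR h2).2 hδ,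
        (hle x hxR θ hθR h1).2 hδ⟩

theorem phi_image (m : Match δ S S' D R e h) {I : Set S.W.dom} (hID : I ⊆ D) :
    S'.Phi (e '' I) = S.Phi I ^ (δ : ℤ) := by
  have hsub : hullR S.rel I ⊆ R := by
    rintro θ ⟨a, b, x, y, ha, hb, hx, hy, h1, h2⟩
    exact m.conn_right.out (m.mem_right a (hID ha) x hx) (m.mem_right b (hID hb) y hy) ⟨h1, h2⟩
  rw [Phi, Phi, m.hullR_image hID]
  refine SMono.ar_image (m.right.mono hsub) (hullR_ordConnected _ _) m.finite_right ?_
  intro x hx hxE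
  by_contra hne
  exact hxE ⟨hsub hx, hne⟩

/-- The letters altered by the match join the exceptional set, off which alone letters have to
agree; the values of `Phi` are unaffected by them. -/
theorem pieced_image (m : Match δ S S' D R e h) {𝒯 : X → Sys G K} (hS : S.Pieced 𝒯 D) :
    S'.Pieced 𝒯 (e '' D) := by
  obtain ⟨𝒞, E, h𝒞, hE, hD, hC⟩ := hS
  rcases D.eq_empty_or_nonempty with rfl | ⟨d, -⟩
  · exact ⟨∅, ∅, Set.finite_empty, Set.finite_empty, by simp, by simp⟩
  have : Nonempty S.W.dom := ⟨d⟩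
  have hinv : ∀ a ∈ D, Function.invFunOn e D (e a) = a :=
    fun a ha => m.left.injOn.leftInvOn_invFunOn ha
  refine ⟨(fun C => e '' (C ∩ D)) '' 𝒞,
    e '' (E ∪ {a | a ∈ D ∧ S'.W.letter (e a) ≠ S.W.letter a ^ (δ : ℤ)}), h𝒞.image _,
    (hE.union m.finite_left).image _, ?_, ?_⟩
  · rintro _ ⟨a, ha, rfl⟩
    rcases hD ha with ⟨C, hCC, haC⟩ | haE
    · exact Or.inl ⟨_, ⟨C, hCC, rfl⟩, a, ⟨haC, ha⟩, rfl⟩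
    · exact Or.inr ⟨a, Or.inl haE, rfl⟩
  · rintro _ ⟨C, hCC, rfl⟩
    obtain ⟨hconn, x, ε, f, hf1, hf2, hf3, hf4⟩ := hC C hCC
    have hCD : (C ∩ D).OrdConnected := hconn.inter m.conn_left
    have him : ∀ J ⊆ D, Function.invFunOn e D '' (e '' J) = J := fun J hJ =>
      m.left.injOn.invFunOn_image hJ
    have him2 : ∀ J ⊆ D, (fun a => f (Function.invFunOn e D a)) '' (e '' J) = f '' J := by
      intro J hJ
      rw [← Set.image_image f, him J hJ]
    refine ⟨m.left.ordConnected_image m.conn_image_left hCD Set.inter_subset_right, x, ε * δ,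
      fun a => f (Function.invFunOn e D a), ?_, ?_, ?_, ?_⟩
    · refine SMono.comp ?_ (m.left.invFunOn.mono (Set.image_mono Set.inter_subset_right))
      rw [him _ Set.inter_subset_right]
      exact hf1.mono Set.inter_subset_left
    · rw [him2 _ Set.inter_subset_right]
      exact hf1.ordConnected_image hf2 hCD Set.inter_subset_left
    · rintro _ ⟨a, ⟨haC, haD⟩, rfl⟩ haE
      have h1 : a ∉ E := fun h => haE ⟨a, Or.inl h, rfl⟩
      have h2 : S'.W.letter (e a) = S.W.letter a ^ (δ : ℤ) := by
        by_contra hne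
        exact haE ⟨a, Or.inr ⟨haD, hne⟩, rfl⟩
      simp only [hinv a haD]
      rw [h2, hf3 a haC h1, mul_comm ε, zpow_unit_mul, zpow_unit_self]
    · intro I hI hIc
      obtain ⟨J, hJ, rfl⟩ : ∃ J ⊆ C ∩ D, I = e '' J := by
        refine ⟨C ∩ D ∩ e ⁻¹' I, Set.inter_subset_left, ?_⟩
        rw [Set.image_inter_preimage]
        exact (Set.inter_eq_right.2 hI).symm
      have hJD := hJ.trans Set.inter_subset_right
      have hJc : J.OrdConnected := by
        have h3 := (m.left.ordConnected_preimage m.conn_left hIc)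
        have h4 : D ∩ e ⁻¹' (e '' J) = J := by
          ext a
          constructor
          · rintro ⟨ha, b, hb, hab⟩
            rwa [← m.left.injOn (hJD hb) ha hab]
          · exact fun ha => ⟨hJD ha, a, ha, rfl⟩
        rwa [h4] at h3
      rw [him2 J hJD, hf4 J (hJ.trans Set.inter_subset_left) hJc, m.phi_image hJD, mul_comm ε,
        zpow_unit_mul, zpow_unit_self]

end Match

theorem Pieced.union {S : Sys G K} {𝒯 : X → Sys G K} {D D' : Set S.W.dom} (h : S.Pieced 𝒯 D)
    (h' : S.Pieced 𝒯 D') : S.Pieced 𝒯 (D ∪ D') := by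
  obtain ⟨𝒞, E, h1, h2, h3, h4⟩ := h
  obtain ⟨𝒞', E', h1', h2', h3', h4'⟩ := h'
  refine ⟨𝒞 ∪ 𝒞', E ∪ E', h1.union h1', h2.union h2', ?_, ?_⟩
  · rw [Set.sUnion_union]
    rintro a (ha | ha)
    · rcases h3 ha with h | h
      exacts [Or.inl (Or.inl h), Or.inr (Or.inl h)]
    · rcases h3' ha with h | h
      exacts [Or.inl (Or.inr h), Or.inr (Or.inr h)]
  · rintro C (hC | hC)
    · obtain ⟨h5, x, δ, f, h6, h7, h8, h9⟩ := h4 C hC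
      exact ⟨h5, x, δ, f, h6, h7, fun a ha haE => h8 a ha fun h => haE (Or.inl h), h9⟩
    · obtain ⟨h5, x, δ, f, h6, h7, h8, h9⟩ := h4' C hC
      exact ⟨h5, x, δ, f, h6, h7, fun a ha haE => h8 a ha fun h => haE (Or.inr h), h9⟩

theorem Pieced.of_finite {S : Sys G K} {𝒯 : X → Sys G K} {D : Set S.W.dom} (h : D.Finite) :
    S.Pieced 𝒯 D :=
  ⟨∅, D, Set.finite_empty, h, Set.subset_union_right, by simp⟩

theorem Pieced.self {𝒯 : X → Sys G K} (x : X) {D : Set (𝒯 x).W.dom} (hD : D.OrdConnected) :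
    (𝒯 x).Pieced 𝒯 D := by
  refine ⟨{D}, ∅, Set.finite_singleton D, Set.finite_empty, by simp, ?_⟩
  rintro C rfl
  refine ⟨hD, x, 1, fun a => a, fun a _ b _ h => by simpa using h, by simpa, by simp, by simp⟩

end Sys

end InfWord

namespace InfWord

universe u v

variable {G : ℕ → Type u} [∀ n, Group (G n)] {K : ℕ → Type v} [∀ n, Group (K n)]

/-! ### The words that replace the blocks -/

namespace Word

theorem idx_le {W : Word G} {i : W.dom} {n : ℕ} (h : W.letter i ∈ factor G n) : W.idx i ≤ n := by
  classical exact Nat.find_min' _ h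

/-- Two trivial letters. -/
def pairWord (G : ℕ → Type u) [∀ n, Group (G n)] : Word G where
  dom := Fin 2
  letter _ := 1
  exists_mem _ := ⟨0, one_mem _⟩
  finite_mem _ := Set.finite_univ.subset (Set.subset_univ _)

/-- The trivial letter belongs to every factor, so its index is below every threshold and it always
counts as a placeholder. -/
theorem idx_pairWord (p : (pairWord G).dom) : (pairWord G).idx p = 0 :=
  Nat.le_zero.1 (idx_le (one_mem _))

theorem finite_pairWord (A : Set (pairWord G).dom) : A.Finite :=
  Set.Finite.subset (Set.finite_univ (α := Fin 2)) (Set.subset_univ A)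

theorem exists_covBy_pairWord : ∃ x y : (pairWord G).dom, x ⋖ y := by
  refine ⟨(0 : Fin 2), (1 : Fin 2), ?_⟩
  change (0 : Fin 2) ⋖ 1
  refine ⟨by decide, ?_⟩
  change ∀ c : Fin 2, (0 : Fin 2) < c → ¬ c < (1 : Fin 2)
  decide

/-- A copy, up to the sign `δ`, of the restriction of a word. -/
theorem exists_signed_copy (V : Word G) (δ : ℤˣ) (A : Set V.dom) :
    ∃ (P : Word G) (g : P.dom → V.dom), SMap δ P V g Set.univ ∧ g '' Set.univ = A := by
  rcases Int.units_eq_one_or δ with rfl | rfl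
  · exact ⟨V.restrict A, V.val A, V.smap_val A, V.image_val_univ A⟩
  · refine ⟨(V.restrict A).inv, fun a => V.val A (OrderDual.ofDual a), ⟨?_, ?_⟩, ?_⟩
    · intro a _
      simp only [Units.val_neg, Units.val_one, zpow_neg, zpow_one]
      exact (inv_inv _).symm
    · intro a _ b _ hab
      exact (sLT_neg_one _ _).2 hab
    · ext z
      constructor
      · rintro ⟨a, -, rfl⟩
        exact Subtype.prop (OrderDual.ofDual a : A)
      · intro hz
        exact ⟨OrderDual.toDual ⟨z, hz⟩, trivial, rfl⟩

theorem inR_le_inR (W V : Word G) (a b : V.dom) : inR W V a ≤ inR W V b ↔ a ≤ b := by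
  rw [← not_lt, ← not_lt, inR_lt_inR]

theorem inL_le_inL (W V : Word G) (a b : W.dom) : inL W V a ≤ inL W V b ↔ a ≤ b := by
  rw [← not_lt, ← not_lt, inL_lt_inL]

theorem inL_injective (W V : Word G) : Function.Injective (inL W V) := fun _ _ h =>
  (smap_inL W V).smono.injOn trivial trivial h

theorem inR_injective (W V : Word G) : Function.Injective (inR W V) := fun _ _ h =>
  (smap_inR W V).smono.injOn trivial trivial h

theorem inL_ne_inR (W V : Word G) (a : W.dom) (b : V.dom) : inL W V a ≠ inR W V b :=
  (inL_lt_inR W V a b).ne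

theorem ordConnected_preimage_inL {W V : Word G} {C : Set (W.concat V).dom} (hC : C.OrdConnected) :
    (inL W V ⁻¹' C).OrdConnected := Set.ordConnected_def.2 fun _ hx _ hy _ hz =>
  hC.out hx hy ⟨(inL_le_inL W V _ _).2 hz.1, (inL_le_inL W V _ _).2 hz.2⟩

theorem ordConnected_preimage_inR {W V : Word G} {C : Set (W.concat V).dom} (hC : C.OrdConnected) :
    (inR W V ⁻¹' C).OrdConnected := Set.ordConnected_def.2 fun _ hx _ hy _ hz =>
  hC.out hx hy ⟨(inR_le_inR W V _ _).2 hz.1, (inR_le_inR W V _ _).2 hz.2⟩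

theorem covBy_of_inL {W V : Word G} {a b : W.dom} (h : inL W V a ⋖ inL W V b) : a ⋖ b :=
  ⟨(inL_lt_inL W V a b).1 h.1, fun _ h1 h2 =>
    h.2 ((inL_lt_inL W V _ _).2 h1) ((inL_lt_inL W V _ _).2 h2)⟩

theorem covBy_of_inR {W V : Word G} {a b : V.dom} (h : inR W V a ⋖ inR W V b) : a ⋖ b :=
  ⟨(inR_lt_inR W V a b).1 h.1, fun _ h1 h2 =>
    h.2 ((inR_lt_inR W V _ _).2 h1) ((inR_lt_inR W V _ _).2 h2)⟩

/-- By `hlow` every interval crossing the junction contains a letter of index at most `n`, so no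
cancellation or adjacency among the higher letters crosses it. -/
theorem redOn_concat {W V : Word G} {n : ℕ} (hW : W.RedOn {a | n < W.idx a})
    (hV : V.RedOn {a | n < V.idx a})
    (hlow : ∀ a p, n < W.idx a → n < V.idx p → ∃ m ≤ p, V.idx m ≤ n) :
    (W.concat V).RedOn {a | n < (W.concat V).idx a} := by
  have hnot : ∀ C ⊆ {a | n < (W.concat V).idx a}, C.OrdConnected → ∀ a p, inL W V a ∈ C →
      inR W V p ∉ C := by
    intro C hC hCc a p ha hp
    obtain ⟨m, hm, hmn⟩ := hlow a p (hC ha) (hC hp)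
    have : inR W V m ∈ C := hCc.out ha hp ⟨(inL_lt_inR W V a m).le, (inR_le_inR W V m p).2 hm⟩
    exact not_lt.2 hmn (hC this)
  constructor
  · intro C hC hCc hcl
    by_contra hne
    obtain ⟨i, hi⟩ := Set.nonempty_iff_ne_empty.2 hne
    rcases concat_cases W V i with ⟨a, rfl⟩ | ⟨p, rfl⟩
    · have him : inL W V '' (inL W V ⁻¹' C) = C := by
        refine Set.image_preimage_eq_of_subset fun j hj => ?_
        rcases concat_cases W V j with ⟨b, rfl⟩ | ⟨p, rfl⟩
        · exact ⟨b, rfl⟩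
        · exact absurd hj (hnot C hC hCc a p hi)
      have h1 := ((smap_inL W V).mono (Set.subset_univ (inL W V ⁻¹' C))).cl_image
      rw [him, hcl] at h1
      have h2 := hW.1 (inL W V ⁻¹' C) (fun b hb => hC hb) (ordConnected_preimage_inL hCc) (by simpa using h1.symm)
      exact Set.notMem_empty a (h2 ▸ hi)
    · have him : inR W V '' (inR W V ⁻¹' C) = C := by
        refine Set.image_preimage_eq_of_subset fun j hj => ?_
        rcases concat_cases W V j with ⟨b, rfl⟩ | ⟨q, rfl⟩
        · exact absurd hi (hnot C hC hCc b p hj)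
        · exact ⟨q, rfl⟩
      have h1 := ((smap_inR W V).mono (Set.subset_univ (inR W V ⁻¹' C))).cl_image
      rw [him, hcl] at h1
      have h2 := hV.1 (inR W V ⁻¹' C) (fun b hb => hC hb) (ordConnected_preimage_inR hCc) (by simpa using h1.symm)
      exact Set.notMem_empty p (h2 ▸ hi)
  · intro i hi j hj hij k hk
    rcases concat_cases W V i with ⟨a, rfl⟩ | ⟨a, rfl⟩ <;>
    rcases concat_cases W V j with ⟨b, rfl⟩ | ⟨b, rfl⟩
    · exact hW.2 a hi b hj (covBy_of_inL hij) k hk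
    · obtain ⟨m, hm, hmn⟩ := hlow a b hi hj
      rcases hm.lt_or_eq with hlt | rfl
      · exact hij.2 (inL_lt_inR W V a m) ((inR_lt_inR W V m b).2 hlt)
      · exact not_lt.2 hmn hj
    · exact not_inR_lt_inL W V a b hij.1
    · exact hV.2 a hi b hj (covBy_of_inR hij) k hk

end Word

/-! ### Translation of a single block -/

open Word (inL inR)

namespace Sys

variable {X : Type*}

/-- The word `S.U` replaces the interval `B` of `S.W`. Letters of index at most `n` are
placeholders. -/
structure IsBlock (𝒯 : X → Sys G K) (n : ℕ) (S : Sys G K) (B : Set S.W.dom) : Prop where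
  rel_mem : ∀ a p, S.rel a p → a ∈ B
  lt_iff : ∀ a b x y, S.rel a x → S.rel b y → (a < b ↔ x < y)
  close_left : ∀ I ⊆ B, I.OrdConnected → I.Infinite → ∃ a ∈ I, ∃ x, S.rel a x
  close_right : Close {x | ∃ a, S.rel a x}
  nonempty : B.Nonempty → ∃ a x, S.rel a x
  -- A neighbouring pair makes orientation visible: the order of `x` and `y` in a copy reveals its
  -- sign.
  pair : B.Nonempty → ∃ x y : S.U.dom, x ⋖ y ∧ S.U.idx x ≤ n ∧ S.U.idx y ≤ n
  low : ∀ p, ∃ m ≤ p, S.U.idx m ≤ n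
  redOn : S.U.RedOn {p | n < S.U.idx p}
  pieced : S.Pieced 𝒯 B
  pieced_swap : S.swap.Pieced (fun x => (𝒯 x).swap) Set.univ

theorem isBlock_empty (𝒯 : X → Sys G K) (n : ℕ) (W : Word G) :
    IsBlock 𝒯 n ⟨W, Word.empty K, fun _ _ => False⟩ ∅ where
  rel_mem _ _ h := h.elim
  lt_iff _ _ _ _ h := h.elim
  close_left _ hI _ hinf := absurd (Set.finite_empty.subset hI) hinf
  close_right _ _ hinf := absurd (Set.Finite.subset (Set.finite_univ (α := Empty))
    (Set.subset_univ _)) hinf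
  nonempty h := absurd h Set.not_nonempty_empty
  pair h := absurd h Set.not_nonempty_empty
  low p := p.elim
  redOn := ⟨fun _ _ _ _ => Set.eq_empty_of_forall_notMem fun i _ => i.elim, fun i _ => i.elim⟩
  pieced := Pieced.of_finite Set.finite_empty
  pieced_swap := Pieced.of_finite (Set.Finite.subset (Set.finite_univ (α := Empty))
    (Set.subset_univ _))

theorem exists_isBlock_of_finite (𝒯 : X → Sys G K) (n : ℕ) (W : Word G) {B : Set W.dom}
    (hB : B.Finite) : ∃ (Y : Word K) (r : W.dom → Y.dom → Prop), IsBlock 𝒯 n ⟨W, Y, r⟩ B := by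
  rcases B.eq_empty_or_nonempty with rfl | ⟨i, hi⟩
  · exact ⟨_, _, isBlock_empty 𝒯 n W⟩
  obtain ⟨x, y, hxy⟩ := Word.exists_covBy_pairWord (G := K)
  have hidx : ∀ p, (Word.pairWord K).idx p ≤ n := fun p => by
    rw [Word.idx_pairWord]
    exact Nat.zero_le n
  refine ⟨Word.pairWord K, fun a p => a = i ∧ p = x, ?_, ?_, ?_, ?_, ?_, ?_, ?_, ?_, ?_, ?_⟩
  · intro a p h
    exact (h.1 : a = i) ▸ hi
  · intro a b p q h h'
    have h1 : a = b := Eq.trans h.1 (Eq.symm h'.1)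
    have h2 : p = q := Eq.trans h.2 (Eq.symm h'.2)
    rw [h1, h2]
    exact ⟨fun h => absurd h (lt_irrefl _), fun h => absurd h (lt_irrefl _)⟩
  · exact fun I hI _ hinf => absurd (hB.subset hI) hinf
  · exact fun I _ hinf => absurd (Word.finite_pairWord I) hinf
  · exact fun _ => ⟨i, x, rfl, rfl⟩
  · exact fun _ => ⟨x, y, hxy, hidx x, hidx y⟩
  · exact fun p => ⟨p, le_rfl, hidx p⟩
  · have h0 : ∀ p : (Word.pairWord K).dom, p ∉ {p | n < (Word.pairWord K).idx p} :=
      fun p hp => not_lt.2 (hidx p) hp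
    exact ⟨fun A hA _ _ => Set.eq_empty_of_forall_notMem fun p hp => h0 p (hA hp),
      fun p hp => absurd hp (h0 p)⟩
  · exact Pieced.of_finite hB
  · exact Pieced.of_finite (Word.finite_pairWord (G := K) _)

theorem IsBlock.union {𝒯 : X → Sys G K} {n : ℕ} {W : Word G} {Y Z : Word K}
    {r : W.dom → Y.dom → Prop} {s : W.dom → Z.dom → Prop} {A B : Set W.dom}
    (hAc : A.OrdConnected) (hBc : B.OrdConnected) (hlt : ∀ a ∈ A, ∀ b ∈ B, a < b)
    (hA : IsBlock 𝒯 n ⟨W, Y, r⟩ A) (hB : IsBlock 𝒯 n ⟨W, Z, s⟩ B) :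
    IsBlock 𝒯 n ⟨W, Y.concat Z, fun a p => (∃ x, p = inL Y Z x ∧ r a x) ∨
      ∃ x, p = inR Y Z x ∧ s a x⟩ (A ∪ B) := by
  have hrA : ∀ a x, r a x → a ∈ A := hA.rel_mem
  have hsB : ∀ a x, s a x → a ∈ B := hB.rel_mem
  have hdis : ∀ a ∈ A, a ∉ B := fun a ha hb => lt_irrefl a (hlt a ha a hb)
  set t : W.dom → (Y.concat Z).dom → Prop := fun a p => (∃ x, p = inL Y Z x ∧ r a x) ∨
      ∃ x, p = inR Y Z x ∧ s a x with ht
  have htL : ∀ a x, t a (inL Y Z x) ↔ r a x := by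
    intro a x
    constructor
    · rintro (⟨y, hy, h⟩ | ⟨y, hy, h⟩)
      · rwa [Word.inL_injective Y Z hy]
      · exact absurd hy (Word.inL_ne_inR Y Z _ _)
    · exact fun h => Or.inl ⟨x, rfl, h⟩
  have htR : ∀ a x, t a (inR Y Z x) ↔ s a x := by
    intro a x
    constructor
    · rintro (⟨y, hy, h⟩ | ⟨y, hy, h⟩)
      · exact absurd hy.symm (Word.inL_ne_inR Y Z _ _)
      · rwa [Word.inR_injective Y Z hy]
    · exact fun h => Or.inr ⟨x, rfl, h⟩
  have mL : Match 1 (⟨W, Y, r⟩ : Sys G K) ⟨W, Y.concat Z, t⟩ A Set.univ (fun a => a)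
      (inL Y Z) := by
    refine ⟨(Word.SMap.id W A).smono, (Word.smap_inL Y Z).smono, hAc, Set.ordConnected_univ, by simpa,
      Word.ordConnected_image_inL _ _ Set.ordConnected_univ, ?_, ?_, ?_, ?_, ?_, ?_, ?_⟩
    · convert Set.finite_empty
      ext a
      simp
    · convert Set.finite_empty
      refine Set.eq_empty_of_forall_notMem fun a ha => ha.2 ((Word.smap_inL Y Z).letter a trivial)
    · exact fun a _ x _ => (htL a x).symm
    · exact fun _ _ _ _ => trivial
    · exact fun x _ a h => hrA a x h
    · rintro a ha p (⟨x, rfl, -⟩ | ⟨x, rfl, h⟩)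
      · exact ⟨x, trivial, rfl⟩
      · exact absurd (hsB a x h) (hdis a ha)
    · intro x _ a h
      exact ⟨a, hrA a x ((htL a x).1 h), rfl⟩
  have mR : Match 1 (⟨W, Z, s⟩ : Sys G K) ⟨W, Y.concat Z, t⟩ B Set.univ (fun a => a)
      (inR Y Z) := by
    refine ⟨(Word.SMap.id W B).smono, (Word.smap_inR Y Z).smono, hBc, Set.ordConnected_univ, by simpa,
      Word.ordConnected_image_inR _ _ Set.ordConnected_univ, ?_, ?_, ?_, ?_, ?_, ?_, ?_⟩
    · convert Set.finite_empty
      ext a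
      simp
    · convert Set.finite_empty
      refine Set.eq_empty_of_forall_notMem fun a ha => ha.2 ((Word.smap_inR Y Z).letter a trivial)
    · exact fun a _ x _ => (htR a x).symm
    · exact fun _ _ _ _ => trivial
    · exact fun x _ a h => hsB a x h
    · rintro a ha p (⟨x, rfl, h⟩ | ⟨x, rfl, -⟩)
      · exact absurd ha (hdis a (hrA a x h))
      · exact ⟨x, trivial, rfl⟩
    · intro x _ a h
      exact ⟨a, hsB a x ((htR a x).1 h), rfl⟩
  have himg : inL Y Z '' Set.univ ∪ inR Y Z '' Set.univ = Set.univ := by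
    ext p
    rcases Word.concat_cases Y Z p with ⟨x, rfl⟩ | ⟨x, rfl⟩
    · simp
    · simp
  refine ⟨?_, ?_, ?_, ?_, ?_, ?_, ?_, ?_, ?_, ?_⟩
  · rintro a p (⟨x, -, h⟩ | ⟨x, -, h⟩)
    exacts [Or.inl (hrA a x h), Or.inr (hsB a x h)]
  · rintro a b p q (⟨x, rfl, hx⟩ | ⟨x, rfl, hx⟩) (⟨y, rfl, hy⟩ | ⟨y, rfl, hy⟩)
    · exact (hA.lt_iff a b x y hx hy).trans (Word.inL_lt_inL Y Z x y).symm
    · exact ⟨fun _ => Word.inL_lt_inR Y Z x y, fun _ => hlt a (hrA a x hx) b (hsB b y hy)⟩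
    · exact ⟨fun h => absurd h (lt_asymm (hlt b (hrA b y hy) a (hsB a x hx))),
        fun h => absurd h (Word.not_inR_lt_inL Y Z x y)⟩
    · exact (hB.lt_iff a b x y hx hy).trans (Word.inR_lt_inR Y Z x y).symm
  · intro I hI hIc hinf
    have h1 : I = I ∩ A ∪ I ∩ B := by
      rw [← Set.inter_union_distrib_left]
      exact (Set.inter_eq_left.2 hI).symm
    rw [h1, Set.infinite_union] at hinf
    rcases hinf with hinf | hinf
    · obtain ⟨a, ha, x, hx⟩ := hA.close_left _ Set.inter_subset_right (hIc.inter hAc) hinf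
      exact ⟨a, ha.1, _, (htL a x).2 hx⟩
    · obtain ⟨a, ha, x, hx⟩ := hB.close_left _ Set.inter_subset_right (hIc.inter hBc) hinf
      exact ⟨a, ha.1, _, (htR a x).2 hx⟩
  · intro J hJ hinf
    have h1 : J ⊆ inL Y Z '' (inL Y Z ⁻¹' J) ∪ inR Y Z '' (inR Y Z ⁻¹' J) := by
      intro p hp
      rcases Word.concat_cases Y Z p with ⟨x, rfl⟩ | ⟨x, rfl⟩
      exacts [Or.inl ⟨x, hp, rfl⟩, Or.inr ⟨x, hp, rfl⟩]
    rcases Set.infinite_union.1 (hinf.mono h1) with h2 | h2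
    · obtain ⟨x, hx, a, ha⟩ := hA.close_right _ (Word.ordConnected_preimage_inL hJ) h2.of_image
      exact ⟨_, hx, a, (htL a x).2 ha⟩
    · obtain ⟨x, hx, a, ha⟩ := hB.close_right _ (Word.ordConnected_preimage_inR hJ) h2.of_image
      exact ⟨_, hx, a, (htR a x).2 ha⟩
  · rintro ⟨i, hi | hi⟩
    · obtain ⟨a, x, hx⟩ := hA.nonempty ⟨i, hi⟩
      exact ⟨a, _, (htL a x).2 hx⟩
    · obtain ⟨a, x, hx⟩ := hB.nonempty ⟨i, hi⟩
      exact ⟨a, _, (htR a x).2 hx⟩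
  · rintro ⟨i, hi | hi⟩
    · obtain ⟨x, y, hxy, hx, hy⟩ := hA.pair ⟨i, hi⟩
      refine ⟨inL Y Z x, inL Y Z y, ⟨(Word.inL_lt_inL Y Z x y).2 hxy.1, fun p h1 h2 => ?_⟩, hx, hy⟩
      rcases Word.concat_cases Y Z p with ⟨z, rfl⟩ | ⟨z, rfl⟩
      · exact hxy.2 ((Word.inL_lt_inL Y Z _ _).1 h1) ((Word.inL_lt_inL Y Z _ _).1 h2)
      · exact Word.not_inR_lt_inL Y Z _ _ h2
    · obtain ⟨x, y, hxy, hx, hy⟩ := hB.pair ⟨i, hi⟩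
      refine ⟨inR Y Z x, inR Y Z y, ⟨(Word.inR_lt_inR Y Z x y).2 hxy.1, fun p h1 h2 => ?_⟩, hx, hy⟩
      rcases Word.concat_cases Y Z p with ⟨z, rfl⟩ | ⟨z, rfl⟩
      · exact Word.not_inR_lt_inL Y Z _ _ h1
      · exact hxy.2 ((Word.inR_lt_inR Y Z _ _).1 h1) ((Word.inR_lt_inR Y Z _ _).1 h2)
  · intro p
    rcases Word.concat_cases Y Z p with ⟨x, rfl⟩ | ⟨x, rfl⟩
    · obtain ⟨m, hm, hmn⟩ := hA.low x
      exact ⟨_, (Word.inL_le_inL Y Z m x).2 hm, hmn⟩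
    · obtain ⟨m, hm, hmn⟩ := hB.low x
      exact ⟨_, (Word.inR_le_inR Y Z m x).2 hm, hmn⟩
  · exact Word.redOn_concat hA.redOn hB.redOn fun _ p _ _ => hB.low p
  · have h1 := mL.pieced_image hA.pieced
    have h2 := mR.pieced_image hB.pieced
    rw [Set.image_id'] at h1 h2
    exact h1.union h2
  · have h1 := mL.swap.pieced_image hA.pieced_swap
    have h2 := mR.swap.pieced_image hB.pieced_swap
    exact himg ▸ h1.union h2

/-- The translation is the pair of placeholders followed by a signed copy of the hull that
corresponds to the copy of `C` in `𝒯 x`. As `C` is infinite, closeness guarantees a related pair of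
positions. -/
theorem exists_isBlock_of_smap {𝒯 : X → Sys G K} (h𝒯 : ∀ x, CoiRel (𝒯 x).rel)
    (hU : ∀ x, (𝒯 x).U.IsReduced) (n : ℕ) {W : Word G} {C : Set W.dom} (hC : C.OrdConnected)
    (hinf : C.Infinite) {x : X} {δ : ℤˣ} {f : W.dom → (𝒯 x).W.dom}
    (hf : Word.SMap δ W (𝒯 x).W f C) (hfC : (f '' C).OrdConnected) :
    ∃ (Y : Word K) (r : W.dom → Y.dom → Prop), IsBlock 𝒯 n ⟨W, Y, r⟩ C := by
  obtain ⟨i0, hi0⟩ := hinf.nonempty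
  have : Nonempty W.dom := ⟨i0⟩
  obtain ⟨P, g, hg, hgH⟩ := (𝒯 x).U.exists_signed_copy δ (hullR (𝒯 x).rel (f '' C))
  have hself : ∀ a ∈ C, ∀ u, (𝒯 x).rel (f a) u → ∃ z, g z = u := by
    intro a ha u hu
    have : u ∈ hullR (𝒯 x).rel (f '' C) :=
      ⟨f a, f a, u, u, ⟨a, ha, rfl⟩, ⟨a, ha, rfl⟩, hu, hu, le_rfl, le_rfl⟩
    rw [← hgH] at this
    obtain ⟨z, -, hz⟩ := this
    exact ⟨z, hz⟩
  have hmem : ∀ z a, (𝒯 x).rel a (g z) → a ∈ f '' C := by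
    intro z a ha
    refine (h𝒯 x).mem_of_mem_hullR hfC ha ?_
    rw [← hgH]
    exact ⟨z, trivial, rfl⟩
  obtain ⟨_, ⟨a0, ha0, rfl⟩, u0, hu0⟩ := (h𝒯 x).close_left _ hfC (hinf.image hf.smono.injOn)
  obtain ⟨z0, rfl⟩ := hself a0 ha0 u0 hu0
  have : Nonempty P.dom := ⟨z0⟩
  let Q : Word K := (Word.pairWord K).concat P
  let r : W.dom → Q.dom → Prop := fun a p => a ∈ C ∧ ∃ z, p = inR (Word.pairWord K) P z ∧
    (𝒯 x).rel (f a) (g z)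
  have hr : ∀ a ∈ C, ∀ z, r a (inR _ P z) ↔ (𝒯 x).rel (f a) (g z) := by
    intro a ha z
    constructor
    · rintro ⟨-, w, hw, h⟩
      rwa [Word.inR_injective _ P hw]
    · exact fun h => ⟨ha, z, rfl, h⟩
  have hidx : ∀ p, Q.idx (inL (Word.pairWord K) P p) ≤ n := fun p => by
    change (Word.pairWord K).idx p ≤ n
    rw [Word.idx_pairWord]
    exact Nat.zero_le n
  have hginv : ∀ z, Function.invFunOn g Set.univ (g z) = z := fun z =>
    hg.smono.injOn.leftInvOn_invFunOn trivial
  have hfinv : ∀ a ∈ C, Function.invFunOn f C (f a) = a := fun a ha =>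
    hf.smono.injOn.leftInvOn_invFunOn ha
  have hfim : Function.invFunOn f C '' (f '' C) = C := hf.smono.injOn.invFunOn_image subset_rfl
  have hgmap : Word.SMap δ (𝒯 x).U Q (fun u => inR _ P (Function.invFunOn g Set.univ u))
      (g '' Set.univ) := by
    have := Word.SMap.comp (((Word.smap_inR (Word.pairWord K) P)).mono
      (Set.subset_univ (Function.invFunOn g Set.univ '' (g '' Set.univ)))) hg.invFunOn
    rwa [one_mul] at this
  have hgim : (fun u => inR (Word.pairWord K) P (Function.invFunOn g Set.univ u)) ''
      (g '' Set.univ) = inR _ P '' Set.univ := by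
    rw [← Set.image_image (inR (Word.pairWord K) P), hg.smono.injOn.invFunOn_image subset_rfl]
  have m : Match δ (𝒯 x) ⟨W, Q, r⟩ (f '' C) (g '' Set.univ) (Function.invFunOn f C)
      (fun u => inR _ P (Function.invFunOn g Set.univ u)) := by
    refine ⟨hf.invFunOn.smono, hgmap.smono, hfC, hgH ▸ hullR_ordConnected _ _, by rwa [hfim], ?_, ?_,
      ?_, ?_, ?_, ?_, ?_, ?_⟩
    · rw [hgim]
      exact Word.ordConnected_image_inR _ _ Set.ordConnected_univ
    · convert Set.finite_empty
      exact Set.eq_empty_of_forall_notMem fun a ha => ha.2 (hf.invFunOn.letter a ha.1)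
    · convert Set.finite_empty
      exact Set.eq_empty_of_forall_notMem fun a ha => ha.2 (hgmap.letter a ha.1)
    · rintro _ ⟨a, ha, rfl⟩ _ ⟨z, -, rfl⟩
      simp only [hginv, hfinv a ha]
      exact (hr a ha z).symm
    · rintro _ ⟨a, ha, rfl⟩ u hu
      obtain ⟨z, rfl⟩ := hself a ha u hu
      exact ⟨z, trivial, rfl⟩
    · rintro _ ⟨z, -, rfl⟩ a ha
      exact hmem z a ha
    · rintro _ ⟨a, ha, rfl⟩ p ⟨-, z, rfl, -⟩
      rw [hgim]
      exact ⟨z, trivial, rfl⟩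
    · rintro u - a ⟨ha, -⟩
      rwa [hfim]
  refine ⟨Q, r, ?_, ?_, ?_, ?_, ?_, ?_, ?_, ?_, ?_, ?_⟩
  · exact fun a p h => h.1
  · rintro a b _ _ ⟨ha, z, rfl, hz⟩ ⟨hb, w, rfl, hw⟩
    have h1 := (h𝒯 x).lt_iff _ _ _ _ hz hw
    have h2 := (h𝒯 x).lt_iff _ _ _ _ hw hz
    refine Iff.trans ?_ (Word.inR_lt_inR _ P z w).symm
    rcases Int.units_eq_one_or δ with rfl | rfl
    · rwa [hf.smono.lt_iff ha hb, hg.smono.lt_iff trivial trivial] at h1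
    · rwa [hf.smono.lt_iff' hb ha, hg.smono.lt_iff' trivial trivial] at h2
  · intro I hI hIc hIinf
    obtain ⟨_, ⟨a, ha, rfl⟩, u, hu⟩ := (h𝒯 x).close_left _ (hf.smono.ordConnected_image hfC hIc hI)
      (hIinf.image (hf.smono.injOn.mono hI))
    obtain ⟨z, rfl⟩ := hself a (hI ha) u hu
    exact ⟨a, ha, _, (hr a (hI ha) z).2 hu⟩
  · intro J hJ hJinf
    have h1 : J ⊆ inL _ P '' Set.univ ∪ inR (Word.pairWord K) P '' (inR _ P ⁻¹' J) := by
      intro p hp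
      rcases Word.concat_cases _ P p with ⟨z, rfl⟩ | ⟨z, rfl⟩
      exacts [Or.inl ⟨z, trivial, rfl⟩, Or.inr ⟨z, hp, rfl⟩]
    have h2 := ((Set.infinite_union.1 (hJinf.mono h1)).resolve_left
      (Set.not_infinite.2 ((Word.finite_pairWord _).image _))).of_image
    obtain ⟨_, ⟨z, hz, rfl⟩, a, ha⟩ := (h𝒯 x).close_right _
      (hg.smono.ordConnected_image (hgH ▸ hullR_ordConnected _ _)
        (Word.ordConnected_preimage_inR hJ) (Set.subset_univ _))
      (h2.image (hg.smono.injOn.mono (Set.subset_univ _)))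
    obtain ⟨b, hb, rfl⟩ := hmem z a ha
    exact ⟨_, hz, b, (hr b hb z).2 ha⟩
  · exact fun _ => ⟨a0, _, (hr a0 ha0 z0).2 hu0⟩
  · intro _
    obtain ⟨p, q, hpq⟩ := Word.exists_covBy_pairWord (G := K)
    refine ⟨inL _ P p, inL _ P q, ⟨(Word.inL_lt_inL _ P p q).2 hpq.1, fun k h1 h2 => ?_⟩,
      hidx p, hidx q⟩
    rcases Word.concat_cases _ P k with ⟨z, rfl⟩ | ⟨z, rfl⟩
    · exact hpq.2 ((Word.inL_lt_inL _ P _ _).1 h1) ((Word.inL_lt_inL _ P _ _).1 h2)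
    · exact Word.not_inR_lt_inL _ P _ _ h2
  · intro k
    obtain ⟨p, q, hpq⟩ := Word.exists_covBy_pairWord (G := K)
    rcases Word.concat_cases _ P k with ⟨z, rfl⟩ | ⟨z, rfl⟩
    · exact ⟨_, le_rfl, hidx z⟩
    · exact ⟨_, (Word.inL_lt_inR _ P p z).le, hidx p⟩
  · have h0 : ∀ p : (Word.pairWord K).dom, ¬ n < (Word.pairWord K).idx p := fun p =>
      not_lt.2 (hidx p)
    have hP : P.IsReduced := by
      refine Word.isReduced_of_redOn (hg.redOn (hgH ▸ hullR_ordConnected _ _) ((hU x).redOn _))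
    refine Word.redOn_concat ?_ (hP.redOn _) fun a p ha _ => absurd ha (h0 a)
    exact ⟨fun A hA _ _ => Set.eq_empty_of_forall_notMem fun p hp => h0 p (hA hp),
      fun p hp => absurd hp (h0 p)⟩
  · have := m.pieced_image (Pieced.self x hfC)
    rwa [hfim] at this
  · have h1 := m.swap.pieced_image (Pieced.self (𝒯 := fun x => (𝒯 x).swap) x
      (hgH ▸ hullR_ordConnected _ _ : (g '' Set.univ).OrdConnected))
    have h2 : (Sys.swap ⟨W, Q, r⟩).Pieced (fun x => (𝒯 x).swap) (inL (Word.pairWord K) P '' Set.univ) :=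
      Pieced.of_finite ((Word.finite_pairWord _).image _)
    refine cast (congrArg (Sys.Pieced (Sys.swap ⟨W, Q, r⟩) fun x => (𝒯 x).swap) ?_) (h2.union h1)
    refine (congrArg (inL (Word.pairWord K) P '' Set.univ ∪ ·) hgim).trans
      (Set.eq_univ_of_forall fun p => ?_)
    rcases Word.concat_cases _ P p with ⟨z, rfl⟩ | ⟨z, rfl⟩
    exacts [Or.inl ⟨z, trivial, rfl⟩, Or.inr ⟨z, trivial, rfl⟩]

/-- The infinite intervals inside the pieces are translated by `exists_isBlock_of_smap`, finite ones
by placeholders only, and translations concatenate. -/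
theorem exists_isBlock {𝒯 : X → Sys G K} (h𝒯 : ∀ x, CoiRel (𝒯 x).rel)
    (hT : ∀ x, (𝒯 x).W.IsReduced) (hU : ∀ x, (𝒯 x).U.IsReduced) (n : ℕ) {W : Word G}
    (hW : W.IsReduced) {A : Set W.dom} (hA : A.OrdConnected)
    (hmem : W.cl A ∈ Fine fun x => (𝒯 x).W) :
    ∃ (Y : Word K) (r : W.dom → Y.dom → Prop), IsBlock 𝒯 n ⟨W, Y, r⟩ A := by
  obtain ⟨k, D, h1, -, -, h3, h4, h5, -⟩ := Word.exists_pieces_of_interval hT hW hA hmem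
  refine interval_induction (P := fun I => ∃ (Y : Word K) (r : W.dom → Y.dom → Prop),
      IsBlock 𝒯 n ⟨W, Y, r⟩ I) (𝒞 := D '' Set.Iio k) (D := A) (E := {i ∈ A | ∀ j, i ∉ D j})
    ?_ ?_ ((Set.finite_Iio k).image D) h5 ?_ ?_ ?_ ?_ A subset_rfl hA
  · rintro I J hI hJ _ hlt ⟨Y, r, hr⟩ ⟨Z, s, hs⟩
    exact ⟨_, _, hr.union hI hJ hlt hs⟩
  · exact exists_isBlock_of_finite 𝒯 n W Set.finite_empty
  · rintro _ ⟨j, -, rfl⟩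
    exact h1 j
  · intro i hi
    by_cases h : ∃ j, i ∈ D j
    · obtain ⟨j, hj⟩ := h
      exact Or.inl ⟨_, ⟨j, h3 i j hj, rfl⟩, hj⟩
    · exact Or.inr ⟨hi, fun j hj => h ⟨j, hj⟩⟩
  · exact fun i _ _ => exists_isBlock_of_finite 𝒯 n W (Set.finite_singleton i)
  · rintro _ ⟨j, -, rfl⟩ I hI _ hIc _
    by_cases hfin : I.Finite
    · exact exists_isBlock_of_finite 𝒯 n W hfin
    · obtain ⟨i, hi⟩ := Set.Infinite.nonempty hfin
      obtain ⟨x, δ, f, hf, hfc⟩ := h4 j ⟨i, hI hi⟩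
      exact exists_isBlock_of_smap h𝒯 hU n hIc hfin (hf.mono hI)
        (hf.smono.ordConnected_image hfc hIc hI)

end Sys

end InfWord

namespace InfWord

universe u v

variable {G : ℕ → Type u} [∀ n, Group (G n)] {K : ℕ → Type v} [∀ n, Group (K n)]

/-! ### Ordered sums of signed copies of words -/

/-- The order on `α`, reversed if the sign is negative. -/
def Signed (_ : ℤˣ) (α : Type) : Type := α

instance Signed.linearOrder {δ : ℤˣ} {α : Type} [h : LinearOrder α] : LinearOrder (Signed δ α) :=
  if δ = 1 then h else OrderDual.instLinearOrder α

theorem Signed.lt_iff {δ : ℤˣ} {α : Type} [h : LinearOrder α] (a b : α) :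
    @LT.lt (Signed δ α) _ a b ↔ sLT δ a b := by
  by_cases hδ : δ = 1
  · have e : (Signed.linearOrder : LinearOrder (Signed δ α)) = h := if_pos hδ
    rw [e, sLT, if_pos hδ]
    rfl
  · have e : (Signed.linearOrder : LinearOrder (Signed δ α)) = OrderDual.instLinearOrder α :=
      if_neg hδ
    rw [e, sLT, if_neg hδ]
    rfl

/-- Words `Y r` of which signed copies are to be arranged along the rationals. -/
structure Frame (K : ℕ → Type v) [∀ n, Group (K n)] where
  Y : ℚ → Word K
  rep : ℚ → ℚ
  ε : ℚ → ℤˣ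
  finite_rep : ∀ r, {q | rep q = r}.Finite
  redOn : ∀ r, (Y r).RedOn {p | Encodable.encode r < (Y r).idx p}
  pair : ∀ r, ∃ x y : (Y r).dom, x ⋖ y ∧ (Y r).idx x ≤ Encodable.encode r ∧
    (Y r).idx y ≤ Encodable.encode r

namespace Frame

variable (F : Frame K)

/-- The positions of the sum. -/
def Pos : Type := Σₗ q : ℚ, Signed (F.ε q) (F.Y (F.rep q)).dom

instance : LinearOrder F.Pos := inferInstanceAs (LinearOrder (Σₗ _ : ℚ, Signed _ _))

/-- The positions of the summands. -/
def Cls : Type := Σ r : ℚ, (F.Y r).dom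

variable {F}

/-- The block of a position. -/
def block (u : F.Pos) : ℚ := (ofLex u).1

/-- The position of the summand that corresponds to a position. -/
def cp (u : F.Pos) : F.Cls := ⟨F.rep (ofLex u).1, (ofLex u).2⟩

variable (F) in
/-- The positions of the block `q`. -/
def pos (q : ℚ) (p : (F.Y (F.rep q)).dom) : F.Pos := toLex ⟨q, p⟩

theorem exists_pos (u : F.Pos) : ∃ p, u = F.pos (block u) p := ⟨(ofLex u).2, rfl⟩

theorem exists_pos_of_eq {u : F.Pos} {q : ℚ} (h : block u = q) : ∃ p, u = F.pos q p := by
  subst h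
  exact exists_pos u

theorem cp_fst (u : F.Pos) : (cp u).1 = F.rep (block u) := rfl

theorem eq_of_cp_eq {u w : F.Pos} (hb : block u = block w) (hc : cp u = cp w) : u = w := by
  have key : ∀ (q q' : ℚ) (p : (F.Y (F.rep q)).dom) (p' : (F.Y (F.rep q')).dom), q = q' →
      cp (F.pos q p) = cp (F.pos q' p') → F.pos q p = F.pos q' p' := by
    rintro q _ p p' rfl h
    have h' : p = p' := eq_of_heq (Sigma.mk.inj h).2
    rw [h']
  exact key (block u) (block w) (ofLex u).2 (ofLex w).2 hb hc

theorem exists_of_cp {q : ℚ} {c : F.Cls} (h : F.rep q = c.1) :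
    ∃ u : F.Pos, block u = q ∧ cp u = c := by
  obtain ⟨r, p⟩ := c
  subst h
  exact ⟨F.pos q p, rfl, rfl⟩

theorem pos_lt_pos {q : ℚ} (p p' : (F.Y (F.rep q)).dom) :
    F.pos q p < F.pos q p' ↔ sLT (F.ε q) p p' := by
  rw [← Signed.lt_iff]
  refine (Sigma.Lex.lt_def (a := F.pos q p) (b := F.pos q p')).trans ?_
  constructor
  · rintro (h | ⟨_, h⟩)
    · exact absurd h (lt_irrefl q)
    · exact h
  · exact fun h => Or.inr ⟨rfl, h⟩

theorem block_mono : Monotone (block : F.Pos → ℚ) := by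
  intro u w h
  rcases h.lt_or_eq with h | rfl
  · rcases Sigma.Lex.lt_def.1 h with h | ⟨h, -⟩
    · exact h.le
    · exact le_of_eq h
  · exact le_rfl

theorem smono_pos (q : ℚ) : SMono (F.ε q) (F.pos q) Set.univ := fun p _ p' _ h => by
  rcases Int.units_eq_one_or (F.ε q) with h1 | h1
  · rw [h1, sLT_one, pos_lt_pos, h1, sLT_one]
    exact h
  · rw [h1, sLT_neg_one, pos_lt_pos, h1, sLT_neg_one]
    exact h

theorem image_pos (q : ℚ) : F.pos q '' Set.univ = {u | block u = q} := by
  ext u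
  constructor
  · rintro ⟨p, -, rfl⟩
    rfl
  · intro h
    obtain ⟨p, rfl⟩ := exists_pos_of_eq h
    exact ⟨p, trivial, rfl⟩

/-- Placeholders, which are to be given new letters. -/
def Marked (c : F.Cls) : Prop := (F.Y c.1).idx c.2 ≤ Encodable.encode c.1

/-- The letters of the summands. -/
def base (u : F.Pos) : CoprodI K := (F.Y (cp u).1).letter (cp u).2 ^ (F.ε (block u) : ℤ)

theorem exists_shift {q q' : ℚ} (h : F.rep q = F.rep q') : ∃ f : F.Pos → F.Pos,
    (∀ u, block u = q → block (f u) = q' ∧ cp (f u) = cp u) ∧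
      SMono (F.ε q * F.ε q') f {u | block u = q} ∧ f '' {u | block u = q} = {u | block u = q'} := by
  classical
  have hex : ∀ u : F.Pos, ∃ w : F.Pos, block u = q → block w = q' ∧ cp w = cp u := by
    intro u
    by_cases hu : block u = q
    · obtain ⟨w, hw⟩ := exists_of_cp (F := F) (q := q') (c := cp u) (by rw [cp_fst, hu, h])
      exact ⟨w, fun _ => hw⟩
    · exact ⟨u, fun h => absurd h hu⟩
  choose f hf using hex
  refine ⟨f, hf, ?_, ?_⟩
  · intro u hu w hw huw
    obtain ⟨p, rfl⟩ := exists_pos_of_eq hu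
    obtain ⟨p', rfl⟩ := exists_pos_of_eq hw
    obtain ⟨h1, h2⟩ := hf _ hu
    obtain ⟨h3, h4⟩ := hf _ hw
    obtain ⟨k, hk⟩ := exists_pos_of_eq h1
    obtain ⟨k', hk'⟩ := exists_pos_of_eq h3
    rw [hk] at h2 ⊢
    rw [hk'] at h4 ⊢
    rw [pos_lt_pos] at huw
    have key : ∀ {r r' : ℚ} (_ : r = r') {p p' : (F.Y r).dom} {k k' : (F.Y r').dom} (δ : ℤˣ),
        (⟨r', k⟩ : F.Cls) = ⟨r, p⟩ → (⟨r', k'⟩ : F.Cls) = ⟨r, p'⟩ → sLT δ p p' → sLT δ k k' := by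
      rintro r _ rfl p p' k k' δ e1 e2 hlt
      rwa [eq_of_heq (Sigma.mk.inj e1).2, eq_of_heq (Sigma.mk.inj e2).2]
    have hlt := key h (F.ε q) h2 h4 huw
    rw [(smono_pos q').sLT_iff trivial trivial]
    rw [mul_assoc, Int.units_mul_self, mul_one]
    exact hlt
  · ext w
    constructor
    · rintro ⟨u, hu, rfl⟩
      exact (hf u hu).1
    · intro hw
      obtain ⟨u, hu, hc⟩ := exists_of_cp (F := F) (q := q) (c := cp w) (by rw [cp_fst, hw, h])
      exact ⟨u, hu, eq_of_cp_eq ((hf u hu).1.trans (Eq.symm hw)) ((hf u hu).2.trans hc)⟩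

theorem finite_block_cls (c : F.Cls) : {u : F.Pos | cp u = c}.Finite := by
  refine Set.Finite.of_finite_image ((F.finite_rep c.1).subset ?_) (f := block) ?_
  · rintro _ ⟨u, hu, rfl⟩
    exact congrArg Sigma.fst hu
  · intro u hu w hw h
    exact eq_of_cp_eq h (Eq.trans hu (Eq.symm hw))

/-- This is the purpose of the threshold `Encodable.encode r`: letters of a given index survive
unreplaced in finitely many summands only, which makes the infinite sum a word. -/
theorem finite_cls (n : ℕ) :
    {c : F.Cls | Encodable.encode c.1 < n ∧ (F.Y c.1).idx c.2 ≤ n}.Finite := by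
  have h1 : {r : ℚ | Encodable.encode r < n}.Finite :=
    Set.Finite.preimage (f := Encodable.encode) Encodable.encode_injective.injOn
      (Set.finite_Iio n)
  refine (h1.biUnion fun r _ => (((F.Y r).truncDom n).finite_toSet.image
    fun p => (⟨r, p⟩ : F.Cls))).subset ?_
  rintro ⟨r, p⟩ ⟨h2, h3⟩
  exact Set.mem_biUnion (show r ∈ {r : ℚ | Encodable.encode r < n} from h2)
    ⟨p, (Word.mem_truncDom_iff_idx _ _ _).2 h3, rfl⟩

/-- Letters available for the placeholders. -/
structure Palette (F : Frame K) where
  ν : F.Cls → ℕ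
  ν_injective : Function.Injective ν
  lt_ν : ∀ c, Encodable.encode c.1 < ν c
  ν_ne : ∀ r (p p' : (F.Y r).dom), p ⋖ p' ∨ p' ⋖ p → ν ⟨r, p⟩ ≠ (F.Y r).idx p'
  ink : F.Cls → ℕ → CoprodI K
  ink_mem : ∀ c k, ink c k ∈ factor K (ν c)
  -- A single fresh letter cannot be cancelled by surviving letters of its factor standing on either
  -- side of it.
  generic : ∀ c k (δ : ℤˣ) (A B : Finset F.Pos),
    (∀ u ∈ A, ¬ Marked (cp u) ∧ base u ∈ factor K (ν c)) →
    (∀ u ∈ B, ¬ Marked (cp u) ∧ base u ∈ factor K (ν c)) →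
    ordProd A base * ink c k ^ (δ : ℤ) * ordProd B base ≠ 1
  ink_eq : ∀ c k k' (δ : ℤˣ), ink c k = ink c k' ^ (δ : ℤ) → k = k' ∧ δ = 1
  ink_ne : ∀ c k (u : F.Pos) (δ : ℤˣ), ¬ Marked (cp u) → ink c k ≠ base u ^ (δ : ℤ)

namespace Palette

variable (P : F.Palette) (s : F.Cls → ℕ)

theorem ink_ne_one (c : F.Cls) (k : ℕ) : P.ink c k ≠ 1 := by
  have := P.generic c k 1 ∅ ∅ (by simp) (by simp)
  simpa using this

open scoped Classical in
/-- The letters of the summands after the replacement of the placeholders. -/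
noncomputable def lab (c : F.Cls) : CoprodI K :=
  if Marked c then P.ink c (s c) else (F.Y c.1).letter c.2

theorem lab_marked {c : F.Cls} (h : Marked c) : P.lab s c = P.ink c (s c) := if_pos h

theorem lab_unmarked {c : F.Cls} (h : ¬ Marked c) : P.lab s c = (F.Y c.1).letter c.2 := if_neg h

theorem lab_ne_one (c : F.Cls) : P.lab s c ≠ 1 := by
  by_cases h : Marked c
  · rw [P.lab_marked s h]
    exact P.ink_ne_one c _
  · rw [P.lab_unmarked s h]
    exact (F.redOn c.1).letter_ne_one (not_le.1 h)

theorem lab_mem_iff {c : F.Cls} {n : ℕ} : P.lab s c ∈ factor K n ↔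
    (Marked c ∧ P.ν c = n) ∨ (¬ Marked c ∧ (F.Y c.1).idx c.2 = n) := by
  have h1 := P.lab_ne_one s c
  by_cases h : Marked c
  · rw [P.lab_marked s h] at h1 ⊢
    constructor
    · intro hn
      refine Or.inl ⟨h, ?_⟩
      by_contra hne
      exact h1 (eq_one_of_mem_factor hne (P.ink_mem c _) hn)
    · rintro (⟨-, rfl⟩ | ⟨h', -⟩)
      exacts [P.ink_mem c _, absurd h h']
  · rw [P.lab_unmarked s h] at h1 ⊢
    constructor
    · exact fun hn => Or.inr ⟨h, Word.idx_eq h1 hn⟩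
    · rintro (⟨h', -⟩ | ⟨-, rfl⟩)
      exacts [absurd h' h, Word.idx_mem _ _]

/-- The sum of the signed copies. -/
noncomputable abbrev word : Word K where
  dom := F.Pos
  letter u := P.lab s (cp u) ^ (F.ε (block u) : ℤ)
  exists_mem u := by
    simp only [zpow_unit_mem, lab_mem_iff]
    by_cases h : Marked (cp u)
    exacts [⟨_, Or.inl ⟨h, rfl⟩⟩, ⟨_, Or.inr ⟨h, rfl⟩⟩]
  finite_mem n := by
    simp only [zpow_unit_mem, lab_mem_iff]
    refine ((finite_cls n).biUnion fun c _ => finite_block_cls c).subset ?_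
    rintro u (⟨h1, rfl⟩ | ⟨h1, rfl⟩)
    · exact Set.mem_biUnion ⟨P.lt_ν _, h1.trans (P.lt_ν _).le⟩ rfl
    · exact Set.mem_biUnion ⟨not_le.1 h1, le_rfl⟩ rfl

theorem letter_word (u : F.Pos) :
    (P.word s).letter u = P.lab s (cp u) ^ (F.ε (block u) : ℤ) := rfl

theorem letter_ne_one (u : F.Pos) : (P.word s).letter u ≠ 1 := by
  rw [letter_word, ne_eq, zpow_unit_eq_one]
  exact P.lab_ne_one s _

theorem idx_marked {u : F.Pos} (h : Marked (cp u)) : (P.word s).idx u = P.ν (cp u) := by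
  refine Word.idx_eq (P.letter_ne_one s u) ?_
  rw [letter_word, zpow_unit_mem, lab_mem_iff]
  exact Or.inl ⟨h, rfl⟩

theorem letter_unmarked {u : F.Pos} (h : ¬ Marked (cp u)) : (P.word s).letter u = base u := by
  rw [letter_word, P.lab_unmarked s h]
  rfl

theorem smap_pos (q : ℚ) : Word.SMap (F.ε q) (F.Y (F.rep q)) (P.word s) (F.pos q)
    {p | Encodable.encode (F.rep q) < (F.Y (F.rep q)).idx p} :=
  ⟨fun p hp => P.letter_unmarked s (u := F.pos q p) (not_le.2 hp),
    (smono_pos q).mono (Set.subset_univ _)⟩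

theorem exists_smap_shift {q q' : ℚ} (h : F.rep q = F.rep q') : ∃ f : F.Pos → F.Pos,
    (∀ u, block u = q → block (f u) = q' ∧ cp (f u) = cp u) ∧
      Word.SMap (F.ε q * F.ε q') (P.word s) (P.word s) f {u | block u = q} ∧
      f '' {u | block u = q} = {u | block u = q'} := by
  obtain ⟨f, h1, h2, h3⟩ := exists_shift h
  refine ⟨f, h1, ⟨?_, h2⟩, h3⟩
  intro (u : F.Pos) hu
  obtain ⟨h4, h5⟩ := h1 u hu
  rw [letter_word, letter_word, h4, h5, show block u = q from hu, ← zpow_unit_mul, ← mul_assoc,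
    Int.units_mul_self, one_mul]

end Palette

end Frame

end InfWord

namespace InfWord

universe u v

variable {G : ℕ → Type u} [∀ n, Group (G n)] {K : ℕ → Type v} [∀ n, Group (K n)]

/-! ### Cancellations within a set of positions -/

namespace Word

/-- The relation `r` describes how the restriction of `W` to `A` cancels. -/
structure CancelOn (W : Word G) (A : Set W.dom) (r : W.dom → W.dom → Prop) : Prop where
  refl : ∀ a ∈ A, r a a
  symm : ∀ a b, r a b → r b a
  trans : ∀ a b c, r a b → r b c → r a c
  mem : ∀ a b, r a b → b ∈ A
  idx_eq : ∀ a b, r a b → W.idx a = W.idx b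
  noncrossing : ∀ i j k l, i < j → j < k → k < l → r i k → r j l → r i j
  cl_eq_one : ∀ t ⊆ A, (∀ i ∈ t, ∀ j, r i j → j ∈ t) → W.cl t = 1

theorem exists_cancelOn {W : Word G} {A : Set W.dom} (hA : W.cl A = 1) : ∃ r, W.CancelOn A r := by
  obtain ⟨R, hR⟩ := exists_cancellation (W.restrict A) hA
  refine ⟨fun a b => ∃ (ha : a ∈ A) (hb : b ∈ A), R (⟨a, ha⟩ : A) (⟨b, hb⟩ : A),
    ?_, ?_, ?_, ?_, ?_, ?_, ?_⟩
  · exact fun a ha => ⟨ha, ha, R.refl _⟩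
  · exact fun a b ⟨ha, hb, h⟩ => ⟨hb, ha, R.symm h⟩
  · exact fun a b c ⟨ha, _, h⟩ ⟨_, hc, h'⟩ => ⟨ha, hc, R.trans h h'⟩
  · exact fun a b ⟨_, hb, _⟩ => hb
  · exact fun a b ⟨ha, hb, h⟩ => hR.idx_eq _ _ h
  · exact fun i j k l hij hjk hkl ⟨hi, hk, h⟩ ⟨hj, hl, h'⟩ =>
      ⟨hi, hj, hR.noncrossing ⟨i, hi⟩ ⟨j, hj⟩ ⟨k, hk⟩ ⟨l, hl⟩ hij hjk hkl h h'⟩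
  · intro t ht hsat
    have h1 := hR.cl_eq_one (W.val A ⁻¹' t) fun i hi j hij => hsat _ hi _ ⟨i.2, j.2, hij⟩
    have h2 := ((W.smap_val A).mono (Set.subset_univ (W.val A ⁻¹' t))).cl_image
    rw [h1, one_zpow] at h2
    rw [← h2]
    congr 1
    ext i
    constructor
    · exact fun hi => ⟨⟨i, ht hi⟩, hi, rfl⟩
    · rintro ⟨j, hj, rfl⟩
      exact hj

namespace CancelOn

variable {W : Word G} {A : Set W.dom} {r : W.dom → W.dom → Prop}

theorem finite_class (h : W.CancelOn A r) (i : W.dom) : {j | r i j}.Finite := by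
  refine (W.finite_mem (W.idx i)).subset fun j hj => ?_
  change W.letter j ∈ factor G (W.idx i)
  rw [h.idx_eq i j hj]
  exact W.idx_mem j

theorem saturated_Icc (h : W.CancelOn A r) {i j : W.dom} (hij : r i j)
    (hb : ∀ k, r i k → i ≤ k ∧ k ≤ j) : ∀ k ∈ Set.Icc i j, ∀ l, r k l → l ∈ Set.Icc i j := by
  intro k hk l hkl
  by_cases hik : r i k
  · exact hb l (h.trans _ _ _ hik hkl)
  have hil : ¬ r i l := fun hil => hik (h.trans _ _ _ hil (h.symm _ _ hkl))
  have h1 : i < k := lt_of_le_of_ne hk.1 fun e => hil (e ▸ hkl)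
  have h2 : k < j := lt_of_le_of_ne hk.2 fun e => hik (e ▸ hij)
  by_contra hl
  rcases lt_or_ge l i with h3 | h3
  · exact hil (h.symm _ _ (h.noncrossing l i k j h3 h1 h2 (h.symm _ _ hkl) hij))
  · have h4 : j < l := not_le.1 fun h4 => hl ⟨h3, h4⟩
    exact hik (h.noncrossing i k j l h1 h2 h4 hij hkl)

theorem ordProd_class (h : W.CancelOn A r) (i : W.dom) :
    ordProd (h.finite_class i).toFinset W.letter = 1 := by
  classical
  have h1 := cl_eq_one_iff.1 (h.cl_eq_one {j | r i j} (fun j hj => h.mem i j hj)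
    fun j hj k hjk => h.trans _ _ _ hj hjk) (W.idx i)
  rw [← h1, tr]
  congr 1
  ext j
  simp only [Set.Finite.mem_toFinset, Set.mem_ofPred_eq, Finset.mem_filter, mem_truncDom_iff_idx]
  exact ⟨fun hj => ⟨(h.idx_eq i j hj).symm.le, hj⟩, fun hj => hj.2⟩

end CancelOn

end Word

namespace Frame.Palette

variable {F : Frame K} (P : F.Palette) (s : F.Cls → ℕ)

open Word

/-! ### The sum of the signed copies is reduced -/

/-- If all other members of the class of `u` were surviving letters, its trivial product would have
the form excluded by `generic`. -/
theorem exists_marked_of_cancelOn {A : Set F.Pos} {r : F.Pos → F.Pos → Prop}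
    (hr : (P.word s).CancelOn A r) {u : F.Pos} (hu : u ∈ A) (hm : Marked (cp u)) :
    ∃ w, r u w ∧ w ≠ u ∧ Marked (cp w) := by
  classical
  by_contra hcon
  push Not at hcon
  have h1 := hr.ordProd_class u
  have hmem : u ∈ (hr.finite_class u).toFinset := by
    rw [Set.Finite.mem_toFinset]
    exact hr.refl u hu
  rw [ordProd_split _ _ hmem, letter_word, P.lab_marked s hm] at h1
  have key : ∀ w ∈ (hr.finite_class u).toFinset, w ≠ u →
      ¬ Marked (cp w) ∧ (P.word s).letter w = base w ∧ base w ∈ factor K (P.ν (cp u)) := by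
    intro w hw hwu
    rw [Set.Finite.mem_toFinset] at hw
    have h2 := hcon w hw hwu
    refine ⟨h2, P.letter_unmarked s h2, ?_⟩
    rw [← P.letter_unmarked s h2, ← P.idx_marked s hm, hr.idx_eq u w hw]
    exact Word.idx_mem _ _
  rw [ordProd_congr (g := base), ordProd_congr (s := {a ∈ (hr.finite_class u).toFinset | u < a})
    (g := base)] at h1
  · refine P.generic (cp u) (s (cp u)) (F.ε (block u)) _ _ ?_ ?_ h1
    · intro w hw
      rw [Finset.mem_filter] at hw
      have := key w hw.1 hw.2.ne
      exact ⟨this.1, this.2.2⟩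
    · intro w hw
      rw [Finset.mem_filter] at hw
      have := key w hw.1 hw.2.ne'
      exact ⟨this.1, this.2.2⟩
  · intro w hw
    rw [Finset.mem_filter] at hw
    exact (key w hw.1 hw.2.ne').2.1
  · intro w hw
    rw [Finset.mem_filter] at hw
    exact (key w hw.1 hw.2.ne).2.1

theorem cp_eq_of_cancelOn {A : Set F.Pos} {r : F.Pos → F.Pos → Prop}
    (hr : (P.word s).CancelOn A r) {u w : F.Pos} (h : r u w) (hu : Marked (cp u))
    (hw : Marked (cp w)) : cp u = cp w := by
  refine P.ν_injective ?_
  rw [← P.idx_marked s hu, ← P.idx_marked s hw]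
  exact hr.idx_eq u w h

/-- A fresh letter cancels only with another copy of the same placeholder, and a block holds just
one copy. So `A` contains no placeholder and lies in the part of the summand known to be reduced. -/
theorem eq_empty_of_block {A : Set F.Pos} (hA : A.OrdConnected) (hcl : (P.word s).cl A = 1) {q : ℚ}
    (hq : ∀ u ∈ A, block u = q) : A = ∅ := by
  obtain ⟨r, hr⟩ := exists_cancelOn hcl
  have hunm : ∀ u ∈ A, ¬ Marked (cp u) := by
    intro u hu hm
    obtain ⟨w, hw, hne, hm'⟩ := P.exists_marked_of_cancelOn s hr hu hm
    exact hne (eq_of_cp_eq ((hq w (hr.mem _ _ hw)).trans (hq u hu).symm)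
      (P.cp_eq_of_cancelOn s hr hw hm hm').symm)
  have him : F.pos q '' (F.pos q ⁻¹' A) = A := by
    refine Set.image_preimage_eq_of_subset fun u hu => ?_
    obtain ⟨p, rfl⟩ := exists_pos_of_eq (hq u hu)
    exact ⟨p, rfl⟩
  have hsub : F.pos q ⁻¹' A ⊆ {p | Encodable.encode (F.rep q) < (F.Y (F.rep q)).idx p} :=
    fun p hp => not_le.1 (hunm _ hp)
  have h1 := ((P.smap_pos s q).mono hsub).cl_image
  rw [him, hcl] at h1
  have h2 : (F.pos q ⁻¹' A).OrdConnected := by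
    have := (smono_pos q).ordConnected_preimage Set.ordConnected_univ hA
    rwa [Set.univ_inter] at this
  have h3 := (F.redOn (F.rep q)).1 _ hsub h2 (zpow_unit_eq_one.1 h1.symm)
  rw [← him, h3, Set.image_empty]

theorem covBy_of_cp {u w : F.Pos} {c : ℚ} {z z' : (F.Y c).dom} (hz : z ⋖ z' ∨ z' ⋖ z)
    (hb : block w = block u) (hu : cp u = ⟨c, z⟩) (hw : cp w = ⟨c, z'⟩) : u ⋖ w ∨ w ⋖ u := by
  obtain ⟨t, ht⟩ : ∃ t, block u = t := ⟨_, rfl⟩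
  rw [ht] at hb
  obtain ⟨k, rfl⟩ := exists_pos_of_eq ht
  obtain ⟨k', rfl⟩ := exists_pos_of_eq hb
  obtain rfl : F.rep t = c := congrArg Sigma.fst hu
  obtain rfl : k = z := eq_of_heq (Sigma.mk.inj hu).2
  obtain rfl : k' = z' := eq_of_heq (Sigma.mk.inj hw).2
  have hconn : (F.pos t '' Set.univ).OrdConnected := by
    rw [image_pos]
    exact ordConnected_fiber block_mono t
  rcases hz with h | h
  · exact (smono_pos t).covBy hconn trivial trivial h
  · exact ((smono_pos t).covBy hconn trivial trivial h).symm

/-- If the restriction to a union of blocks is trivial, then two of the blocks are mutually inverse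
and the blocks between them are trivial. -/
theorem exists_cancelling_blocks {I : Set F.Pos} (hI : I.OrdConnected) {S : Set ℚ}
    (hcl : (P.word s).cl {u | u ∈ I ∧ block u ∈ S} = 1) {q : ℚ} (hq : q ∈ S)
    (hqI : ∀ u, block u = q → u ∈ I) :
    ∃ q₁ q₂, q₁ ∈ S ∧ q₂ ∈ S ∧ q₁ < q₂ ∧ F.rep q₁ = F.rep q ∧ F.rep q₂ = F.rep q ∧
      F.ε q₁ * F.ε q₂ = -1 ∧ (P.word s).cl {u | block u ∈ S ∩ Set.Ioo q₁ q₂} = 1 := by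
  classical
  obtain ⟨r, hr⟩ := exists_cancelOn hcl
  obtain ⟨c, hc⟩ : ∃ c, F.rep q = c := ⟨_, rfl⟩
  rw [hc]
  obtain ⟨x, y, hxy, hx, hy⟩ := F.pair c
  obtain ⟨u0, hu0, hu0c⟩ := exists_of_cp (F := F) (q := q) (c := ⟨c, x⟩) hc
  have : Nonempty (P.word s).dom := ⟨u0⟩
  let M : Set F.Pos := {u | (u ∈ I ∧ block u ∈ S) ∧ (cp u = ⟨c, x⟩ ∨ cp u = ⟨c, y⟩)}
  have hMm : ∀ u ∈ M, Marked (cp u) := by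
    rintro u ⟨-, h | h⟩ <;> rw [h]
    exacts [hx, hy]
  have hMfin : M.Finite := by
    refine ((finite_block_cls (⟨c, x⟩ : F.Cls)).union (finite_block_cls ⟨c, y⟩)).subset ?_
    rintro u ⟨-, h⟩
    exact h
  have hmin : ∀ u, r u u → ∃ m, r u m ∧ ∀ k, r u k → m ≤ k := fun u hu => by
    obtain ⟨m, hm, h⟩ := Set.exists_min_image {k | r u k} id (hr.finite_class u) ⟨u, hu⟩
    exact ⟨m, hm, h⟩
  have hmax : ∀ u, r u u → ∃ m, r u m ∧ ∀ k, r u k → k ≤ m := fun u hu => by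
    obtain ⟨m, hm, h⟩ := Set.exists_max_image {k | r u k} id (hr.finite_class u) ⟨u, hu⟩
    exact ⟨m, hm, h⟩
  have hrefl : ∀ u ∈ M, r u u := fun u hu => hr.refl u hu.1
  choose! lo hlo1 hlo2 using fun u (hu : u ∈ M) => hmin u (hrefl u hu)
  choose! hi hhi1 hhi2 using fun u (hu : u ∈ M) => hmax u (hrefl u hu)
  -- Among the copies of the pair `x`, `y` the one whose class has the innermost span is taken. By
  -- noncrossing, all members of `M` within that span are in its class (`hall`): another class would
  -- have a span nested inside it and missing `p`.
  obtain ⟨p, hpM, hpmin⟩ := Set.exists_min_image M (fun u => (M ∩ Set.Icc (lo u) (hi u)).ncard)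
    hMfin ⟨u0, ⟨hqI u0 hu0, hu0 ▸ hq⟩, Or.inl hu0c⟩
  have hsat := hr.saturated_Icc (i := lo p) (j := hi p)
    (hr.trans _ _ _ (hr.symm _ _ (hlo1 p hpM)) (hhi1 p hpM)) fun k hk =>
      ⟨hlo2 p hpM k (hr.trans _ _ _ (hlo1 p hpM) hk), hhi2 p hpM k (hr.trans _ _ _ (hlo1 p hpM) hk)⟩
  have hall : ∀ w ∈ M, w ∈ Set.Icc (lo p) (hi p) → r p w := by
    intro w hwM hw
    by_contra hpw
    have h1 := hsat w hw (lo w) (hlo1 w hwM)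
    have h2 := hsat w hw (hi w) (hhi1 w hwM)
    have hne : ∀ k, r w k → ¬ r p k := fun k h3 h4 => hpw (hr.trans _ _ _ h4 (hr.symm _ _ h3))
    have hp : p ∉ Set.Icc (lo w) (hi w) := by
      intro hp
      have h3 : lo w < p := lt_of_le_of_ne hp.1 fun e => hne _ (hlo1 w hwM) (e ▸ hrefl p hpM)
      have h4 : p < hi w := lt_of_le_of_ne hp.2 fun e => hne _ (hhi1 w hwM) (e ▸ hrefl p hpM)
      have h5 : lo p < lo w := lt_of_le_of_ne h1.1 fun e => hne _ (hlo1 w hwM) (e ▸ hlo1 p hpM)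
      have h6 := hr.noncrossing _ _ _ _ h5 h3 h4 (hr.symm _ _ (hlo1 p hpM))
        (hr.trans _ _ _ (hr.symm _ _ (hlo1 w hwM)) (hhi1 w hwM))
      exact hne _ (hlo1 w hwM) (hr.trans _ _ _ (hlo1 p hpM) h6)
    refine not_lt.2 (hpmin w hwM) (Set.ncard_lt_ncard ?_ (hMfin.inter_of_left _))
    refine ⟨fun k hk => ⟨hk.1, h1.1.trans hk.2.1, hk.2.2.trans h2.2⟩, fun h3 => ?_⟩
    exact hp (h3 ⟨hpM, hlo2 p hpM p (hrefl p hpM), hhi2 p hpM p (hrefl p hpM)⟩).2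
  obtain ⟨p', hp', hpp', hp'm⟩ := P.exists_marked_of_cancelOn s hr hpM.1 (hMm p hpM)
  have hcp : cp p = cp p' := P.cp_eq_of_cancelOn s hr hp' (hMm p hpM) hp'm
  have hp'V := hr.mem _ _ hp'
  obtain ⟨u₁, u₂, h12, hcu, hu₁c, hu₁V, hu₂V, hru₁, hru₂⟩ : ∃ u₁ u₂ : F.Pos, u₁ < u₂ ∧ cp u₁ = cp u₂ ∧
      cp u₁ = cp p ∧ (u₁ ∈ I ∧ block u₁ ∈ S) ∧ (u₂ ∈ I ∧ block u₂ ∈ S) ∧ r p u₁ ∧ r p u₂ := by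
    rcases lt_or_gt_of_ne hpp' with h | h
    · exact ⟨p', p, h, hcp.symm, hcp.symm, hp'V, hpM.1, hp', hrefl p hpM⟩
    · exact ⟨p, p', h, hcp, rfl, hpM.1, hp'V, hrefl p hpM, hp'⟩
  have hbne : block u₁ ≠ block u₂ := fun h => h12.ne (eq_of_cp_eq h hcu)
  have hb12 : block u₁ < block u₂ := lt_of_le_of_ne (block_mono h12.le) hbne
  have hcfst : (cp p).1 = c := by
    rcases hpM.2 with h | h <;> rw [h]
  have hrep₁ : F.rep (block u₁) = c := by rw [← cp_fst, hu₁c, hcfst]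
  have hrep₂ : F.rep (block u₂) = c := by rw [← cp_fst, ← hcu, hu₁c, hcfst]
  obtain ⟨z, z', hz, hz', hzz⟩ : ∃ z z' : (F.Y c).dom, cp p = ⟨c, z⟩ ∧
      (∀ w : F.Pos, w ∈ I → block w ∈ S → cp w = ⟨c, z'⟩ → w ∈ M) ∧ (z ⋖ z' ∨ z' ⋖ z) := by
    rcases hpM.2 with h | h
    · exact ⟨x, y, h, fun w h1 h2 h3 => ⟨⟨h1, h2⟩, Or.inr h3⟩, Or.inl hxy⟩
    · exact ⟨y, x, h, fun w h1 h2 h3 => ⟨⟨h1, h2⟩, Or.inl h3⟩, Or.inr hxy⟩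
  have hzne : z ≠ z' := by
    rcases hzz with h | h
    exacts [h.ne, h.ne']
  have hnot : ∀ w : F.Pos, w ∈ I → block w ∈ S → cp w = ⟨c, z'⟩ → lo p ≤ w → w ≤ hi p → False := by
    intro w h1 h2 h3 h4 h5
    have hwM := hz' w h1 h2 h3
    have h6 := P.cp_eq_of_cancelOn s hr (hall w hwM ⟨h4, h5⟩) (hMm p hpM) (hMm w hwM)
    rw [hz, h3] at h6
    have h7 : z = z' := eq_of_heq (Sigma.mk.inj h6).2
    exact hzne h7
  have hadj : ∀ u : F.Pos, cp u = ⟨c, z⟩ → ∃ w : F.Pos, block w = block u ∧ cp w = ⟨c, z'⟩ ∧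
      (u ⋖ w ∨ w ⋖ u) := by
    intro u hu
    have h1 : F.rep (block u) = c := by rw [← cp_fst, hu]
    obtain ⟨w, hw1, hw2⟩ := exists_of_cp (F := F) (q := block u) (c := ⟨c, z'⟩) h1
    refine ⟨w, hw1, hw2, ?_⟩
    exact covBy_of_cp hzz hw1 hu hw2
  obtain ⟨w₁, hw₁b, hw₁c, hw₁⟩ := hadj u₁ (hu₁c.trans hz)
  obtain ⟨w₂, hw₂b, hw₂c, hw₂⟩ := hadj u₂ (hcu.symm.trans (hu₁c.trans hz))
  have hlou₁ := hlo2 p hpM u₁ hru₁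
  have hhiu₂ := hhi2 p hpM u₂ hru₂
  -- The neighbours of `u₁` and `u₂` must lie outside the span, on its left and on its right. Hence
  -- the span is exactly `[u₁, u₂]` and the two blocks are oppositely oriented.
  have hw₁u₁ : w₁ ⋖ u₁ := by
    refine hw₁.resolve_left fun h => ?_
    have h1 : w₁ < u₂ := lt_of_index_lt block_mono (hw₁b.symm ▸ hb12)
    exact hnot w₁ (hI.out hu₁V.1 hu₂V.1 ⟨h.le, h1.le⟩) (hw₁b ▸ hu₁V.2) hw₁c
      (hlou₁.trans h.le) (h1.le.trans hhiu₂)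
  have hu₂w₂ : u₂ ⋖ w₂ := by
    refine hw₂.resolve_right fun h => ?_
    have h1 : u₁ < w₂ := lt_of_index_lt block_mono (hw₂b.symm ▸ hb12)
    exact hnot w₂ (hI.out hu₁V.1 hu₂V.1 ⟨h1.le, h.le⟩) (hw₂b ▸ hu₂V.2) hw₂c
      (hlou₁.trans h1.le) (h.le.trans hhiu₂)
  have hlo_eq : lo p = u₁ := by
    by_contra hne
    have h1 : lo p ≤ w₁ := by
      by_contra h2
      exact hw₁u₁.2 (not_le.1 h2) (lt_of_le_of_ne hlou₁ hne)
    exact hnot w₁ (hI.out (hr.mem _ _ (hlo1 p hpM)).1 hu₁V.1 ⟨h1, hw₁u₁.le⟩) (hw₁b ▸ hu₁V.2) hw₁c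
      h1 (hw₁u₁.le.trans (h12.le.trans hhiu₂))
  have hhi_eq : hi p = u₂ := by
    by_contra hne
    have h1 : w₂ ≤ hi p := by
      by_contra h2
      exact hu₂w₂.2 (lt_of_le_of_ne hhiu₂ (Ne.symm hne)) (not_le.1 h2)
    exact hnot w₂ (hI.out hu₂V.1 (hr.mem _ _ (hhi1 p hpM)).1 ⟨hu₂w₂.le, h1⟩) (hw₂b ▸ hu₂V.2) hw₂c
      (hlou₁.trans (h12.le.trans hu₂w₂.le)) h1
  have hsatcl : (P.word s).cl {u | (u ∈ I ∧ block u ∈ S) ∧ u₁ ≤ u ∧ u ≤ u₂} = 1 := by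
    refine hr.cl_eq_one _ (fun u hu => hu.1) fun i hi' j hij => ⟨hr.mem _ _ hij, ?_⟩
    have := hsat i (by rw [hlo_eq, hhi_eq]; exact hi'.2) j hij
    rwa [hlo_eq, hhi_eq] at this
  obtain ⟨f, hf1, hf2, hf3⟩ := P.exists_smap_shift s (hrep₁.trans hrep₂.symm)
  have hfu : f u₁ = u₂ := eq_of_cp_eq (hf1 u₁ rfl).1 ((hf1 u₁ rfl).2.trans hcu)
  have hfw : f w₁ = w₂ := eq_of_cp_eq ((hf1 w₁ hw₁b).1.trans hw₂b.symm)
    (((hf1 w₁ hw₁b).2.trans hw₁c).trans hw₂c.symm)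
  have hsign : F.ε (block u₁) * F.ε (block u₂) = -1 := by
    refine (Int.units_eq_one_or _).resolve_left fun h => ?_
    rw [h] at hf2
    have := (sLT_one _ _).1 (hf2.smono w₁ hw₁b u₁ rfl hw₁u₁.lt)
    rw [hfu, hfw] at this
    exact lt_asymm this hu₂w₂.lt
  refine ⟨block u₁, block u₂, hu₁V.2, hu₂V.2, hb12, hrep₁, hrep₂, hsign, ?_⟩
  rw [hsign] at hf2
  have him : f '' {u | block u = block u₁ ∧ u₁ ≤ u} = {u | block u = block u₂ ∧ u ≤ u₂} := by
    ext w
    constructor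
    · rintro ⟨u, ⟨hu, hle⟩, rfl⟩
      refine ⟨(hf1 u hu).1, ?_⟩
      rw [← hfu, ← not_lt, hf2.smono.lt_iff' rfl hu, not_lt]
      exact hle
    · rintro ⟨hw, hle⟩
      have : w ∈ f '' {u | block u = block u₁} := hf3 ▸ hw
      obtain ⟨u, hu, rfl⟩ := this
      refine ⟨u, ⟨hu, ?_⟩, rfl⟩
      rwa [← hfu, ← not_lt, hf2.smono.lt_iff' rfl hu, not_lt] at hle
  have hcl2 := (hf2.mono (fun u hu => hu.1 :
    {u | block u = block u₁ ∧ u₁ ≤ u} ⊆ {u | block u = block u₁})).cl_image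
  rw [him] at hcl2
  -- The trivial span is the final part of the first block, the stretch in question and the initial
  -- part of the second block. The outer parts are mutually inverse, so the stretch is trivial.
  have hdec : {u | (u ∈ I ∧ block u ∈ S) ∧ u₁ ≤ u ∧ u ≤ u₂} =
      ({u | block u = block u₁ ∧ u₁ ≤ u} ∪ {u | block u ∈ S ∩ Set.Ioo (block u₁) (block u₂)}) ∪
        {u | block u = block u₂ ∧ u ≤ u₂} := by
    ext u
    constructor
    · rintro ⟨⟨-, h2⟩, h3, h4⟩
      rcases (block_mono h3).lt_or_eq with h5 | h5
      · rcases (block_mono h4).lt_or_eq with h6 | h6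
        · exact Or.inl (Or.inr ⟨h2, h5, h6⟩)
        · exact Or.inr ⟨h6, h4⟩
      · exact Or.inl (Or.inl ⟨h5.symm, h3⟩)
    · have hin : ∀ u, u₁ ≤ u → u ≤ u₂ → u ∈ I := fun u h1 h2 => hI.out hu₁V.1 hu₂V.1 ⟨h1, h2⟩
      rintro ((⟨h1, h2⟩ | ⟨h1, h2, h3⟩) | ⟨h1, h2⟩)
      · have h3 : u ≤ u₂ := (lt_of_index_lt block_mono (h1.symm ▸ hb12)).le
        exact ⟨⟨hin u h2 h3, h1.symm ▸ hu₁V.2⟩, h2, h3⟩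
      · have h4 := (lt_of_index_lt block_mono h2).le
        have h5 := (lt_of_index_lt block_mono h3).le
        exact ⟨⟨hin u h4 h5, h1⟩, h4, h5⟩
      · have h3 : u₁ ≤ u := (lt_of_index_lt block_mono (h1.symm ▸ hb12)).le
        exact ⟨⟨hin u h3 h2, h1.symm ▸ hu₂V.2⟩, h3, h2⟩
  rw [hdec, cl_union, cl_union, hcl2] at hsatcl
  · simpa using hsatcl
  · rintro u ⟨hu, -⟩ w ⟨-, hw, -⟩
    exact lt_of_index_lt block_mono (Eq.trans_lt hu hw)
  · rintro u (⟨hu, -⟩ | ⟨-, -, hu⟩) w ⟨hw, -⟩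
    · exact lt_of_index_lt block_mono (hu.trans_lt (hb12.trans_eq hw.symm))
    · exact lt_of_index_lt block_mono (hu.trans_eq hw.symm)

end Frame.Palette

end InfWord

/-! ### Transfer of cancellations to `W` and reducedness of the sum -/

namespace InfWord

universe u v

variable {G : ℕ → Type u} [∀ n, Group (G n)] {K : ℕ → Type v} [∀ n, Group (K n)]

namespace Word

theorem cl_index_union {W : Word G} {β : W.dom → ℚ} (hβ : Monotone β) {S T : Set ℚ}
    (h : ∀ q ∈ S, ∀ r ∈ T, q < r) :
    W.cl {u | β u ∈ S ∪ T} = W.cl {u | β u ∈ S} * W.cl {u | β u ∈ T} := by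
  rw [← cl_union]
  · rfl
  · exact fun u hu w hw => lt_of_index_lt hβ (h _ hu _ hw)

theorem tr_index_union {W : Word G} {β : W.dom → ℚ} (hβ : Monotone β) {S T : Set ℚ}
    (h : ∀ q ∈ S, ∀ r ∈ T, q < r) (N : ℕ) :
    W.tr {u | β u ∈ S ∪ T} N = W.tr {u | β u ∈ S} N * W.tr {u | β u ∈ T} N := by
  rw [← tr_union]
  · rfl
  · exact fun u hu w hw => lt_of_index_lt hβ (h _ hu _ hw)

end Word

theorem decomp_of_lt {S : Set ℚ} {q₁ q₂ : ℚ} (h1 : q₁ ∈ S) (h2 : q₂ ∈ S) (h12 : q₁ < q₂) :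
    S = S ∩ Set.Iio q₁ ∪ ({q₁} ∪ (S ∩ Set.Ioo q₁ q₂ ∪ ({q₂} ∪ S ∩ Set.Ioi q₂))) := by
  ext q
  simp only [Set.mem_union, Set.mem_inter_iff, Set.mem_Iio, Set.mem_singleton_iff, Set.mem_Ioo,
    Set.mem_Ioi]
  constructor
  · intro hq
    rcases lt_trichotomy q q₁ with h | h | h
    · exact Or.inl ⟨hq, h⟩
    · exact Or.inr (Or.inl h)
    rcases lt_trichotomy q q₂ with h' | h' | h'
    · exact Or.inr (Or.inr (Or.inl ⟨hq, h, h'⟩))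
    · exact Or.inr (Or.inr (Or.inr (Or.inl h')))
    · exact Or.inr (Or.inr (Or.inr (Or.inr ⟨hq, h'⟩)))
  · rintro (h | rfl | h | rfl | h)
    exacts [h.1, h1, h.1, h2, h.1]

/-- A function which is multiplicative on ordered unions is computed from the parts. -/
theorem eq_mul_of_decomp {M : Type*} [Group M] {φ : Set ℚ → M}
    (hφ : ∀ S T : Set ℚ, (∀ q ∈ S, ∀ r ∈ T, q < r) → φ (S ∪ T) = φ S * φ T) {S : Set ℚ} {q₁ q₂ : ℚ}
    (h1 : q₁ ∈ S) (h2 : q₂ ∈ S) (h12 : q₁ < q₂) (hm : φ (S ∩ Set.Ioo q₁ q₂) = 1)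
    (hinv : φ {q₂} = (φ {q₁})⁻¹) : φ S = φ (S ∩ Set.Iio q₁ ∪ S ∩ Set.Ioi q₂) := by
  conv_lhs => rw [decomp_of_lt h1 h2 h12]
  rw [hφ, hφ, hφ, hφ, hφ, hm, hinv]
  · group
  · rintro q ⟨-, hq⟩ r ⟨-, hr⟩
    exact (Set.mem_Iio.1 hq).trans (h12.trans hr)
  · rintro q rfl r ⟨-, hr⟩
    exact hr
  · rintro q ⟨-, -, hq⟩ r (rfl | ⟨-, hr⟩)
    exacts [hq, hq.trans hr]
  · rintro q rfl r (⟨-, hr, -⟩ | rfl | ⟨-, hr⟩)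
    exacts [hr, h12, h12.trans hr]
  · rintro q ⟨-, hq⟩ r (rfl | ⟨-, hr, -⟩ | rfl | ⟨-, hr⟩)
    exacts [hq, (Set.mem_Iio.1 hq).trans hr, (Set.mem_Iio.1 hq).trans h12,
      (Set.mem_Iio.1 hq).trans (h12.trans hr)]

namespace Frame

variable {F : Frame K}

/-- The blocks of `W` are permuted by signed isomorphisms in the same way as the blocks of the
frame. -/
def Models (F : Frame K) (W : Word G) (β : W.dom → ℚ) : Prop :=
  ∀ q q', F.rep q = F.rep q' → ∃ f : W.dom → W.dom,
    Word.SMap (F.ε q * F.ε q') W W f {a | β a = q} ∧ f '' {a | β a = q} = {a | β a = q'}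

namespace Palette

variable (P : F.Palette) (s : F.Cls → ℕ)

open Word

/-- Blocks of the sum that are mutually inverse correspond to mutually inverse blocks of `W`. The
cancelling pair and the stretch between them are removed, and the induction runs over the number of
blocks in `S` visible at level `N`. It drops because the pair belongs to the class of a visible
block and is itself visible. -/
theorem tr_eq_one {W : Word G} {β : W.dom → ℚ} (hβ : Monotone β) (hW : F.Models W β) (N : ℕ) :
    ∀ (k : ℕ) (S : Set ℚ), {q | q ∈ S ∧ ∃ a, β a = q ∧ a ∈ W.truncDom N}.ncard = k →
      (P.word s).cl {u | block u ∈ S} = 1 → W.tr {a | β a ∈ S} N = 1 := by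
  intro k
  induction k using Nat.strong_induction_on with
  | _ k ih =>
    intro S hk hcl
    have hfin : ∀ S : Set ℚ, {q | q ∈ S ∧ ∃ a, β a = q ∧ a ∈ W.truncDom N}.Finite := by
      intro S
      refine ((W.truncDom N).finite_toSet.image β).subset ?_
      rintro _ ⟨-, a, rfl, ha⟩
      exact ⟨a, ha, rfl⟩
    by_cases hex : ∃ q ∈ S, ∃ a, β a = q ∧ a ∈ W.truncDom N
    swap
    · exact W.tr_eq_one_of_forall fun a ha haN => hex ⟨β a, ha, a, rfl, haN⟩
    obtain ⟨q, hq, a, rfl, haN⟩ := hex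
    obtain ⟨q₁, q₂, h1, h2, h12, hr1, hr2, hsign, hmid⟩ := P.exists_cancelling_blocks s
      Set.ordConnected_univ (S := S) (by simpa using hcl) hq fun _ _ => trivial
    have hrel : ∃ b, β b = q₁ ∧ b ∈ W.truncDom N := by
      obtain ⟨f, hf, hfi⟩ := hW (β a) q₁ hr1.symm
      have : f a ∈ f '' {b | β b = β a} := ⟨a, rfl, rfl⟩
      rw [hfi] at this
      exact ⟨f a, this, (hf.mem_truncDom rfl N).2 haN⟩
    have hless : ∀ S' ⊆ S, q₁ ∉ S' →
        {q | q ∈ S' ∧ ∃ a, β a = q ∧ a ∈ W.truncDom N}.ncard < k := by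
      intro S' hS' hq₁
      rw [← hk]
      refine Set.ncard_lt_ncard ⟨fun q hq => ⟨hS' hq.1, hq.2⟩, fun h => ?_⟩ (hfin S)
      exact hq₁ (h ⟨h1, hrel⟩).1
    have htrmid := ih _ (hless _ Set.inter_subset_left fun h => lt_irrefl _ h.2.1) _ rfl hmid
    have hout : q₁ ∉ S ∩ Set.Iio q₁ ∪ S ∩ Set.Ioi q₂ := by
      rintro (⟨-, h⟩ | ⟨-, h⟩)
      exacts [lt_irrefl q₁ h, lt_asymm h12 h]
    have hclout : (P.word s).cl {u | block u ∈ S ∩ Set.Iio q₁ ∪ S ∩ Set.Ioi q₂} = 1 := by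
      rw [← hcl]
      refine (eq_mul_of_decomp (φ := fun S => (P.word s).cl {u | block u ∈ S})
        (fun S T h => cl_index_union block_mono h) h1 h2 h12 hmid ?_).symm
      obtain ⟨f, -, hf, hfi⟩ := P.exists_smap_shift s (hr1.trans hr2.symm)
      have := hf.cl_image
      rw [hfi, hsign] at this
      simpa using this
    have htrout := ih _ (hless _ (Set.union_subset Set.inter_subset_left Set.inter_subset_left)
      hout) _ rfl hclout
    rw [← htrout]
    refine eq_mul_of_decomp (φ := fun S => W.tr {u | β u ∈ S} N)
      (fun S T h => tr_index_union hβ h N) h1 h2 h12 htrmid ?_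
    obtain ⟨f, hf, hfi⟩ := hW q₁ q₂ (hr1.trans hr2.symm)
    have := hf.tr_image N
    rw [hfi, hsign] at this
    simpa using this

theorem exists_block_pos (F : Frame K) (q : ℚ) : ∃ u : F.Pos, block u = q := by
  obtain ⟨x, -⟩ := F.pair (F.rep q)
  exact ⟨F.pos q x, rfl⟩

/-- A trivial interval meeting two blocks contains a full block, hence a trivial stretch between two
inverse blocks; the corresponding interval of `W` is nonempty by density of `ℚ` and trivial by
`tr_eq_one`. Neighbouring letters share a block, again by density, and the choice of `ν` separates
their factors whenever a placeholder is involved. -/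
theorem isReduced_word {W : Word G} (hred : W.IsReduced) {β : W.dom → ℚ} (hβ : Monotone β)
    (hne : ∀ q, ∃ a, β a = q) (hW : F.Models W β) : (P.word s).IsReduced := by
  refine isReduced_iff.2 ⟨fun A hA hcl => ?_, fun i j hij n hn => ?_⟩
  · by_contra hAne
    obtain ⟨u, hu⟩ := Set.nonempty_iff_ne_empty.2 hAne
    by_cases hone : ∀ w ∈ A, block w = block u
    · exact hAne (P.eq_empty_of_block s hA hcl hone)
    push Not at hone
    obtain ⟨w, hw, hwu⟩ := hone
    obtain ⟨a, b, ha, hb, hab⟩ : ∃ a b : F.Pos, a ∈ A ∧ b ∈ A ∧ block a < block b := by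
      rcases lt_or_gt_of_ne hwu with h | h
      exacts [⟨w, u, hw, hu, h⟩, ⟨u, w, hu, hw, h⟩]
    obtain ⟨q, h1, h2⟩ := exists_between hab
    obtain ⟨q₁, q₂, -, -, h12, -, -, -, hmid⟩ := P.exists_cancelling_blocks s hA (S := Set.univ)
      (by simpa using hcl) (q := q) trivial (by
        rintro z rfl
        exact hA.out ha hb ⟨(lt_of_index_lt block_mono h1).le, (lt_of_index_lt block_mono h2).le⟩)
    have h3 : W.cl {a | β a ∈ Set.univ ∩ Set.Ioo q₁ q₂} = 1 :=
      cl_eq_one_iff.2 fun N => P.tr_eq_one s hβ hW N _ _ rfl hmid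
    have hconn : ({a | β a ∈ Set.univ ∩ Set.Ioo q₁ q₂} : Set W.dom).OrdConnected :=
      Set.ordConnected_def.2 fun x hx y hy z hz =>
        ⟨trivial, hx.2.1.trans_le (hβ hz.1), (hβ hz.2).trans_lt hy.2.2⟩
    have h4 := hred.eq_empty hconn h3
    obtain ⟨q', hq'1, hq'2⟩ := exists_between h12
    obtain ⟨c, rfl⟩ := hne q'
    have h5 : c ∈ {a | β a ∈ Set.univ ∩ Set.Ioo q₁ q₂} := ⟨trivial, hq'1, hq'2⟩
    rw [h4] at h5
    exact h5
  · have hb : block j = block i := by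
      by_contra hne'
      have hlt := lt_of_le_of_ne (block_mono hij.le) (Ne.symm hne')
      obtain ⟨q, h1, h2⟩ := exists_between hlt
      obtain ⟨u, rfl⟩ := exists_block_pos F q
      exact hij.2 (lt_of_index_lt block_mono h1) (lt_of_index_lt block_mono h2)
    obtain ⟨t, ht⟩ : ∃ t, block i = t := ⟨_, rfl⟩
    rw [ht] at hb
    obtain ⟨p, rfl⟩ := exists_pos_of_eq ht
    obtain ⟨p', rfl⟩ := exists_pos_of_eq hb
    have hcov : p ⋖ p' ∨ p' ⋖ p := by
      have hinv := (smono_pos (F := F) t).injOn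
      rcases lt_trichotomy p p' with h | h | h
      · refine Or.inl ⟨h, fun k h1 h2 => ?_⟩
        have h3 := smono_pos t p trivial k trivial h1
        have h4 := smono_pos t k trivial p' trivial h2
        rcases Int.units_eq_one_or (F.ε t) with h5 | h5 <;> rw [h5] at h3 h4
        · exact hij.2 ((sLT_one _ _).1 h3) ((sLT_one _ _).1 h4)
        · exact lt_asymm hij.1 (((sLT_neg_one _ _).1 h4).trans ((sLT_neg_one _ _).1 h3))
      · exact absurd hij.1 (h ▸ lt_irrefl _)
      · refine Or.inr ⟨h, fun k h1 h2 => ?_⟩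
        have h3 := smono_pos t p' trivial k trivial h1
        have h4 := smono_pos t k trivial p trivial h2
        rcases Int.units_eq_one_or (F.ε t) with h5 | h5 <;> rw [h5] at h3 h4
        · exact lt_asymm hij.1 (((sLT_one _ _).1 h3).trans ((sLT_one _ _).1 h4))
        · exact hij.2 ((sLT_neg_one _ _).1 h4) ((sLT_neg_one _ _).1 h3)
    obtain ⟨hn1, hn2⟩ := hn
    rw [letter_word, zpow_unit_mem, lab_mem_iff] at hn1 hn2
    rcases hn1 with ⟨hm1, hn1⟩ | ⟨hm1, hn1⟩ <;> rcases hn2 with ⟨hm2, hn2⟩ | ⟨hm2, hn2⟩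
    · exact hij.ne (eq_of_cp_eq rfl (P.ν_injective (hn1.trans hn2.symm)))
    · exact P.ν_ne _ p p' hcov (hn1.trans hn2.symm)
    · exact P.ν_ne _ p' p hcov.symm (hn2.trans hn1.symm)
    · have hR := F.redOn (F.rep t)
      have h3 := Word.idx_mem (F.Y (F.rep t)) p
      have h4 := Word.idx_mem (F.Y (F.rep t)) p'
      have h5 : (F.Y (F.rep t)).idx p = (F.Y (F.rep t)).idx p' := hn1.trans hn2.symm
      rcases hcov with h | h
      · exact hR.2 p (not_le.1 hm1) p' (not_le.1 hm2) h _ ⟨h3, h5 ▸ h4⟩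
      · exact hR.2 p' (not_le.1 hm2) p (not_le.1 hm1) h _ ⟨h5 ▸ h4, h3⟩

end Palette

end Frame

end InfWord

namespace InfWord

universe u v

variable {K : ℕ → Type v} [∀ n, Group (K n)]

/-! ### Letters for the placeholders -/

theorem Word.countable_dom (W : Word K) : Countable W.dom := by
  have : (Set.univ : Set W.dom) = ⋃ n, {i | W.letter i ∈ factor K n} := by
    ext i
    simpa using W.exists_mem i
  rw [← Set.countable_univ_iff, this]
  exact Set.countable_iUnion fun n => (W.finite_mem n).countable

namespace Frame

variable (F : Frame K)

theorem exists_index_function : ∃ ν : F.Cls → ℕ, Function.Injective ν ∧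
    (∀ c, Encodable.encode c.1 < ν c) ∧
    ∀ r (p p' : (F.Y r).dom), p ⋖ p' ∨ p' ⋖ p → ν ⟨r, p⟩ ≠ (F.Y r).idx p' := by
  have : ∀ r, Countable (F.Y r).dom := fun r => (F.Y r).countable_dom
  have : Countable F.Cls := inferInstanceAs (Countable (Σ r : ℚ, (F.Y r).dom))
  obtain ⟨enc, henc⟩ := exists_injective_nat F.Cls
  have hadj : ∀ (r : ℚ) (p : (F.Y r).dom), {p' | p ⋖ p' ∨ p' ⋖ p}.Finite := by
    intro r p
    have h1 : {p' | p ⋖ p'}.Subsingleton := fun a ha b hb => CovBy.unique_right ha hb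
    have h2 : {p' | p' ⋖ p}.Subsingleton := fun a ha b hb => CovBy.unique_left ha hb
    exact h1.finite.union h2.finite
  -- The first component of the pairing secures injectivity; the second is free to avoid small
  -- values and the indices of the at most two neighbours.
  have hex : ∀ c : F.Cls, ∃ k : ℕ, Encodable.encode c.1 < Nat.pair (enc c) k ∧
      ∀ p', c.2 ⋖ p' ∨ p' ⋖ c.2 → Nat.pair (enc c) k ≠ (F.Y c.1).idx p' := by
    intro c
    have hinj : Function.Injective fun k => Nat.pair (enc c) k := fun k k' h =>
      (Nat.pair_eq_pair.1 h).2
    obtain ⟨_, ⟨k, rfl⟩, hk⟩ := (Set.infinite_range_of_injective hinj).exists_notMem_finite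
      ((Set.finite_Iic (Encodable.encode c.1)).union ((hadj c.1 c.2).image (F.Y c.1).idx))
    refine ⟨k, not_le.1 fun h => hk (Or.inl h), fun p' hp' h => hk (Or.inr ⟨p', hp', h.symm⟩)⟩
  choose k hk1 hk2 using hex
  exact ⟨fun c => Nat.pair (enc c) (k c), fun c c' h => henc (Nat.pair_eq_pair.1 h).1, hk1,
    fun r p p' h => hk2 ⟨r, p⟩ p' h⟩

theorem finite_unmarked (n : ℕ) :
    {u : F.Pos | ¬ Marked (cp u) ∧ base u ∈ factor K n}.Finite := by
  refine ((finite_cls n).biUnion fun c _ => finite_block_cls c).subset ?_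
  rintro u ⟨h1, h2⟩
  rw [base, zpow_unit_mem] at h2
  have h3 := Word.idx_eq ((F.redOn (cp u).1).letter_ne_one (not_le.1 h1)) h2
  exact Set.mem_biUnion ⟨(not_le.1 h1).trans_eq h3, h3.le⟩ rfl

/-- Only finitely many surviving letters lie in the factor `ν c`, so only finitely many values are
forbidden, while an element of infinite order has infinitely many powers. Positive exponents ensure
that no two chosen letters are mutually inverse. -/
theorem exists_palette (hK : ∀ n, ∃ k : K n, ¬ IsOfFinOrder k) : Nonempty F.Palette := by
  obtain ⟨ν, h1, h2, h3⟩ := F.exists_index_function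
  have hex : ∀ c : F.Cls, ∃ ink : ℕ → CoprodI K, (∀ k, ink k ∈ factor K (ν c)) ∧
      (∀ k (δ : ℤˣ) (A B : Finset F.Pos),
        (∀ u ∈ A, ¬ Marked (cp u) ∧ base u ∈ factor K (ν c)) →
        (∀ u ∈ B, ¬ Marked (cp u) ∧ base u ∈ factor K (ν c)) →
        ordProd A base * ink k ^ (δ : ℤ) * ordProd B base ≠ 1) ∧
      (∀ k k' (δ : ℤˣ), ink k = ink k' ^ (δ : ℤ) → k = k' ∧ δ = 1) ∧
      ∀ k (u : F.Pos) (δ : ℤˣ), ¬ Marked (cp u) → ink k ≠ base u ^ (δ : ℤ) := by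
    intro c
    obtain ⟨h, hh⟩ := hK (ν c)
    have hinj : Function.Injective fun m : ℕ => (CoprodI.of h : CoprodI K) ^ m := by
      intro m m' hm
      simp only [← map_pow] at hm
      exact injective_pow_iff_not_isOfFinOrder.2 hh (CoprodI.of_injective _ hm)
    have hmem : ∀ m : ℕ, (CoprodI.of h : CoprodI K) ^ m ∈ factor K (ν c) := fun m =>
      pow_mem (⟨h, rfl⟩ : CoprodI.of h ∈ factor K (ν c)) m
    have hD := F.finite_unmarked (ν c)
    let D : Finset F.Pos := hD.toFinset
    let forb : ℤˣ → Set (CoprodI K) := fun δ =>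
      (fun A : Finset F.Pos × Finset F.Pos =>
        ((ordProd A.1 base)⁻¹ * (ordProd A.2 base)⁻¹) ^ (δ : ℤ)) ''
        (D.powerset ×ˢ D.powerset : Finset (Finset F.Pos × Finset F.Pos)) ∪
      (fun u : F.Pos => base u ^ (δ : ℤ)) '' D
    have hforb : (forb 1 ∪ forb (-1)).Finite := by
      refine Set.Finite.union ?_ ?_ <;>
      exact ((Finset.finite_toSet _).image _).union ((Finset.finite_toSet _).image _)
    have hforb' : ∀ δ, forb δ ⊆ forb 1 ∪ forb (-1) := by
      intro δ
      rcases Int.units_eq_one_or δ with rfl | rfl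
      exacts [Set.subset_union_left, Set.subset_union_right]
    have hE : ({m : ℕ | m = 0 ∨ (CoprodI.of h : CoprodI K) ^ m ∈ forb 1 ∪ forb (-1)}ᶜ).Infinite := by
      refine Set.Finite.infinite_compl ?_
      exact (Set.finite_singleton 0).union (hforb.preimage hinj.injOn)
    let e := hE.natEmbedding
    have he : ∀ k, ((e k : ℕ) ≠ 0) ∧ (CoprodI.of h : CoprodI K) ^ (e k : ℕ) ∉ forb 1 ∪ forb (-1) :=
      fun k => ⟨fun h' => (e k).2 (Or.inl h'), fun h' => (e k).2 (Or.inr h')⟩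
    refine ⟨fun k => CoprodI.of h ^ (e k : ℕ), fun k => hmem _, ?_, ?_, ?_⟩
    · intro k δ A B hA hB heq
      refine (he k).2 (hforb' δ (Or.inl ⟨(A, B), ?_, ?_⟩))
      · rw [Finset.mem_coe, Finset.mem_product, Finset.mem_powerset, Finset.mem_powerset]
        exact ⟨fun u hu => hD.mem_toFinset.2 (hA u hu), fun u hu => hD.mem_toFinset.2 (hB u hu)⟩
      · have h4 : (CoprodI.of h ^ (e k : ℕ)) ^ (δ : ℤ) =
            (ordProd A base)⁻¹ * (ordProd B base)⁻¹ := by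
          rw [eq_inv_mul_iff_mul_eq, eq_inv_iff_mul_eq_one]
          exact heq
        change ((ordProd A base)⁻¹ * (ordProd B base)⁻¹) ^ (δ : ℤ) = _
        rw [← h4, zpow_unit_self]
    · intro k k' δ hk
      rcases Int.units_eq_one_or δ with rfl | rfl
      · simp only [Units.val_one, zpow_one] at hk
        exact ⟨e.injective (Subtype.ext (hinj hk)), rfl⟩
      · exfalso
        simp only [Units.val_neg, Units.val_one, zpow_neg, zpow_one] at hk
        rw [eq_inv_iff_mul_eq_one, ← pow_add] at hk
        have h5 : (e k : ℕ) + e k' = 0 := hinj (hk.trans (pow_zero _).symm)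
        exact (he k).1 (Nat.eq_zero_of_add_eq_zero_right h5)
    · intro k u δ hu hk
      refine (he k).2 (hforb' δ (Or.inr ⟨u, ?_, hk.symm⟩))
      rw [Finset.mem_coe, hD.mem_toFinset]
      refine ⟨hu, ?_⟩
      rw [← zpow_unit_mem (δ := δ), ← hk]
      exact hmem _
  choose ink h4 h5 h6 h7 using hex
  exact ⟨⟨ν, h1, h2, h3, ink, h4, h5, h6, h7⟩⟩

end Frame

end InfWord

namespace InfWord

universe u v

variable {K : ℕ → Type v} [∀ n, Group (K n)]

/-! ### The blocks of the sum are intrinsic -/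

/-- An encoding of the first `m` digits of a binary sequence. -/
def prefixCode (τ : ℕ → Bool) (m : ℕ) : ℕ := Encodable.encode ((List.range m).map τ)

theorem eq_of_prefixCode_eq {τ τ' : ℕ → Bool} {m : ℕ} (h : prefixCode τ m = prefixCode τ' m) {i : ℕ}
    (hi : i < m) : τ i = τ' i :=
  List.map_inj_left.1 (Encodable.encode_injective h) i (List.mem_range.2 hi)

theorem exists_pair_not_injective {X : Type*} (hX : Cardinal.mk X < Cardinal.continuum)
    (g : (ℕ → Bool) → X × ℕ × ℕ) : ∃ τ τ', τ ≠ τ' ∧ g τ = g τ' := by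
  by_contra hcon
  push Not at hcon
  have hinj : Function.Injective g := fun τ τ' h => by
    by_contra hne
    exact hcon τ τ' hne h
  have h1 := Cardinal.lift_mk_le_lift_mk_of_injective hinj
  have h2 : Cardinal.mk (X × ℕ × ℕ) < Cardinal.continuum := by
    rw [Cardinal.mk_prod, Cardinal.lift_id']
    refine Cardinal.mul_lt_of_lt Cardinal.aleph0_le_continuum (by simpa using hX) ?_
    simpa using Cardinal.aleph0_lt_continuum
  refine not_le.2 h2 ?_
  simpa using h1

namespace Frame

variable {F : Frame K}

theorem exists_mark (F : Frame K) : ∃ m : ℚ → F.Pos, ∀ q, block (m q) = q ∧ Marked (cp (m q)) ∧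
    ∀ q', F.rep q = F.rep q' → cp (m q) = cp (m q') := by
  choose x y hxy hx hy using F.pair
  refine ⟨fun q => F.pos q (x (F.rep q)), fun q => ⟨rfl, hx _, fun q' h => ?_⟩⟩
  change (⟨F.rep q, x (F.rep q)⟩ : F.Cls) = ⟨F.rep q', x (F.rep q')⟩
  rw [h]

/-- Classes of blocks are finite, so an infinite set of blocks has representatives of arbitrarily
large code. -/
theorem infinite_rep {a b : ℚ} (hab : a < b) (i : ℕ) :
    ∃ q, a < q ∧ q < b ∧ i < Encodable.encode (F.rep q) := by
  by_contra hcon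
  push Not at hcon
  refine Set.Ioo_infinite hab (Set.Finite.subset (s := ⋃ r ∈ {r : ℚ | Encodable.encode r ≤ i},
    {q | F.rep q = r}) (Set.Finite.biUnion ?_ fun r _ => F.finite_rep r) ?_)
  · exact Set.Finite.preimage (f := Encodable.encode) Encodable.encode_injective.injOn
      (Set.finite_Iic i)
  · intro q hq
    exact Set.mem_biUnion (show F.rep q ∈ {r : ℚ | Encodable.encode r ≤ i} from
      hcon q hq.1 hq.2) rfl

namespace Palette

variable (P : F.Palette)

/-- A fresh letter reveals, even up to inversion, its placeholder, the choice made for it and the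
orientation. Allowing two choices `s`, `s'` is what the comparison of binary sequences needs. -/
theorem eq_of_letter_eq {s s' : F.Cls → ℕ} {u w : F.Pos} {δ : ℤˣ} (hu : Marked (cp u))
    (h : (P.word s').letter w = (P.word s).letter u ^ (δ : ℤ)) :
    cp w = cp u ∧ s (cp u) = s' (cp u) ∧ F.ε (block w) = F.ε (block u) * δ := by
  have h1 : (P.word s).letter u = P.ink (cp u) (s (cp u)) ^ (F.ε (block u) : ℤ) := by
    rw [letter_word, P.lab_marked s hu]
  rw [h1, ← zpow_unit_mul] at h
  have hw : Marked (cp w) := by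
    by_contra hw
    rw [P.letter_unmarked s' hw] at h
    refine P.ink_ne (cp u) (s (cp u)) w (F.ε (block u) * δ) hw ?_
    rw [h, zpow_unit_self]
  have hcp : cp w = cp u := by
    refine P.ν_injective ?_
    have h2 : P.lab s' (cp w) ∈ factor K (P.ν (cp u)) := by
      rw [letter_word] at h
      rw [← zpow_unit_mem (δ := F.ε (block w)), h, zpow_unit_mem]
      exact P.ink_mem _ _
    rw [lab_mem_iff] at h2
    rcases h2 with h2 | h2
    exacts [h2.2, absurd hw h2.1]
  rw [letter_word, P.lab_marked s' hw, hcp] at h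
  have h3 : P.ink (cp u) (s' (cp u)) =
      P.ink (cp u) (s (cp u)) ^ ((F.ε (block u) * δ * F.ε (block w) : ℤˣ) : ℤ) := by
    rw [zpow_unit_mul _ (F.ε (block u) * δ), ← h, zpow_unit_self]
  obtain ⟨h4, h5⟩ := P.ink_eq _ _ _ _ h3
  refine ⟨hcp, h4.symm, ?_⟩
  rcases Int.units_eq_one_or (F.ε (block u)) with h6 | h6 <;>
  rcases Int.units_eq_one_or (F.ε (block w)) with h7 | h7 <;>
  rcases Int.units_eq_one_or δ with h8 | h8 <;> rw [h6, h7, h8] at h5 ⊢ <;> revert h5 <;> decide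

/-- Otherwise two marked positions of different blocks are sent into one block. Their letters
identify the placeholders, which forces equal representatives and then equal images, against
injectivity. -/
theorem index_eq_of_smap (s : F.Cls → ℕ) {δ : ℤˣ} {f : F.Pos → F.Pos} {A : Set F.Pos}
    (hA : A.OrdConnected) (hf : Word.SMap δ (P.word s) (P.word s) f A)
    (hone : ∀ a ∈ A, ∀ b ∈ A, block (f a) = block (f b)) {a b : F.Pos} (ha : a ∈ A) (hb : b ∈ A) :
    block a = block b := by
  wlog hab : block a < block b generalizing a b
  · rcases (not_lt.1 hab).lt_or_eq with h1 | h1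
    · exact (this hb ha h1).symm
    · exact h1.symm
  exfalso
  obtain ⟨m, hm⟩ := F.exists_mark
  obtain ⟨q, h1, h2⟩ := exists_between hab
  obtain ⟨q', h3, h4⟩ := exists_between h2
  have hin : ∀ t, block a < t → t < block b → m t ∈ A := fun t h5 h6 =>
    hA.out ha hb ⟨(lt_of_index_lt block_mono (by rwa [(hm t).1])).le,
      (lt_of_index_lt block_mono (by rwa [(hm t).1])).le⟩
  have hq := hin q h1 h2
  have hq' := hin q' (h1.trans h3) h4
  have h5 := (P.eq_of_letter_eq (hm q).2.1 (hf.letter _ hq)).1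
  have h6 := (P.eq_of_letter_eq (hm q').2.1 (hf.letter _ hq')).1
  have h7 := hone _ hq _ hq'
  have h8 : F.rep q = F.rep q' := by
    rw [← (hm q).1, ← (hm q').1, ← cp_fst, ← cp_fst, ← h5, ← h6, cp_fst, cp_fst, h7]
  have h9 : f (m q) = f (m q') := eq_of_cp_eq h7 ((h5.trans ((hm q).2.2 q' h8)).trans h6.symm)
  have h10 := hf.smono.injOn hq hq' h9
  rw [← (hm q).1, ← (hm q').1, h10] at h3
  exact lt_irrefl _ h3

/-- A binary sequence `τ` fills the placeholders of the summand `r` according to its first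
`Encodable.encode r` digits. If every `τ` failed, two sequences would share `x` and the images of
two endpoints in different blocks, hence the interval of `𝒲 x` between these images. A block inside
with a sufficiently long prefix then shows that the sequences agree at any given digit. -/
theorem exists_intrinsicBlocks {X : Type*} (hX : Cardinal.mk X < Cardinal.continuum)
    (𝒲 : X → Word K) : ∃ s, Sys.IntrinsicBlocks (P.word s) 𝒲 block := by
  let s : (ℕ → Bool) → F.Cls → ℕ := fun τ c => prefixCode τ (Encodable.encode c.1)
  suffices h : ∃ τ, ∀ (x : X) (δ : ℤˣ) (f : F.Pos → (𝒲 x).dom) (A : Set F.Pos), A.OrdConnected →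
      Word.SMap δ (P.word (s τ)) (𝒲 x) f A → (f '' A).OrdConnected →
      ∀ a ∈ A, ∀ b ∈ A, ¬ block a < block b by
    obtain ⟨τ, hτ⟩ := h
    refine ⟨s τ, fun δ f A hA hf _ hone a ha b hb => P.index_eq_of_smap _ hA hf hone ha hb,
      fun x δ f A hA hf hfA a ha b hb => ?_⟩
    exact le_antisymm (not_lt.1 (hτ x δ f A hA hf hfA b hb a ha))
      (not_lt.1 (hτ x δ f A hA hf hfA a ha b hb))
  by_contra hcon
  push Not at hcon
  have hcount : ∀ x, ∃ g : (𝒲 x).dom → ℕ, Function.Injective g := fun x => by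
    have := (𝒲 x).countable_dom
    exact exists_injective_nat _
  choose enc henc using hcount
  have hex : ∀ τ, ∃ ρ : X × ℕ × ℕ, ∃ (δ : ℤˣ) (f : F.Pos → (𝒲 ρ.1).dom) (A : Set F.Pos),
      A.OrdConnected ∧ Word.SMap δ (P.word (s τ)) (𝒲 ρ.1) f A ∧ (f '' A).OrdConnected ∧
      ∃ a ∈ A, ∃ b ∈ A, block a < block b ∧ enc ρ.1 (f a) = ρ.2.1 ∧ enc ρ.1 (f b) = ρ.2.2 := by
    intro τ
    obtain ⟨x, δ, f, A, h1, h2, h3, a, ha, b, hb, hab⟩ := hcon τ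
    exact ⟨(x, enc x (f a), enc x (f b)), δ, f, A, h1, h2, h3, a, ha, b, hb, hab, rfl, rfl⟩
  choose g hg using hex
  obtain ⟨τ, τ', hne, hgτ⟩ := exists_pair_not_injective hX g
  have h1 := hg τ
  have h2 := hg τ'
  rw [← hgτ] at h2
  obtain ⟨δ, f, A, hA, hf, hfA, a, ha, b, hb, hab, hea, heb⟩ := h1
  obtain ⟨δ', f', A', hA', hf', hfA', a', ha', b', hb', hab', hea', heb'⟩ := h2
  have hfa : f a = f' a' := henc _ (hea.trans hea'.symm)
  have hfb : f b = f' b' := henc _ (heb.trans heb'.symm)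
  obtain ⟨i, hi⟩ := Function.ne_iff.1 hne
  obtain ⟨q, hq1, hq2, hqi⟩ := infinite_rep (F := F) hab i
  obtain ⟨m, hm⟩ := F.exists_mark
  have h1 : a < m q := lt_of_index_lt block_mono (by rwa [(hm q).1])
  have h2 : m q < b := lt_of_index_lt block_mono (by rwa [(hm q).1])
  have hmq : m q ∈ A := hA.out ha hb ⟨h1.le, h2.le⟩
  have h3 := hf.smono a ha _ hmq h1
  have h4 := hf.smono _ hmq b hb h2
  have himg : f (m q) ∈ f' '' A' := by
    rw [hfa] at h3
    rw [hfb] at h4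
    rcases Int.units_eq_one_or δ with rfl | rfl
    · exact hfA'.out ⟨a', ha', rfl⟩ ⟨b', hb', rfl⟩
        ⟨((sLT_one _ _).1 h3).le, ((sLT_one _ _).1 h4).le⟩
    · exact hfA'.out ⟨b', hb', rfl⟩ ⟨a', ha', rfl⟩
        ⟨((sLT_neg_one _ _).1 h4).le, ((sLT_neg_one _ _).1 h3).le⟩
  obtain ⟨w, hw, hwq⟩ := himg
  have h5 := hf'.letter w hw
  rw [hwq, hf.letter _ hmq] at h5
  have h6 : (P.word (s τ')).letter w = (P.word (s τ)).letter (m q) ^ ((δ * δ' : ℤˣ) : ℤ) := by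
    rw [zpow_unit_mul, h5, zpow_unit_self]
  have h7 := (P.eq_of_letter_eq (hm q).2.1 h6).2.1
  refine hi (eq_of_prefixCode_eq h7 ?_)
  rwa [cp_fst, (hm q).1]

end Palette

end Frame

end InfWord

namespace InfWord

universe u v

variable {G : ℕ → Type u} [∀ n, Group (G n)] {K : ℕ → Type v} [∀ n, Group (K n)]

/-! ### The extension of a coherent family -/

namespace Sys

variable {X : Type*}

/-- The sum of the words that replace the blocks, with the induced relation. -/
structure Replacement (𝒯 : X → Sys G K) (W : Word G) (β : W.dom → ℚ) where
  F : Frame K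
  r : ∀ q, W.dom → (F.Y q).dom → Prop
  isBlock : ∀ q, IsBlock 𝒯 (Encodable.encode q) ⟨W, F.Y q, r q⟩ {a | β a = q}
  e : ℚ → W.dom → W.dom
  smap : ∀ q, Word.SMap (F.ε q) W W (e q) {a | β a = q}
  image : ∀ q, e q '' {a | β a = q} = {a | β a = F.rep q}
  sign : ∀ (q q' : ℚ) (δ : ℤˣ) (f : W.dom → W.dom), Word.SMap δ W W f {a | β a = q} →
    f '' {a | β a = q} = {a | β a = q'} → F.rep q = F.rep q' ∧ F.ε q = δ * F.ε q'

theorem exists_replacement (hG : ∀ n (g : G n), orderOf g ≠ 2) {𝒯 : X → Sys G K}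
    (h𝒯 : ∀ x, CoiRel (𝒯 x).rel) (hT : ∀ x, (𝒯 x).W.IsReduced) (hU : ∀ x, (𝒯 x).U.IsReduced)
    {W : Word G} (hW : W.IsReduced) {β : W.dom → ℚ} (hβ : Monotone β) (hne : ∀ q, ∃ a, β a = q)
    (hmem : ∀ q, W.cl {a | β a = q} ∈ Fine fun x => (𝒯 x).W) :
    Nonempty (Replacement 𝒯 W β) := by
  obtain ⟨rep, ε, e, h1, h2, h3⟩ := Word.exists_representatives hG hW hβ hne
  choose Y r hr using fun q => exists_isBlock h𝒯 hT hU (Encodable.encode q) hW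
    (ordConnected_fiber hβ q) (hmem q)
  exact ⟨⟨⟨Y, rep, ε, h3, fun q => (hr q).redOn, fun q => (hr q).pair (hne q)⟩, r, hr, e,
    fun q => (h1 q).1, fun q => (h1 q).2, h2⟩⟩

namespace Replacement

open InfWord.Frame

variable {𝒯 : X → Sys G K} {W : Word G} {β : W.dom → ℚ} (R : Replacement 𝒯 W β)
  (P : R.F.Palette) (s : R.F.Cls → ℕ)

/-- The system formed by `W` and the sum. -/
noncomputable abbrev sys : Sys G K :=
  ⟨W, P.word s, fun a u => R.r (cp u).1 (R.e (block u) a) (cp u).2 ∧ β a = block u⟩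

theorem sys_rel_pos (q : ℚ) (p : (R.F.Y (R.F.rep q)).dom) (a : W.dom) :
    (R.sys P s).rel a (R.F.pos q p) ↔ R.r (R.F.rep q) (R.e q a) p ∧ β a = q := Iff.rfl

theorem models (hne : ∀ q, ∃ a, β a = q) : R.F.Models W β := by
  intro q q' h
  have : Nonempty W.dom := ⟨(hne 0).choose⟩
  have h1 := (R.smap q').invFunOn
  have h2 := (R.smap q').smono.injOn.invFunOn_image subset_rfl
  rw [R.image q', ← h, ← R.image q] at h1 h2
  refine ⟨fun a => Function.invFunOn (R.e q') {a | β a = q'} (R.e q a), ?_, ?_⟩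
  · have := h1.comp (R.smap q)
    rwa [mul_comm] at this
  · rw [← Set.image_image (Function.invFunOn (R.e q') {a | β a = q'}), h2]

theorem match_block [Nonempty W.dom] (hβ : Monotone β) (q : ℚ) :
    Match (R.F.ε q) (⟨W, R.F.Y (R.F.rep q), R.r (R.F.rep q)⟩ : Sys G K) (R.sys P s)
      {a | β a = R.F.rep q} Set.univ
      (Function.invFunOn (R.e q) {a | β a = q} : W.dom → W.dom) (R.F.pos q) ∧
    Function.invFunOn (R.e q) {a | β a = q} '' {a | β a = R.F.rep q} = {a | β a = q} := by
  have h1 := (R.smap q).invFunOn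
  have h2 := (R.smap q).smono.injOn.invFunOn_image subset_rfl
  have h3 : ∀ a, β a = q → Function.invFunOn (R.e q) {a | β a = q} (R.e q a) = a := fun a ha =>
    (R.smap q).smono.injOn.leftInvOn_invFunOn ha
  have h4 : ∀ b, β b = R.F.rep q → ∃ a, β a = q ∧ R.e q a = b := by
    intro b hb
    have : b ∈ R.e q '' {a | β a = q} := by
      rw [R.image q]
      exact hb
    exact this
  rw [R.image q] at h1 h2
  refine ⟨⟨h1.smono, smono_pos q, ordConnected_fiber hβ _, Set.ordConnected_univ, ?_, ?_, ?_, ?_, ?_,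
    ?_, ?_, ?_, ?_⟩, h2⟩
  · rw [h2]
    exact ordConnected_fiber hβ _
  · rw [image_pos]
    exact ordConnected_fiber block_mono _
  · convert Set.finite_empty
    exact Set.eq_empty_of_forall_notMem fun a ha => ha.2 (h1.letter a ha.1)
  · refine ((R.F.Y (R.F.rep q)).truncDom (Encodable.encode (R.F.rep q))).finite_toSet.subset ?_
    rintro p ⟨-, hp⟩
    rw [Finset.mem_coe, Word.mem_truncDom_iff_idx]
    by_contra hlt
    exact hp ((P.smap_pos s q).letter p (not_le.1 hlt))
  · rintro b hb p -
    obtain ⟨a, ha, rfl⟩ := h4 b hb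
    rw [sys_rel_pos, h3 a ha]
    exact ⟨fun h => ⟨h, ha⟩, fun h => h.1⟩
  · exact fun _ _ _ _ => trivial
  · exact fun p _ a h => (R.isBlock _).rel_mem a p h
  · rintro b hb u ⟨-, hu⟩
    rw [image_pos]
    have h5 := Set.mem_image_of_mem (Function.invFunOn (R.e q) {a | β a = q}) hb
    rw [h2] at h5
    exact hu.symm.trans h5
  · rintro p - a ⟨-, ha⟩
    rw [h2]
    exact ha

theorem pieced (hβ : Monotone β) (hne : ∀ q, ∃ a, β a = q) (q : ℚ) :
    (R.sys P s).Pieced 𝒯 {a | β a = q} := by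
  have : Nonempty W.dom := ⟨(hne 0).choose⟩
  obtain ⟨m, h⟩ := R.match_block P s hβ q
  have := m.pieced_image (R.isBlock _).pieced
  rwa [h] at this

theorem pieced_swap (hβ : Monotone β) (hne : ∀ q, ∃ a, β a = q) (q : ℚ) :
    (R.sys P s).swap.Pieced (fun x => (𝒯 x).swap) {u : R.F.Pos | block u = q} := by
  have : Nonempty W.dom := ⟨(hne 0).choose⟩
  obtain ⟨m, -⟩ := R.match_block P s hβ q
  exact image_pos (F := R.F) q ▸ m.swap.pieced_image (R.isBlock _).pieced_swap

theorem exists_rel (hne : ∀ q, ∃ a, β a = q) (q : ℚ) :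
    ∃ (a : W.dom) (u : R.F.Pos), β a = q ∧ block u = q ∧ (R.sys P s).rel a u := by
  obtain ⟨b, p, hbp⟩ := (R.isBlock (R.F.rep q)).nonempty (hne _)
  have hb : b ∈ {a | β a = R.F.rep q} := (R.isBlock _).rel_mem b p hbp
  rw [← R.image q] at hb
  obtain ⟨a, ha, rfl⟩ := hb
  exact ⟨a, R.F.pos q p, ha, rfl, hbp, ha⟩

/-- For closeness: an interval meeting two blocks contains a whole block between them and so a
related point; an infinite interval inside one block is covered by closeness of the translated
block. -/
theorem coiRel (hβ : Monotone β) (hne : ∀ q, ∃ a, β a = q) : CoiRel (R.sys P s).rel := by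
  refine ⟨?_, ?_, ?_⟩
  · intro a b (u : R.F.Pos) (w : R.F.Pos) hau hbw
    have hu := hau.2
    have hw := hbw.2
    rcases lt_trichotomy (block u) (block w) with h | h | h
    · exact ⟨fun _ => lt_of_index_lt block_mono h,
        fun _ => lt_of_index_lt hβ (by rwa [hu, hw])⟩
    · obtain ⟨q, hq⟩ : ∃ q, block u = q := ⟨_, rfl⟩
      obtain ⟨p, rfl⟩ := exists_pos_of_eq hq
      obtain ⟨p', rfl⟩ := exists_pos_of_eq (h.symm.trans hq)
      have ha : a ∈ {a | β a = q} := hu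
      have hb : b ∈ {a | β a = q} := hw
      have h1 := (R.isBlock _).lt_iff _ _ _ _ hau.1 hbw.1
      have h2 := (R.isBlock _).lt_iff _ _ _ _ hbw.1 hau.1
      have h3 := R.smap q
      have h4 := pos_lt_pos (F := R.F) p p'
      refine Iff.trans ?_ h4.symm
      rcases Int.units_eq_one_or (R.F.ε q) with h5 | h5 <;> rw [h5] at h3 ⊢
      · rw [sLT_one, ← h3.smono.lt_iff ha hb]
        exact h1
      · rw [sLT_neg_one, ← h3.smono.lt_iff' hb ha]
        exact h2
    · exact ⟨fun h' => absurd h' (lt_asymm (lt_of_index_lt hβ (by rwa [hu, hw]))),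
        fun h' => absurd h' (lt_asymm (lt_of_index_lt block_mono h))⟩
  · intro I hI hinf
    by_cases hone : ∃ a ∈ I, ∃ b ∈ I, β a < β b
    · obtain ⟨a, ha, b, hb, hab⟩ := hone
      obtain ⟨q, h1, h2⟩ := exists_between hab
      obtain ⟨c, u, rfl, -, hcu⟩ := R.exists_rel P s hne q
      exact ⟨c, hI.out ha hb ⟨(lt_of_index_lt hβ h1).le, (lt_of_index_lt hβ h2).le⟩, u, hcu⟩
    · push Not at hone
      obtain ⟨a, ha⟩ := hinf.nonempty
      obtain ⟨q, hq⟩ : ∃ q, β a = q := ⟨_, rfl⟩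
      have hsub : I ⊆ {a | β a = q} := fun b hb =>
        (le_antisymm (hone a ha b hb) (hone b hb a ha)).trans hq
      have himg : (R.e q '' {a | β a = q}).OrdConnected := by
        rw [R.image q]
        exact ordConnected_fiber hβ _
      have hmem : R.e q '' I ⊆ {a | β a = R.F.rep q} := by
        rw [← R.image q]
        exact Set.image_mono hsub
      obtain ⟨_, ⟨c, hc, rfl⟩, p, hp⟩ := (R.isBlock (R.F.rep q)).close_left _ hmem
        ((R.smap q).smono.ordConnected_image himg hI hsub)
        (hinf.image ((R.smap q).smono.injOn.mono hsub))
      exact ⟨c, hc, R.F.pos q p, hp, hsub hc⟩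
  · intro (J : Set R.F.Pos) hJ hinf
    by_cases hone : ∃ a ∈ J, ∃ b ∈ J, block a < block b
    · obtain ⟨a, ha, b, hb, hab⟩ := hone
      obtain ⟨q, h1, h2⟩ := exists_between hab
      obtain ⟨c, u, -, rfl, hcu⟩ := R.exists_rel P s hne q
      exact ⟨u, hJ.out ha hb
        ⟨(lt_of_index_lt block_mono h1).le, (lt_of_index_lt block_mono h2).le⟩, c, hcu⟩
    · push Not at hone
      obtain ⟨a, ha⟩ := hinf.nonempty
      obtain ⟨q, hq⟩ : ∃ q, block a = q := ⟨_, rfl⟩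
      have hsub : J ⊆ {a | block a = q} := fun b hb =>
        (le_antisymm (hone a ha b hb) (hone b hb a ha)).trans hq
      have him : R.F.pos q '' (R.F.pos q ⁻¹' J) = J := by
        refine Set.image_preimage_eq_of_subset fun u hu => ?_
        obtain ⟨p, rfl⟩ := exists_pos_of_eq (hsub hu)
        exact ⟨p, rfl⟩
      have hconn : (R.F.pos q ⁻¹' J).OrdConnected := by
        have := (smono_pos (F := R.F) q).ordConnected_preimage Set.ordConnected_univ hJ
        rwa [Set.univ_inter] at this
      rw [← him] at hinf
      obtain ⟨p, hp, b, hb⟩ := (R.isBlock (R.F.rep q)).close_right _ hconn hinf.of_image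
      have hb' : b ∈ {a | β a = R.F.rep q} := (R.isBlock _).rel_mem b p hb
      rw [← R.image q] at hb'
      obtain ⟨c, hc, rfl⟩ := hb'
      exact ⟨_, hp, c, hb, hc⟩

theorem exists_smap_word {q q' : ℚ} {δ : ℤˣ} {f : W.dom → W.dom}
    (hf : Word.SMap δ W W f {a | β a = q}) (hfi : f '' {a | β a = q} = {a | β a = q'}) :
    ∃ g : R.F.Pos → R.F.Pos, Word.SMap δ (P.word s) (P.word s) g {u | block u = q} ∧
      g '' {u | block u = q} = {u | block u = q'} := by
  obtain ⟨h1, h2⟩ := R.sign q q' δ f hf hfi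
  obtain ⟨g, -, h3, h4⟩ := P.exists_smap_shift s h1
  rw [h2, mul_assoc, Int.units_mul_self, mul_one] at h3
  exact ⟨g, h3, h4⟩

/-- The fresh letter at a marked position determines the representative and the sign, so fresh
letters create no isomorphisms of blocks beyond those coming from `W`. -/
theorem exists_smap_of_word (hne : ∀ q, ∃ a, β a = q) {q q' : ℚ} {δ : ℤˣ} {f : R.F.Pos → R.F.Pos}
    (hf : Word.SMap δ (P.word s) (P.word s) f {u | block u = q})
    (hfi : f '' {u | block u = q} = {u | block u = q'}) :
    ∃ g : W.dom → W.dom, Word.SMap δ W W g {a | β a = q} ∧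
      g '' {a | β a = q} = {a | β a = q'} := by
  obtain ⟨m, hm⟩ := R.F.exists_mark
  have h1 : m q ∈ {u | block u = q} := (hm q).1
  have h2 : block (f (m q)) = q' := by
    have : f (m q) ∈ f '' {u | block u = q} := ⟨_, h1, rfl⟩
    rw [hfi] at this
    exact this
  obtain ⟨h3, -, h4⟩ := P.eq_of_letter_eq (hm q).2.1 (hf.letter _ h1)
  have h5 : R.F.rep q = R.F.rep q' := by
    rw [← h2, ← cp_fst, h3, cp_fst, (hm q).1]
  rw [h2, (hm q).1] at h4
  obtain ⟨g, h6, h7⟩ := R.models hne q q' h5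
  rw [h4, ← mul_assoc, Int.units_mul_self, one_mul] at h6
  exact ⟨g, h6, h7⟩

end Replacement

theorem exists_extension (hG : ∀ n (g : G n), orderOf g ≠ 2)
    (hK : ∀ n, ∃ k : K n, ¬ IsOfFinOrder k) (hX : Cardinal.mk X < Cardinal.continuum)
    {𝒯 : X → Sys G K} (h𝒯 : ∀ x, CoiRel (𝒯 x).rel) (hT : ∀ x, (𝒯 x).W.IsReduced)
    (hU : ∀ x, (𝒯 x).U.IsReduced) (hc : ∀ x y, (𝒯 x).CohOn (𝒯 y) Set.univ Set.univ)
    (hc' : ∀ x y, (𝒯 x).swap.CohOn (𝒯 y).swap Set.univ Set.univ) {W : Word G} (hW : W.IsReduced)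
    {I : ℚ → Set W.dom} (hI : IsRatBlockDecomp W (Fine fun x => (𝒯 x).W) I) :
    ∃ (U : Word K) (Γ : W.dom → U.dom → Prop), U.IsReduced ∧ CoiRel Γ ∧
      (Sys.mk W U Γ).CohOn ⟨W, U, Γ⟩ Set.univ Set.univ ∧
      (Sys.mk W U Γ).swap.CohOn (Sys.mk W U Γ).swap Set.univ Set.univ ∧
      (∀ x, (Sys.mk W U Γ).CohOn (𝒯 x) Set.univ Set.univ) ∧
      ∀ x, (Sys.mk W U Γ).swap.CohOn (𝒯 x).swap Set.univ Set.univ := by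
  obtain ⟨β, hβ, hβI⟩ := hI.concat.exists_index
  obtain rfl : I = fun q => {a | β a = q} := funext hβI
  have hne : ∀ q, ∃ a, β a = q := hI.nonempty
  obtain ⟨R⟩ := exists_replacement hG h𝒯 hT hU hW hβ hne hI.mem
  obtain ⟨P⟩ := R.F.exists_palette hK
  obtain ⟨s, hs⟩ := P.exists_intrinsicBlocks hX fun x => (𝒯 x).U
  have hcoi := R.coiRel P s hβ hne
  have hint := Word.intrinsicBlocks_of_isRatBlockDecomp hT hW hβ hI
  have hcoi' : CoiRel (R.sys P s).swap.rel := hcoi.swap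
  have h𝒯' : ∀ x, CoiRel (𝒯 x).swap.rel := fun x => (h𝒯 x).swap
  refine ⟨P.word s, (R.sys P s).rel, P.isReduced_word s hW hβ hne (R.models hne), hcoi, ?_, ?_, ?_, ?_⟩
  · refine cohOn_self (S := R.sys P s) (β := β) (β' := Frame.block) hcoi h𝒯 hc hβ Frame.block_mono
      (fun a u h => h.2) ?_ hint (R.pieced P s hβ hne) ?_
    · intro q
      obtain ⟨a, u, h1, -, h2⟩ := R.exists_rel P s hne q
      exact ⟨a, u, h1, h2⟩
    · exact fun q q' δ f hf hfi => R.exists_smap_word P s hf hfi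
  · refine cohOn_self (S := (R.sys P s).swap) (𝒯 := fun x => (𝒯 x).swap) (β := Frame.block)
      (β' := β) hcoi' h𝒯' hc' Frame.block_mono hβ (fun u a h => h.2.symm) ?_ hs
      (R.pieced_swap P s hβ hne) ?_
    · intro q
      obtain ⟨a, u, -, h1, h2⟩ := R.exists_rel P s hne q
      exact ⟨u, a, h1, h2⟩
    · exact fun q q' δ f hf hfi => R.exists_smap_of_word P s hne hf hfi
  · exact cohOn_other (S := R.sys P s) hcoi h𝒯 hc hint (R.pieced P s hβ hne)
  · exact cohOn_other (S := (R.sys P s).swap) (𝒯 := fun x => (𝒯 x).swap) hcoi' h𝒯' hc' hs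
      (R.pieced_swap P s hβ hne)

end Sys

/-! ### From systems back to coi triples -/

theorem CoiTriple.coherent_insert {X : Type*} {T : X → CoiTriple G K}
    (hT : Coherent (Set.range T)) {t : CoiTriple G K}
    (h1 : t.sys.CohOn t.sys Set.univ Set.univ)
    (h2 : t.sys.swap.CohOn t.sys.swap Set.univ Set.univ)
    (h3 : ∀ x, t.sys.CohOn (T x).sys Set.univ Set.univ)
    (h4 : ∀ x, t.sys.swap.CohOn (T x).sys.swap Set.univ Set.univ) :
    Coherent (insert t (Set.range T)) := by
  rw [coherent_iff] at hT ⊢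
  rintro a (rfl | ⟨x, rfl⟩) b (rfl | ⟨y, rfl⟩)
  · exact ⟨h1, h2⟩
  · exact ⟨h3 y, h4 y⟩
  · exact ⟨(h3 x).symm, (h4 x).symm⟩
  · exact hT _ ⟨x, rfl⟩ _ ⟨y, rfl⟩

theorem CoiRel.graph_eq {Λ Θ : Type*} [LinearOrder Λ] [LinearOrder Θ] {Γ : Λ → Θ → Prop}
    (h : CoiRel Γ) : h.toCoi.graph = Γ := by
  ext a x
  exact h.graph_toCoi a x

end InfWord

theorem mainTheorem4 {G K : ℕ → Type*} [∀ n, Group (G n)] [∀ n, Group (K n)]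
    (hG2 : ∀ n (g : G n), orderOf g ≠ 2) (hK2 : ∀ n (k : K n), orderOf k ≠ 2)
    (hG : ∀ n, ∃ g : G n, ¬ IsOfFinOrder g) (hK : ∀ n, ∃ k : K n, ¬ IsOfFinOrder k)
    {X : Type*} (hX : Cardinal.mk X < Cardinal.continuum)
    (T : X → InfWord.CoiTriple G K) (hT : InfWord.Coherent (Set.range T)) :
    (∀ (W : InfWord.Word G) (hW : W.IsReduced) (I : ℚ → Set W.dom),
      InfWord.IsRatBlockDecomp W (InfWord.Fine fun x => (T x).W) I →
      ∃ (U : InfWord.Word K) (hU : U.IsReduced) (ι : InfWord.Coi W.dom U.dom),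
        InfWord.Coherent (insert ⟨W, U, hW, hU, ι⟩ (Set.range T))) ∧
    (∀ (U : InfWord.Word K) (hU : U.IsReduced) (I : ℚ → Set U.dom),
      InfWord.IsRatBlockDecomp U (InfWord.Fine fun x => (T x).U) I →
      ∃ (W : InfWord.Word G) (hW : W.IsReduced) (ι : InfWord.Coi W.dom U.dom),
        InfWord.Coherent (insert ⟨W, U, hW, hU, ι⟩ (Set.range T))) := by
  have hc := fun x y => (InfWord.coherent_iff.1 hT) _ ⟨x, rfl⟩ _ ⟨y, rfl⟩
  constructor
  · intro W hW I hI
    obtain ⟨U, Γ, hU, hΓ, h1, h2, h3, h4⟩ := InfWord.Sys.exists_extension hG2 hK hX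
      (𝒯 := fun x => (T x).sys) (fun x => (T x).sys_coiRel) (fun x => (T x).reducedW)
      (fun x => (T x).reducedU) (fun x y => (hc x y).1) (fun x y => (hc x y).2) hW hI
    refine ⟨U, hU, hΓ.toCoi, ?_⟩
    have hsys : (InfWord.CoiTriple.mk W U hW hU hΓ.toCoi).sys = ⟨W, U, Γ⟩ := by
      rw [InfWord.CoiTriple.sys, hΓ.graph_eq]
    refine InfWord.CoiTriple.coherent_insert hT ?_ ?_ ?_ ?_ <;> rw [hsys] <;> assumption
  · intro U hU I hI
    -- The same extension applied to the interchanged systems; the resulting relation is turned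
    -- round again afterwards.
    obtain ⟨W, Γ, hW, hΓ, h1, h2, h3, h4⟩ := InfWord.Sys.exists_extension hK2 hG hX
      (𝒯 := fun x => (T x).sys.swap) (fun x => (T x).sys_coiRel.swap) (fun x => (T x).reducedU)
      (fun x => (T x).reducedW) (fun x y => (hc x y).2) (fun x y => (hc x y).1) hU hI
    have hΓ' := hΓ.swap
    refine ⟨W, hW, hΓ'.toCoi, ?_⟩
    have hsys : (InfWord.CoiTriple.mk W U hW hU hΓ'.toCoi).sys =
        (InfWord.Sys.mk U W Γ).swap := by
      rw [InfWord.CoiTriple.sys, hΓ'.graph_eq, InfWord.Sys.swap]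
    refine InfWord.CoiTriple.coherent_insert hT ?_ ?_ ?_ ?_ <;> rw [hsys] <;> assumption
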